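/- All graphs are simple. For a non-empty finite graph $G$ with $v(G)$ vertices let $m_k(G)$ be the number of matchings with $k$ edges, $\mathrm{pm}(G)$ the number of perfect matchings, $\nu(G)$ the size of a largest matching, $p^*(G)=2\nu(G)/v(G)$, and $$M(G,t)=\sum_{k} m_k(G)t^k,\qquad p(G,t)=\frac{2t\,M'(G,t)}{v(G)M(G,t)},\qquad F(G,t)=\frac{\ln M(G,t)}{v(G)}-\frac12\,p(G,t)\ln t .$$ Let $t(G,\cdot):[0,p^*(G))\to[0,\infty)$ be the inverse of $p(G,\cdot)$. The entropy function is $\lambda_G(p)=F(G,t(G,p))$ for $p<p^*(G)$, $\lambda_G(p^*(G))=\lim_{p\nearrow p^*(G)}\lambda_G(p)$ (with value $0$ if $G$ has no edges), and $\lambda_G(p)=0$ for $p>p^*(G)$. A $2$-lift of $G$ is a graph $H$ on $V(G)\times\{0,1\}$ in which, for every edge $uv$ of $G$, the edges between $\{u\}\times\{0,1\}$ and $\{v\}\times\{0,1\}$ are either exactly $(u,0)(v,0),\ (u,1)(v,1)$ or exactly $(u,0)(v,1),\ (u,1)(v,0)$, and which has no other edges. A sequence $(G_i)$ of non-empty finite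 graphs of uniformly bounded degree Benjamini--Schramm converges to a rooted graph $(T,o)$ if for every $r\ge1$ and every finite rooted graph $\alpha$ the probability that the $r$-ball around a uniformly random vertex of $G_i$ is isomorphic to $\alpha$ tends to $1$ if the $r$-ball of $T$ around $o$ is isomorphic to $\alpha$, and to $0$ otherwise. Let $d\ge1$ and let $\mathbb T_d$ be the (rooted) $d$-regular tree. For $0\le p<1$ let $\lambda_{\mathbb T_d}(p)$ be the common limit $\lim_i\lambda_{G_i}(p)$ over all sequences $(G_i)$ with $p^*(G_i)=1$ for all $i$ that Benjamini--Schramm converge to $\mathbb T_d$, and let $\lambda_{\mathbb T_d}(1)=\lim_{p\nearrow1}\lambda_{\mathbb T_d}(p)$. For $0\le p\le 1$ put (with $0\ln 0=0$ and $p\ln(d/p)=0$ at $p=0$) $$\mathbb G_d(p)=\frac12\left(p\ln\frac dp+(d-p)\ln\Bigl(1-\frac pd\Bigr)-2(1-p)\ln(1-p)\right).$$ \textbf{Theorem.} Let $d\ge 1$. (1) Sequences as in the definition of $\lambda_{\mathbb T_d}$ exist, for each $0\le p<1$ the limit $\lim_i\lambda_{G_i}(p)$ exists for all of them and does not depend on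 the sequence, $\lim_{p\nearrow1}\lambda_{\mathbb T_d}(p)$ exists, and $\lambda_{\mathbb T_d}(p)=\mathbb G_d(p)$ for all $0\le p\le1$. (2) If $G$ is a non-empty finite bipartite graph and $H$ is a $2$-lift of $G$, then $\lambda_H(p)\le\lambda_G(p)$ for all $0\le p\le1$. (3) For every non-empty finite $d$-regular graph $G$ there is a sequence $G=G_0,G_1,G_2,\dots$ such that $G_{i+1}$ is a $2$-lift of $G_i$ for every $i$ and $(G_i)$ Benjamini--Schramm converges to $\mathbb T_d$. (4) Let $G$ be a non-empty finite $d$-regular bipartite graph on $v(G)=2n$ vertices. Then $\lambda_G(p)\ge\lambda_{\mathbb T_d}(p)$ for all $0\le p\le1$; for every integer $0\le k\le n$, with $p=k/n$, we have $m_k(G)>0$ and $$\frac{\ln m_k(G)}{v(G)}\ \ge\ \mathbb G_d(p)-\frac{\ln v(G)}{v(G)};$$ and $$\mathrm{pm}(G)\ \ge\ \left(\frac{(d-1)^{d-1}}{d^{d-2}}\right)^{n},$$ where $0^0=1$ if $d=1$. -/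

import Mathlib

open Set Filter Topology

universe u v

noncomputable section

/-! ### Matchings of a finite graph -/

/-- A matching of `G`: a finite set of edges of `G` no two of which share a vertex. -/
def IsEdgeMatching {V : Type u} (G : SimpleGraph V) (M : Finset (Sym2 V)) : Prop :=
  (∀ e ∈ M, e ∈ G.edgeSet) ∧ ∀ e ∈ M, ∀ f ∈ M, e ≠ f → ∀ x : V, x ∈ e → x ∉ f

/-- `m_k(G)`, the number of matchings with exactly `k` edges. -/
def numMatchings {V : Type u} (G : SimpleGraph V) (k : ℕ) : ℕ :=
  {M : Finset (Sym2 V) | IsEdgeMatching G M ∧ M.card = k}.ncard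

/-- `pm(G)`, the number of matchings that cover every vertex. -/
def numPerfectMatchings {V : Type u} (G : SimpleGraph V) : ℕ :=
  {M : Finset (Sym2 V) | IsEdgeMatching G M ∧ ∀ x : V, ∃ e ∈ M, x ∈ e}.ncard

/-- `ν(G)`, the size of a largest matching. -/
def maxMatchingSize {V : Type u} (G : SimpleGraph V) : ℕ :=
  sSup {k : ℕ | ∃ M : Finset (Sym2 V), IsEdgeMatching G M ∧ M.card = k}

/-- `p^*(G) = 2 ν(G) / v(G)`. -/
def maxDensity {V : Type u} (G : SimpleGraph V) : ℝ :=
  2 * (maxMatchingSize G : ℝ) / (Nat.card V : ℝ)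

/-- The matching generating function `M(G, t) = ∑_{k ≤ v(G)/2} m_k(G) t^k`. -/
def matchingGen {V : Type u} (G : SimpleGraph V) (t : ℝ) : ℝ :=
  ∑ k ∈ Finset.range (Nat.card V / 2 + 1), (numMatchings G k : ℝ) * t ^ k

/-- The density function `p(G, t) = 2 t M'(G, t) / (v(G) M(G, t))`. -/
def densityFn {V : Type u} (G : SimpleGraph V) (t : ℝ) : ℝ :=
  2 * t * deriv (matchingGen G) t / ((Nat.card V : ℝ) * matchingGen G t)

/-- `F(G, t) = ln M(G, t) / v(G) - (1/2) p(G, t) ln t`; here `0 ln 0 = 0`. -/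
def freeEntropy {V : Type u} (G : SimpleGraph V) (t : ℝ) : ℝ :=
  Real.log (matchingGen G t) / (Nat.card V : ℝ) - 1 / 2 * densityFn G t * Real.log t

/-- `t(G, p)`, the inverse of the strictly increasing function
`p(G, ·) : [0, ∞) → [0, p^*(G))`. -/
def activity {V : Type u} (G : SimpleGraph V) (p : ℝ) : ℝ :=
  Function.invFunOn (densityFn G) (Set.Ici 0) p

/-- The entropy function `λ_G(p)`: it is `F(G, t(G, p))` for `p < p^*(G)`, the limit of these
values from the left for `p = p^*(G)`, and `0` for `p > p^*(G)`. -/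
def graphEntropy {V : Type u} (G : SimpleGraph V) (p : ℝ) : ℝ :=
  if p < maxDensity G then freeEntropy G (activity G p)
  else if p = maxDensity G then
    limUnder (𝓝[<] maxDensity G) (fun q => freeEntropy G (activity G q))
  else 0

/-! ### Two-lifts -/

/-- `H` is a `2`-lift of `G`: above an edge `xy` of `G` lie exactly the two parallel edges or
exactly the two crossing edges, and above a non-edge lies no edge. -/
def IsTwoLift {V : Type u} (G : SimpleGraph V) (H : SimpleGraph (V × Fin 2)) : Prop :=
  ∀ x y : V,
    (G.Adj x y →
      (H.Adj (x, 0) (y, 0) ∧ H.Adj (x, 1) (y, 1) ∧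
        ¬ H.Adj (x, 0) (y, 1) ∧ ¬ H.Adj (x, 1) (y, 0)) ∨
      (H.Adj (x, 0) (y, 1) ∧ H.Adj (x, 1) (y, 0) ∧
        ¬ H.Adj (x, 0) (y, 0) ∧ ¬ H.Adj (x, 1) (y, 1))) ∧
    (¬ G.Adj x y → ∀ i j : Fin 2, ¬ H.Adj (x, i) (y, j))

/-- The vertex set after `i` successive `2`-lifts. -/
def LiftVertex (V : Type u) : ℕ → Type u
  | 0 => V
  | i + 1 => LiftVertex V i × Fin 2

/-- `G_0 = G`, and `G_{i+1}` is a `2`-lift of `G_i` for every `i`. -/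
def IsTwoLiftSequence {V : Type u} (G : SimpleGraph V)
    (Gs : ∀ i : ℕ, SimpleGraph (LiftVertex V i)) : Prop :=
  Gs 0 = G ∧ ∀ i : ℕ, IsTwoLift (Gs i) (Gs (i + 1))

/-! ### Benjamini--Schramm convergence to a rooted graph -/

/-- The vertex set of the ball of radius `r` around `x`. -/
def graphBall {V : Type u} (G : SimpleGraph V) (x : V) (r : ℕ) : Set V :=
  {y : V | G.edist x y ≤ (r : ℕ∞)}

/-- The `r`-ball of `G` around `x`, with root `x`, is isomorphic to the finite rooted
graph `(α, a)`. -/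
def BallIso {V : Type u} (G : SimpleGraph V) (x : V) (r : ℕ) {m : ℕ}
    (α : SimpleGraph (Fin m)) (a : Fin m) : Prop :=
  ∃ φ : α ≃g G.induce (graphBall G x r), (φ a : V) = x

/-- `ℙ(G, α, r)`: the probability that the `r`-ball around a uniformly random vertex of the
finite graph `G` is isomorphic to `(α, a)`. -/
def ballProb {V : Type u} (G : SimpleGraph V) {m : ℕ} (α : SimpleGraph (Fin m)) (a : Fin m)
    (r : ℕ) : ℝ :=
  ({x : V | BallIso G x r α a}.ncard : ℝ) / (Nat.card V : ℝ)

open Classical in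
/-- `ℙ(L, α, r)` when `L` is the rooted graph `(T, o)` with probability `1`. -/
def rootedBallProb {W : Type v} (T : SimpleGraph W) (o : W) {m : ℕ} (α : SimpleGraph (Fin m))
    (a : Fin m) (r : ℕ) : ℝ :=
  if BallIso T o r α a then 1 else 0

/-- The sequence `(G_i)` consists of non-empty finite graphs, has uniformly bounded degrees, and
Benjamini--Schramm converges to the rooted graph `(T, o)`. -/
def BSConvergesTo {V : ℕ → Type u} (G : ∀ i : ℕ, SimpleGraph (V i)) {W : Type v}
    (T : SimpleGraph W) (o : W) : Prop :=
  (∀ i : ℕ, Finite (V i) ∧ Nonempty (V i)) ∧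
  (∃ D : ℕ, ∀ (i : ℕ) (x : V i), ((G i).neighborSet x).ncard ≤ D) ∧
  ∀ r : ℕ, 0 < r → ∀ (m : ℕ) (α : SimpleGraph (Fin m)) (a : Fin m),
    Tendsto (fun i => ballProb (G i) α a r) atTop (𝓝 (rootedBallProb T o α a r))

/-- For `p < p₀`, the number `l` is the entropy of the limit graph `(T, o)` at `p`: there is a
sequence `(G_i)` with `p^*(G_i) ≥ p₀` for all `i` that Benjamini--Schramm converges to `(T, o)`,
and for every such sequence `λ_{G_i}(p) → l`. -/
def IsLimitEntropy {W : Type v} (T : SimpleGraph W) (o : W) (p₀ p l : ℝ) : Prop :=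
  (∃ (V : ℕ → Type) (G : ∀ i : ℕ, SimpleGraph (V i)),
    BSConvergesTo G T o ∧ ∀ i : ℕ, p₀ ≤ maxDensity (G i)) ∧
  ∀ (V : ℕ → Type) (G : ∀ i : ℕ, SimpleGraph (V i)),
    BSConvergesTo G T o → (∀ i : ℕ, p₀ ≤ maxDensity (G i)) →
      Tendsto (fun i => graphEntropy (G i) p) atTop (𝓝 l)

open Classical in
/-- The entropy function of the limit graph `(T, o)` on `[0, p₀]`: for `p < p₀` the common limit
in `IsLimitEntropy`, and at `p₀` the limit of these values from the left. -/
def limitEntropy {W : Type v} (T : SimpleGraph W) (o : W) (p₀ p : ℝ) : ℝ :=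
  if p < p₀ then Classical.epsilon (IsLimitEntropy T o p₀ p)
  else limUnder (𝓝[<] p₀) (fun q => Classical.epsilon (IsLimitEntropy T o p₀ q))

/-! ### The regular tree -/

/-- Vertices of the `d`-regular tree: words over `d` letters without equal consecutive letters. -/
abbrev TreeVertex (d : ℕ) : Type :=
  {l : List (Fin d) // l.IsChain (· ≠ ·)}

/-- The `d`-regular tree `𝕋_d`: two words are adjacent if one of them arises from the other by
putting one letter in front. -/
def regularTree (d : ℕ) : SimpleGraph (TreeVertex d) where
  Adj x y := (∃ c : Fin d, y.1 = c :: x.1) ∨ (∃ c : Fin d, x.1 = c :: y.1)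
  symm := ⟨fun _ _ h => h.symm⟩
  loopless := ⟨fun x h => by
    rcases h with ⟨c, hc⟩ | ⟨c, hc⟩ <;> exact absurd hc (by simp)⟩

/-- The root of the `d`-regular tree, the empty word. -/
def treeRoot (d : ℕ) : TreeVertex d := ⟨[], by simp⟩

/-- The entropy function `λ_{𝕋_d}(p)`, `0 ≤ p ≤ 1`, of the `d`-regular tree. -/
def treeEntropy (d : ℕ) (p : ℝ) : ℝ :=
  limitEntropy (regularTree d) (treeRoot d) 1 p

/-- `𝔾_d(p) = (1/2) (p ln (d/p) + (d - p) ln (1 - p/d) - 2 (1 - p) ln (1 - p))`, with the usual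
convention `0 ln 0 = 0`. -/
def gurvitsFn (d : ℕ) (p : ℝ) : ℝ :=
  1 / 2 * (p * Real.log (d / p) + (d - p) * Real.log (1 - p / d)
    - 2 * (1 - p) * Real.log (1 - p))

end

set_option linter.unusedSectionVars false

noncomputable section

/-! ### Matchings that avoid a vertex set, and the vertex recursion -/

section AvoidingMatchings
open scoped Classical

variable {V : Type u} {G : SimpleGraph V}

/-! The entropy is a Legendre transform. Since `ln M(G, e^s)` is convex in `s`, for `0 ≤ p ≤ p^*(G)`
the value `λ_G(p)` is the infimum over `s > 0` of `ln M(G, s) / v(G) - (p / 2) ln s`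
(`isGLB_graphEntropy`). At `p = p^*(G)` this infimum is `ln m_ν(G) / v(G)`. Inequalities between
matching generating functions thus pass to entropies without inverting the density.

Monotonicity under a 2-lift `H` of a bipartite `G` then reduces to `M(H, t) ≤ M(G, t)^2`
(`matchingGen_twoLift_le`) and `p^*(H) ≤ p^*(G)`. Project a matching of `H` to a multiset of edges
of `G`. Its edges of multiplicity one form paths and cycles, and the cycles are even because `G` is
bipartite. Over each such component there are at most two possible lifts, while the component splits
into two alternating matchings whose roles can be exchanged. Comparing every lift with one fixed
reference lift gives an injection from the matchings of `H` with a given projection into the pairs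
of matchings of `G` with that sum (`card_fiber_le`).

For the limit, the probability that a vertex is uncovered obeys a recursion along the graph. On a
large tree ball the recursion confines this probability between bounds that converge to a common
value, whatever the graph looks like outside (`tendsto_cavityBounds`). Averaging over vertices gives
the limit of `p(G_i, t)`, integrating `p / (2t)` gives the limit of `ln M / v`, and the Legendre
transform turns this into `𝔾_d` (`tendsto_graphEntropy_of_BS`).

Lifts without short cycles come from voltages supported on single edges. A closed non-backtracking
walk that survives all these lifts uses every edge an even number of times, so it contains a closed
non-backtracking walk of at most half its length. One round of lifts therefore roughly doubles the
length below which there are no such walks (`exists_noShortNB_liftState`), and the resulting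
sequence converges to the tree. For a `d`-regular bipartite graph Hall's condition gives `p^* = 1`
along the sequence, and the entropy decreases along it to `𝔾_d`, hence starts above it
(`gurvitsFn_le_graphEntropy`).

Single coefficients are reached through Heilmann--Lieb: the zeros of `M(G, ·)` are real and
negative, so `m_k` is log-concave. At the activity where the mean matching size is `k`, the term
`m_k t^k` carries at least the fraction `1 / (n + 1)` of `M(G, t)` (`IsLogConcave.sum_le_of_mean`).
At `p = 1` the entropy is exactly `ln pm(G) / v(G)`, so no error term occurs there. -/

lemma IsEdgeMatching.eq_of_mem {N : Finset (Sym2 V)} (h : IsEdgeMatching G N) {e f : Sym2 V}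
    (he : e ∈ N) (hf : f ∈ N) {x : V} (hxe : x ∈ e) (hxf : x ∈ f) : e = f := by
  by_contra hne
  exact h.2 e he f hf hne x hxe hxf

lemma IsEdgeMatching.mono {N N' : Finset (Sym2 V)} (h : IsEdgeMatching G N) (hs : N' ⊆ N) :
    IsEdgeMatching G N' :=
  ⟨fun e he => h.1 e (hs he), fun e he f hf => h.2 e (hs he) f (hs hf)⟩

lemma isEdgeMatching_empty : IsEdgeMatching G ∅ := ⟨by simp, by simp⟩

/-- The vertices covered by a set of edges. -/
def coveredSet (N : Finset (Sym2 V)) : Set V := {x | ∃ e ∈ N, x ∈ e}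

lemma IsEdgeMatching.ncard_coveredSet [Finite V] {N : Finset (Sym2 V)}
    (h : IsEdgeMatching G N) : (coveredSet N).ncard = 2 * N.card := by
  cases nonempty_fintype V
  have h1 : coveredSet N = ((N.biUnion Sym2.toFinset : Finset V) : Set V) := by
    ext x; simp [coveredSet]
  rw [h1, Set.ncard_coe_finset, Finset.card_biUnion]
  · rw [Finset.sum_congr rfl (g := fun _ => 2), Finset.sum_const, smul_eq_mul, mul_comm]
    intro e he
    exact Sym2.card_toFinset_of_not_isDiag e (G.not_isDiag_of_mem_edgeSet (h.1 e he))
  · intro e he f hf hne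
    rw [Function.onFun, Finset.disjoint_left]
    intro x hx hx'
    exact h.2 e he f hf hne x (by simpa using hx) (by simpa using hx')

lemma IsEdgeMatching.two_mul_card_le [Finite V] {N : Finset (Sym2 V)} (h : IsEdgeMatching G N) :
    2 * N.card ≤ Nat.card V := by
  rw [← h.ncard_coveredSet]
  exact Set.ncard_le_card _

variable [Fintype V]

/-- The matchings of `G` that cover no vertex of `S`. -/
def avoidingMatchings (G : SimpleGraph V) (S : Set V) : Finset (Finset (Sym2 V)) :=
  Finset.univ.filter (fun N => IsEdgeMatching G N ∧ ∀ e ∈ N, ∀ x ∈ S, x ∉ e)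

lemma mem_avoidingMatchings {S : Set V} {N : Finset (Sym2 V)} :
    N ∈ avoidingMatchings G S ↔ IsEdgeMatching G N ∧ ∀ e ∈ N, ∀ x ∈ S, x ∉ e := by
  simp [avoidingMatchings]

/-- The neighbours of `x` outside `S`. -/
def freeNeighbors (G : SimpleGraph V) (S : Set V) (x : V) : Finset V :=
  Finset.univ.filter (fun u => G.Adj x u ∧ u ∉ S)

lemma mem_freeNeighbors {S : Set V} {x u : V} :
    u ∈ freeNeighbors G S x ↔ G.Adj x u ∧ u ∉ S := by
  simp [freeNeighbors]

variable {R : Type*} [CommSemiring R]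

/-- The matching generating function of the graph induced on the complement of `S`. -/
def avoidSum (G : SimpleGraph V) (S : Set V) (t : R) : R :=
  ∑ N ∈ avoidingMatchings G S, t ^ N.card

/-- The same sum is used over `ℝ`, over `ℂ` and with the polynomial variable as activity; this lemma
moves between the three. -/
lemma map_avoidSum {R' : Type*} [CommSemiring R'] (f : R →+* R') (S : Set V) (t : R) :
    f (avoidSum G S t) = avoidSum G S (f t) := by
  simp [avoidSum]

/-- Sort by the fate of `x`: either it is uncovered, or exactly one edge `xu` covers it, and erasing
that edge leaves a matching that also avoids `x` and `u`. -/
lemma avoidingMatchings_eq_union {S : Set V} {x : V} (hx : x ∉ S) :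
    avoidingMatchings G S = avoidingMatchings G (insert x S) ∪
      (freeNeighbors G S x).biUnion (fun u =>
        (avoidingMatchings G (insert u (insert x S))).image (insert s(x, u))) := by
  ext N
  simp only [Finset.mem_union, Finset.mem_biUnion, Finset.mem_image, mem_avoidingMatchings,
    mem_freeNeighbors]
  constructor
  · rintro ⟨hN, hS⟩
    by_cases hc : ∃ e ∈ N, x ∈ e
    · right
      obtain ⟨e, he, hxe⟩ := hc
      obtain ⟨u, rfl⟩ := hxe
      have hadj : G.Adj x u := hN.1 _ he
      refine ⟨u, ⟨hadj, fun hu => hS _ he u hu (by simp)⟩, N.erase s(x, u),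
        ⟨hN.mono (Finset.erase_subset _ _), ?_⟩, Finset.insert_erase he⟩
      intro f hf y hy
      rw [Finset.mem_erase] at hf
      rcases hy with rfl | rfl | hy
      · exact hN.2 _ he f hf.2 hf.1.symm y (by simp)
      · exact hN.2 _ he f hf.2 hf.1.symm y (by simp)
      · exact hS f hf.2 y hy
    · left
      push Not at hc
      refine ⟨hN, ?_⟩
      rintro e he y (rfl | hy)
      · exact hc e he
      · exact hS e he y hy
  · rintro (⟨hN, hS⟩ | ⟨u, ⟨hadj, hu⟩, N', ⟨hN, hS⟩, rfl⟩)
    · exact ⟨hN, fun e he y hy => hS e he y (Or.inr hy)⟩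
    · refine ⟨⟨?_, ?_⟩, ?_⟩
      · intro e he
        rcases Finset.mem_insert.1 he with rfl | he
        · exact hadj
        · exact hN.1 e he
      · intro e he f hf hne y hye hyf
        rcases Finset.mem_insert.1 he with rfl | he' <;> rcases Finset.mem_insert.1 hf with rfl | hf'
        · exact hne rfl
        · rcases Sym2.mem_iff.1 hye with rfl | rfl
          · exact hS f hf' y (by simp) hyf
          · exact hS f hf' y (by simp) hyf
        · rcases Sym2.mem_iff.1 hyf with rfl | rfl
          · exact hS e he' y (by simp) hye
          · exact hS e he' y (by simp) hye
        · exact hN.2 e he' f hf' hne y hye hyf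
      · intro e he y hy hye
        rcases Finset.mem_insert.1 he with rfl | he
        · rcases Sym2.mem_iff.1 hye with rfl | rfl
          · exact hx hy
          · exact hu hy
        · exact hS e he y (by simp [hy]) hye

/-- This recursion drives both the location of the complex zeros and the local analysis on tree
balls. -/
lemma avoidSum_recursion {S : Set V} {x : V} (hx : x ∉ S) (t : R) :
    avoidSum G S t = avoidSum G (insert x S) t +
      t * ∑ u ∈ freeNeighbors G S x, avoidSum G (insert u (insert x S)) t := by
  have hnot : ∀ u, ∀ N ∈ avoidingMatchings G (insert u (insert x S)), s(x, u) ∉ N := by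
    intro u N hN h
    exact (mem_avoidingMatchings.1 hN).2 _ h u (by simp) (by simp)
  rw [avoidSum, avoidingMatchings_eq_union hx, Finset.sum_union, Finset.sum_biUnion]
  · congr 1
    rw [Finset.mul_sum]
    refine Finset.sum_congr rfl fun u hu => ?_
    rw [Finset.sum_image, avoidSum, Finset.mul_sum]
    · refine Finset.sum_congr rfl fun N hN => ?_
      rw [Finset.card_insert_of_notMem (hnot u N hN), pow_succ']
    · intro N hN N' hN' h
      rw [← Finset.erase_insert (hnot u N hN), h, Finset.erase_insert (hnot u N' hN')]
  · intro u hu u' hu' hne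
    rw [Function.onFun, Finset.disjoint_left]
    intro N h h'
    obtain ⟨N₁, h₁, rfl⟩ := Finset.mem_image.1 h
    obtain ⟨N₂, h₂, he⟩ := Finset.mem_image.1 h'
    have hmem : s(x, u') ∈ insert s(x, u) N₁ := by rw [← he]; simp
    rcases Finset.mem_insert.1 hmem with hmem | hmem
    · exact hne (Sym2.congr_right.1 hmem).symm
    · exact (mem_avoidingMatchings.1 h₁).2 _ hmem x (by simp) (by simp)
  · rw [Finset.disjoint_left]
    intro N h h'
    obtain ⟨u, hu, h'⟩ := Finset.mem_biUnion.1 h'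
    obtain ⟨N₁, h₁, rfl⟩ := Finset.mem_image.1 h'
    exact (mem_avoidingMatchings.1 h).2 s(x, u) (by simp) x (by simp) (by simp)

lemma empty_mem_avoidingMatchings (S : Set V) : ∅ ∈ avoidingMatchings G S :=
  mem_avoidingMatchings.2 ⟨isEdgeMatching_empty, by simp⟩

lemma avoidSum_univ (t : R) : avoidSum G (Set.univ : Set V) t = 1 := by
  have : avoidingMatchings G Set.univ = {∅} := by
    ext N
    rw [mem_avoidingMatchings, Finset.mem_singleton]
    constructor
    · rintro ⟨-, h⟩
      rw [Finset.eq_empty_iff_forall_notMem]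
      intro e he
      induction e with | _ a b => exact h _ he a (Set.mem_univ _) (by simp)
    · rintro rfl
      exact ⟨isEdgeMatching_empty, by simp⟩
  simp [avoidSum, this]

lemma avoidSum_pos (S : Set V) {t : ℝ} (ht : 0 ≤ t) : 0 < avoidSum G S t :=
  Finset.sum_pos' (fun _ _ => by positivity) ⟨∅, empty_mem_avoidingMatchings S, by simp⟩

lemma avoidSum_anti {S S' : Set V} (h : S ⊆ S') {t : ℝ} (ht : 0 ≤ t) :
    avoidSum G S' t ≤ avoidSum G S t := by
  refine Finset.sum_le_sum_of_subset_of_nonneg ?_ fun _ _ _ => by positivity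
  intro N hN
  rw [mem_avoidingMatchings] at hN ⊢
  exact ⟨hN.1, fun e he x hx => hN.2 e he x (h hx)⟩

lemma numMatchings_eq_card (k : ℕ) :
    numMatchings G k = ((avoidingMatchings G ∅).filter (fun N => N.card = k)).card := by
  rw [numMatchings, ← Set.ncard_coe_finset]
  congr 1
  ext N
  simp [mem_avoidingMatchings]

lemma avoidSum_empty_eq_sum (t : R) :
    avoidSum G ∅ t =
      ∑ k ∈ Finset.range (Nat.card V / 2 + 1), (numMatchings G k : R) * t ^ k := by
  rw [avoidSum, ← Finset.sum_fiberwise_of_maps_to (g := Finset.card)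
    (t := Finset.range (Nat.card V / 2 + 1))]
  · refine Finset.sum_congr rfl fun k _ => ?_
    rw [numMatchings_eq_card, Finset.sum_congr rfl (g := fun _ => t ^ k), Finset.sum_const,
      nsmul_eq_mul]
    intro N hN
    rw [(Finset.mem_filter.1 hN).2]
  · intro N hN
    have := (mem_avoidingMatchings.1 hN).1.two_mul_card_le
    rw [Finset.mem_range]
    omega

lemma matchingGen_eq_avoidSum (t : ℝ) : matchingGen G t = avoidSum G ∅ t :=
  (avoidSum_empty_eq_sum t).symm

/-- Counting covered and uncovered vertices of all matchings. -/
lemma card_mul_avoidSum_empty (t : R) :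
    (Nat.card V : R) * avoidSum G ∅ t =
      2 * ∑ N ∈ avoidingMatchings G ∅, (N.card : R) * t ^ N.card +
        ∑ x : V, avoidSum G {x} t := by
  have h1 : ∑ x : V, avoidSum G {x} t =
      ∑ N ∈ avoidingMatchings G ∅, ((coveredSet N)ᶜ.ncard : R) * t ^ N.card := by
    have : ∀ x : V, avoidSum G {x} t =
        ∑ N ∈ avoidingMatchings G ∅, if x ∈ (coveredSet N)ᶜ then t ^ N.card else 0 := by
      intro x
      rw [avoidSum, ← Finset.sum_filter]
      refine Finset.sum_congr ?_ fun _ _ => rfl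
      ext N
      simp [mem_avoidingMatchings, coveredSet]
    rw [Finset.sum_congr rfl fun x _ => this x, Finset.sum_comm]
    refine Finset.sum_congr rfl fun N _ => ?_
    rw [← Finset.sum_filter, Finset.sum_const, nsmul_eq_mul, ← Set.ncard_coe_finset]
    congr 3
    ext x
    simp
  rw [h1, avoidSum, Finset.mul_sum, Finset.mul_sum, ← Finset.sum_add_distrib]
  refine Finset.sum_congr rfl fun N hN => ?_
  have h2 := (mem_avoidingMatchings.1 hN).1.ncard_coveredSet
  have h3 : 2 * N.card + (coveredSet N)ᶜ.ncard = Nat.card V := by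
    rw [← h2]; exact Set.ncard_add_ncard_compl _
  rw [← h3]
  push_cast
  ring

end AvoidingMatchings

/-! ### The entropy as an infimum over the activity -/

section Variational

variable {V : Type u} {G : SimpleGraph V} [Fintype V]

/-- `∑ |N| t^|N|` over all matchings `N`. -/
def weightedCardSum (G : SimpleGraph V) (t : ℝ) : ℝ :=
  ∑ N ∈ avoidingMatchings G ∅, (N.card : ℝ) * t ^ N.card

lemma matchingGen_pos {t : ℝ} (ht : 0 ≤ t) : 0 < matchingGen G t := by
  rw [matchingGen_eq_avoidSum]; exact avoidSum_pos _ ht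

lemma one_le_matchingGen {t : ℝ} (ht : 0 ≤ t) : 1 ≤ matchingGen G t := by
  rw [matchingGen_eq_avoidSum, ← avoidSum_univ (G := G) t]
  exact avoidSum_anti (Set.subset_univ _) ht

lemma matchingGen_zero : matchingGen G 0 = 1 := by
  rw [matchingGen_eq_avoidSum, avoidSum, Finset.sum_eq_single ∅]
  · simp
  · intro N _ hN
    exact zero_pow (by simpa using hN)
  · intro h; exact absurd (empty_mem_avoidingMatchings _) h

lemma hasDerivAt_matchingGen (t : ℝ) :
    HasDerivAt (matchingGen G)
      (∑ N ∈ avoidingMatchings G ∅, (N.card : ℝ) * t ^ (N.card - 1)) t := by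
  have : matchingGen G = fun t => ∑ N ∈ avoidingMatchings G ∅, t ^ N.card := by
    funext t; rw [matchingGen_eq_avoidSum, avoidSum]
  rw [this]
  exact HasDerivAt.fun_sum fun N _ => hasDerivAt_pow _ _

lemma continuous_matchingGen : Continuous (matchingGen G) :=
  continuous_iff_continuousAt.2 fun t => (hasDerivAt_matchingGen t).continuousAt

lemma mul_deriv_matchingGen (t : ℝ) :
    t * deriv (matchingGen G) t = weightedCardSum G t := by
  rw [(hasDerivAt_matchingGen t).deriv, weightedCardSum, Finset.mul_sum]
  refine Finset.sum_congr rfl fun N _ => ?_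
  rcases Nat.eq_zero_or_pos N.card with h | h
  · simp [h]
  · obtain ⟨k, hk⟩ := Nat.exists_eq_succ_of_ne_zero h.ne'
    rw [hk, Nat.succ_sub_one, pow_succ]; ring

lemma densityFn_eq (t : ℝ) :
    densityFn G t = 2 * weightedCardSum G t / ((Nat.card V : ℝ) * matchingGen G t) := by
  rw [densityFn, mul_assoc, mul_deriv_matchingGen]

lemma continuous_weightedCardSum : Continuous (weightedCardSum G) := by
  unfold weightedCardSum; fun_prop

lemma weightedCardSum_nonneg {t : ℝ} (ht : 0 ≤ t) : 0 ≤ weightedCardSum G t :=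
  Finset.sum_nonneg fun _ _ => by positivity

lemma weightedCardSum_zero : weightedCardSum G 0 = 0 := by
  refine Finset.sum_eq_zero fun N _ => ?_
  rcases Nat.eq_zero_or_pos N.card with h | h
  · simp [h]
  · rw [zero_pow h.ne', mul_zero]

lemma densityFn_zero : densityFn G 0 = 0 := by
  rw [densityFn_eq, weightedCardSum_zero]; simp

lemma densityFn_nonneg {t : ℝ} (ht : 0 ≤ t) : 0 ≤ densityFn G t := by
  rw [densityFn_eq]
  have := weightedCardSum_nonneg (G := G) ht
  have := (matchingGen_pos (G := G) ht).le
  positivity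

variable [Nonempty V]

lemma card_pos_real : (0 : ℝ) < Nat.card V := by
  exact_mod_cast Nat.card_pos

lemma continuousOn_densityFn : ContinuousOn (densityFn G) (Set.Ici 0) := by
  have : densityFn G = fun t =>
      2 * weightedCardSum G t / ((Nat.card V : ℝ) * matchingGen G t) := funext densityFn_eq
  rw [this]
  refine ContinuousOn.div ?_ ?_ ?_
  · exact (continuous_weightedCardSum.const_mul _).continuousOn
  · exact (continuous_matchingGen.const_mul _).continuousOn
  · intro t ht
    exact (mul_pos card_pos_real (matchingGen_pos ht)).ne'

lemma one_sub_densityFn {t : ℝ} (ht : 0 ≤ t) :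
    1 - densityFn G t =
      (∑ x : V, avoidSum G {x} t / avoidSum G ∅ t) / (Nat.card V : ℝ) := by
  have h := card_mul_avoidSum_empty (G := G) t
  have hv := card_pos_real (V := V)
  have hM := avoidSum_pos (G := G) ∅ ht
  rw [densityFn_eq, matchingGen_eq_avoidSum, ← Finset.sum_div, weightedCardSum]
  field_simp
  linarith

/-- Convexity of `log M(G, e^s)` in `s`. -/
lemma log_matchingGen_ge {s t : ℝ} (hs : 0 < s) (ht : 0 < t) :
    Real.log (matchingGen G t) / (Nat.card V : ℝ) +
        densityFn G t / 2 * (Real.log s - Real.log t) ≤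
      Real.log (matchingGen G s) / (Nat.card V : ℝ) := by
  have hv := card_pos_real (V := V)
  have hM := matchingGen_pos (G := G) ht.le
  set a := Real.log s - Real.log t with ha
  set μ := weightedCardSum G t / matchingGen G t with hμ
  have hd : densityFn G t / 2 = μ / (Nat.card V : ℝ) := by
    rw [densityFn_eq, hμ]; field_simp
  have hsa : s = t * Real.exp a := by
    rw [ha, Real.exp_sub, Real.exp_log hs, Real.exp_log ht]; field_simp
  have key : Real.exp (a * μ) * matchingGen G t ≤ matchingGen G s := by
    have h1 : matchingGen G s =
        ∑ N ∈ avoidingMatchings G ∅, t ^ N.card * Real.exp (a * N.card) := by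
      rw [matchingGen_eq_avoidSum, avoidSum]
      refine Finset.sum_congr rfl fun N _ => ?_
      rw [hsa, mul_pow, mul_comm a, Real.exp_nat_mul]
    have h2 : Real.exp (a * μ) * matchingGen G t =
        ∑ N ∈ avoidingMatchings G ∅,
          t ^ N.card * (Real.exp (a * μ) * (1 + a * (N.card - μ))) := by
      have h3 : weightedCardSum G t = μ * matchingGen G t := by rw [hμ]; field_simp
      have h4 : ∑ N ∈ avoidingMatchings G ∅,
          t ^ N.card * (Real.exp (a * μ) * (1 + a * (N.card - μ))) =
          Real.exp (a * μ) * ((1 - a * μ) * matchingGen G t + a * weightedCardSum G t) := by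
        rw [matchingGen_eq_avoidSum, avoidSum, weightedCardSum, Finset.mul_sum, Finset.mul_sum,
          ← Finset.sum_add_distrib, Finset.mul_sum]
        exact Finset.sum_congr rfl fun N _ => by ring
      rw [h4, h3]; ring
    rw [h1, h2]
    refine Finset.sum_le_sum fun N _ => ?_
    refine mul_le_mul_of_nonneg_left ?_ (by positivity)
    have h5 : Real.exp (a * N.card) = Real.exp (a * μ) * Real.exp (a * (N.card - μ)) := by
      rw [← Real.exp_add]; ring_nf
    rw [h5]
    refine mul_le_mul_of_nonneg_left ?_ (Real.exp_pos _).le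
    linarith [Real.add_one_le_exp (a * ((N.card : ℝ) - μ))]
  have h6 := Real.log_le_log (by positivity) key
  rw [Real.log_mul (Real.exp_pos _).ne' hM.ne', Real.log_exp] at h6
  rw [hd, div_mul_eq_mul_div, ← add_div]
  gcongr
  linarith

/-- The function whose infimum over `s > 0` is the entropy. -/
def entropyObjective (G : SimpleGraph V) (p s : ℝ) : ℝ :=
  Real.log (matchingGen G s) / (Nat.card V : ℝ) - p / 2 * Real.log s

/-- As a function of `log s` the objective is convex, and its slope at `log t` is `(p(G, t) - p) /
2`; this is the tangent line inequality. -/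
lemma entropyObjective_ge {s t : ℝ} (hs : 0 < s) (ht : 0 < t) (p : ℝ) :
    entropyObjective G p t + (densityFn G t - p) / 2 * (Real.log s - Real.log t) ≤
      entropyObjective G p s := by
  have := log_matchingGen_ge (G := G) hs ht
  unfold entropyObjective
  linarith

lemma densityFn_mono {s t : ℝ} (hs : 0 ≤ s) (hst : s ≤ t) : densityFn G s ≤ densityFn G t := by
  rcases hs.eq_or_lt with rfl | hs
  · rw [densityFn_zero]; exact densityFn_nonneg hst
  rcases hst.eq_or_lt with rfl | hlt
  · exact le_rfl
  have ht := hs.trans hlt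
  have h1 := log_matchingGen_ge (G := G) hs ht
  have h2 := log_matchingGen_ge (G := G) ht hs
  have h3 := Real.log_lt_log hs hlt
  by_contra! h
  nlinarith

lemma freeEntropy_eq_objective (t : ℝ) :
    freeEntropy G t = entropyObjective G (densityFn G t) t := by
  unfold freeEntropy entropyObjective; ring

/-- When `t > 0` the tangent at `t` is horizontal, so the infimum is attained there. When `t = 0` we
have `p = 0`, and the infimum is only the limit as `s → 0`. -/
lemma isGLB_objective_of_density {p t : ℝ} (ht : 0 ≤ t) (hp : densityFn G t = p) :
    IsGLB (entropyObjective G p '' Set.Ioi 0) (freeEntropy G t) := by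
  rcases ht.eq_or_lt with rfl | ht
  · rw [densityFn_zero] at hp
    subst hp
    have h0 : freeEntropy G 0 = 0 := by simp [freeEntropy, matchingGen_zero]
    have hobj : ∀ s, entropyObjective G 0 s =
        Real.log (matchingGen G s) / (Nat.card V : ℝ) := by
      intro s; simp [entropyObjective]
    rw [h0]
    constructor
    · rintro _ ⟨s, hs, rfl⟩
      rw [hobj]
      exact div_nonneg (Real.log_nonneg (one_le_matchingGen (le_of_lt hs))) (Nat.cast_nonneg _)
    · intro b hb
      have hlim : Tendsto (fun s => Real.log (matchingGen G s) / (Nat.card V : ℝ))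
          (𝓝[>] 0) (𝓝 0) := by
        have hc : ContinuousAt (fun s => Real.log (matchingGen G s) / (Nat.card V : ℝ)) 0 :=
          (continuous_matchingGen.continuousAt.log (by simp [matchingGen_zero])).div_const _
        have := hc.tendsto
        simp only [matchingGen_zero, Real.log_one, zero_div] at this
        exact this.mono_left nhdsWithin_le_nhds
      refine ge_of_tendsto hlim ?_
      filter_upwards [self_mem_nhdsWithin] with s hs
      rw [← hobj]
      exact hb ⟨s, hs, rfl⟩
  · refine IsLeast.isGLB ⟨⟨t, ht, by rw [freeEntropy_eq_objective, hp]⟩, ?_⟩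
    rintro _ ⟨s, hs, rfl⟩
    have := entropyObjective_ge (G := G) hs ht p
    rw [freeEntropy_eq_objective, hp]
    simpa [hp] using this

/-! ### Largest matchings -/

lemma maxMatchingSize_bdd :
    BddAbove {k : ℕ | ∃ M : Finset (Sym2 V), IsEdgeMatching G M ∧ M.card = k} := by
  refine ⟨Nat.card V, ?_⟩
  rintro _ ⟨M, hM, rfl⟩
  have := hM.two_mul_card_le
  omega

lemma IsEdgeMatching.card_le_max {N : Finset (Sym2 V)} (h : IsEdgeMatching G N) :
    N.card ≤ maxMatchingSize G :=
  le_csSup maxMatchingSize_bdd ⟨N, h, rfl⟩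

lemma exists_card_eq_max :
    ∃ N : Finset (Sym2 V), IsEdgeMatching G N ∧ N.card = maxMatchingSize G :=
  Nat.sSup_mem (s := {k : ℕ | ∃ M : Finset (Sym2 V), IsEdgeMatching G M ∧ M.card = k})
    ⟨0, ∅, isEdgeMatching_empty, rfl⟩ maxMatchingSize_bdd

lemma numMatchings_pos_iff {k : ℕ} :
    0 < numMatchings G k ↔ ∃ N : Finset (Sym2 V), IsEdgeMatching G N ∧ N.card = k := by
  rw [numMatchings, Set.ncard_pos]
  rfl

lemma numMatchings_max_pos : 0 < numMatchings G (maxMatchingSize G) :=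
  numMatchings_pos_iff.2 exists_card_eq_max

lemma numMatchings_pos_of_le {k : ℕ} (hk : k ≤ maxMatchingSize G) : 0 < numMatchings G k := by
  obtain ⟨N, hN, hc⟩ := exists_card_eq_max (G := G)
  obtain ⟨N', hs, hc'⟩ := Finset.exists_subset_card_eq (hc ▸ hk)
  exact numMatchings_pos_iff.2 ⟨N', hN.mono hs, hc'⟩

lemma maxDensity_nonneg : 0 ≤ maxDensity G := by unfold maxDensity; positivity

/-- `M(G, s) / s^ν` as a polynomial in `1 / s`. -/
def reverseGen (G : SimpleGraph V) (y : ℝ) : ℝ :=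
  ∑ N ∈ avoidingMatchings G ∅, y ^ (maxMatchingSize G - N.card)

lemma pow_eq_inv_pow_mul {s : ℝ} (hs : 0 < s) {a b : ℕ} (h : a ≤ b) :
    s ^ a = s⁻¹ ^ (b - a) * s ^ b := by
  obtain ⟨c, rfl⟩ := Nat.exists_eq_add_of_le h
  rw [Nat.add_sub_cancel_left, pow_add, inv_pow]
  field_simp

lemma matchingGen_eq_reverse {s : ℝ} (hs : 0 < s) :
    matchingGen G s = reverseGen G s⁻¹ * s ^ maxMatchingSize G := by
  rw [matchingGen_eq_avoidSum, avoidSum, reverseGen, Finset.sum_mul]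
  exact Finset.sum_congr rfl fun N hN =>
    pow_eq_inv_pow_mul hs (mem_avoidingMatchings.1 hN).1.card_le_max

lemma zero_pow_sub_card {N : Finset (Sym2 V)} (h : N.card ≤ maxMatchingSize G) :
    (0 : ℝ) ^ (maxMatchingSize G - N.card) = if N.card = maxMatchingSize G then 1 else 0 := by
  split_ifs with h'
  · simp [h']
  · exact zero_pow (by omega)

lemma reverseGen_zero : reverseGen G 0 = numMatchings G (maxMatchingSize G) := by
  rw [reverseGen, numMatchings_eq_card, Finset.card_filter, Nat.cast_sum]
  refine Finset.sum_congr rfl fun N hN => ?_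
  rw [zero_pow_sub_card (mem_avoidingMatchings.1 hN).1.card_le_max]
  simp

lemma continuous_reverseGen : Continuous (reverseGen G) := by unfold reverseGen; fun_prop

/-- Dividing numerator and denominator by `t^ν` leaves polynomials in `1 / t`, and at `1 / t = 0`
only the largest matchings contribute. -/
lemma tendsto_densityFn : Tendsto (densityFn G) atTop (𝓝 (maxDensity G)) := by
  set A : ℝ → ℝ := fun y =>
    ∑ N ∈ avoidingMatchings G ∅, (N.card : ℝ) * y ^ (maxMatchingSize G - N.card) with hA
  have hAc : Continuous A := by rw [hA]; fun_prop
  have hA0 : A 0 = maxMatchingSize G * reverseGen G 0 := by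
    simp only [hA, reverseGen, Finset.mul_sum]
    refine Finset.sum_congr rfl fun N hN => ?_
    rw [zero_pow_sub_card (mem_avoidingMatchings.1 hN).1.card_le_max]
    split_ifs with h <;> simp [h]
  have hpos : (0 : ℝ) < reverseGen G 0 := by
    rw [reverseGen_zero]; exact_mod_cast numMatchings_max_pos
  have hv := card_pos_real (V := V)
  have h1 : Tendsto (fun s : ℝ => 2 * A s⁻¹ / (Nat.card V * reverseGen G s⁻¹)) atTop
      (𝓝 (2 * A 0 / (Nat.card V * reverseGen G 0))) := by
    have hc : ContinuousAt (fun y : ℝ => 2 * A y / (Nat.card V * reverseGen G y)) 0 := by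
      refine ContinuousAt.div ?_ ?_ (by positivity)
      · exact (hAc.const_mul _).continuousAt
      · exact (continuous_reverseGen.const_mul _).continuousAt
    exact hc.tendsto.comp tendsto_inv_atTop_zero
  have h2 : 2 * A 0 / (Nat.card V * reverseGen G 0) = maxDensity G := by
    rw [hA0, maxDensity]; field_simp
  rw [h2] at h1
  refine h1.congr' ?_
  filter_upwards [eventually_gt_atTop 0] with s hs
  have hw : weightedCardSum G s = A s⁻¹ * s ^ maxMatchingSize G := by
    simp only [hA, weightedCardSum, Finset.sum_mul]
    refine Finset.sum_congr rfl fun N hN => ?_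
    rw [mul_assoc, ← pow_eq_inv_pow_mul hs (mem_avoidingMatchings.1 hN).1.card_le_max]
  have hs' : s ^ maxMatchingSize G ≠ 0 := by positivity
  rw [densityFn_eq, hw, matchingGen_eq_reverse hs, ← mul_assoc, ← mul_assoc,
    mul_div_mul_right _ _ hs']

lemma exists_density_eq {p : ℝ} (hp0 : 0 ≤ p) (hp : p < maxDensity G) :
    ∃ t ∈ Set.Ici (0 : ℝ), densityFn G t = p := by
  obtain ⟨b, hb, hb0⟩ :=
    ((tendsto_densityFn.eventually (lt_mem_nhds hp)).and (eventually_ge_atTop 0)).exists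
  have := intermediate_value_Icc hb0 (continuousOn_densityFn.mono (Set.Icc_subset_Ici_self))
    (show p ∈ Set.Icc (densityFn G 0) (densityFn G b) from ⟨by rw [densityFn_zero]; exact hp0, hb.le⟩)
  obtain ⟨t, ht, h⟩ := this
  exact ⟨t, ht.1, h⟩

lemma activity_nonneg {p : ℝ} (hp0 : 0 ≤ p) (hp : p < maxDensity G) : 0 ≤ activity G p :=
  Function.invFunOn_mem (exists_density_eq hp0 hp)

lemma densityFn_activity {p : ℝ} (hp0 : 0 ≤ p) (hp : p < maxDensity G) :
    densityFn G (activity G p) = p :=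
  Function.invFunOn_eq (exists_density_eq hp0 hp)

lemma objective_maxDensity {s : ℝ} (hs : 0 < s) :
    entropyObjective G (maxDensity G) s =
      Real.log (reverseGen G s⁻¹) / (Nat.card V : ℝ) := by
  have hv := card_pos_real (V := V)
  have h : 0 < reverseGen G s⁻¹ := by
    have := matchingGen_pos (G := G) hs.le
    rw [matchingGen_eq_reverse hs] at this
    exact pos_of_mul_pos_left this (by positivity)
  rw [entropyObjective, matchingGen_eq_reverse hs, Real.log_mul h.ne' (by positivity),
    Real.log_pow, maxDensity]
  field_simp
  ring

lemma reverseGen_zero_le {y : ℝ} (hy : 0 ≤ y) : reverseGen G 0 ≤ reverseGen G y :=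
  Finset.sum_le_sum fun _ _ => pow_le_pow_left₀ le_rfl hy _

/-- At `p = p^*(G)` the term `(p / 2) ln s` cancels the leading power `s^ν` exactly, so the
objective decreases to its value at `1 / s = 0`. -/
lemma isGLB_objective_maxDensity :
    IsGLB (entropyObjective G (maxDensity G) '' Set.Ioi 0)
      (Real.log (numMatchings G (maxMatchingSize G)) / (Nat.card V : ℝ)) := by
  have hpos : (0 : ℝ) < reverseGen G 0 := by
    rw [reverseGen_zero]; exact_mod_cast numMatchings_max_pos
  rw [← reverseGen_zero]
  constructor
  · rintro _ ⟨s, hs, rfl⟩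
    rw [objective_maxDensity hs]
    have : reverseGen G 0 ≤ reverseGen G s⁻¹ := reverseGen_zero_le (inv_nonneg.2 (le_of_lt hs))
    gcongr
  · intro b hb
    have hlim : Tendsto (fun s : ℝ => Real.log (reverseGen G s⁻¹) / (Nat.card V : ℝ)) atTop
        (𝓝 (Real.log (reverseGen G 0) / (Nat.card V : ℝ))) := by
      have hc : ContinuousAt (fun y => Real.log (reverseGen G y) / (Nat.card V : ℝ)) 0 :=
        (continuous_reverseGen.continuousAt.log hpos.ne').div_const _
      exact hc.tendsto.comp tendsto_inv_atTop_zero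
    refine ge_of_tendsto hlim ?_
    filter_upwards [eventually_gt_atTop 0] with s hs
    rw [← objective_maxDensity hs]
    exact hb ⟨s, hs, rfl⟩

/-- The objective at one well-chosen `s` bounds the values from above, and it is continuous in the
density. From below, the objective at `p^*(G)` and activity `t(G, q)` is already at least the
claimed limit. -/
lemma tendsto_freeEntropy_maxDensity :
    Tendsto (fun q => freeEntropy G (activity G q)) (𝓝[<] maxDensity G)
      (𝓝 (Real.log (numMatchings G (maxMatchingSize G)) / (Nat.card V : ℝ))) := by
  rcases (maxDensity_nonneg (G := G)).eq_or_lt with h0 | hpos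
  · have hν : maxMatchingSize G = 0 := by
      have := h0.symm
      rw [maxDensity, div_eq_zero_iff] at this
      have hv := card_pos_real (V := V)
      rcases this with h | h
      · simpa using h
      · exact absurd h hv.ne'
    have hcard : ∀ N ∈ avoidingMatchings G ∅, N.card = 0 := fun N hN =>
      Nat.le_zero.1 (hν ▸ (mem_avoidingMatchings.1 hN).1.card_le_max)
    -- Without edges every `q` to the left of `p^*(G) = 0` is negative and is not a density, so the
    -- activity there is a default value. It does no harm, as the free entropy vanishes identically.
    have hF : ∀ t, freeEntropy G t = 0 := by
      intro t
      have h1 : matchingGen G t = matchingGen G 0 := by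
        rw [matchingGen_eq_avoidSum, matchingGen_eq_avoidSum, avoidSum, avoidSum]
        exact Finset.sum_congr rfl fun N hN => by simp [hcard N hN]
      have h2 : weightedCardSum G t = 0 :=
        Finset.sum_eq_zero fun N hN => by simp [hcard N hN]
      simp [freeEntropy, densityFn_eq, h1, h2, matchingGen_zero]
    have h3 : numMatchings G (maxMatchingSize G) = 1 := by
      have h1 := reverseGen_zero (G := G)
      have h2 := matchingGen_zero (G := G)
      rw [matchingGen_eq_avoidSum, avoidSum] at h2
      rw [reverseGen, hν] at h1
      rw [hν]
      have : ((numMatchings G 0 : ℕ) : ℝ) = 1 := by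
        rw [← h1, ← h2]
        exact Finset.sum_congr rfl fun N hN => by simp [hcard N hN]
      exact_mod_cast this
    simp [hF, h3]
  · have hlt : densityFn G 1 < maxDensity G := by
      have hM := matchingGen_pos (G := G) zero_le_one
      have hv := card_pos_real (V := V)
      rw [densityFn_eq, maxDensity, div_lt_div_iff₀ (by positivity) hv]
      have h1 : weightedCardSum G 1 < maxMatchingSize G * matchingGen G 1 := by
        rw [weightedCardSum, matchingGen_eq_avoidSum, avoidSum, Finset.mul_sum]
        refine Finset.sum_lt_sum (fun N hN => ?_) ⟨∅, empty_mem_avoidingMatchings _, ?_⟩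
        · have := (mem_avoidingMatchings.1 hN).1.card_le_max
          simpa using this
        · have : 0 < maxMatchingSize G := by
            by_contra h
            have : maxMatchingSize G = 0 := by omega
            simp [maxDensity, this] at hpos
          simpa using this
      nlinarith
    set L := Real.log (numMatchings G (maxMatchingSize G)) / (Nat.card V : ℝ) with hL
    rw [Metric.tendsto_nhds]
    intro ε hε
    obtain ⟨_, ⟨s, hs, rfl⟩, hs'⟩ := (isGLB_objective_maxDensity (G := G)).exists_between
      (show L < L + ε by linarith)
    have hcont : ContinuousAt (fun q => entropyObjective G q s) (maxDensity G) := by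
      unfold entropyObjective; fun_prop
    have hev : ∀ᶠ q in 𝓝[<] maxDensity G, entropyObjective G q s < L + ε :=
      (hcont.tendsto.mono_left nhdsWithin_le_nhds).eventually (gt_mem_nhds hs'.2)
    have hev2 : ∀ᶠ q in 𝓝[<] maxDensity G, max 0 (densityFn G 1) < q :=
      nhdsWithin_le_nhds (lt_mem_nhds (max_lt hpos hlt))
    filter_upwards [hev, hev2, self_mem_nhdsWithin] with q h1 h2 h3
    have hq0 : 0 < q := (le_max_left _ _).trans_lt h2
    have hq1 : densityFn G 1 < q := (le_max_right _ _).trans_lt h2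
    have ht0 := activity_nonneg hq0.le h3
    have hta := densityFn_activity hq0.le h3
    -- Activity at least `1` makes `ln t(G, q)` nonnegative, so passing from `p^*(G)` down to `q`
    -- can only raise the objective.
    have ht1 : 1 ≤ activity G q := by
      by_contra! h
      have := densityFn_mono (G := G) ht0 h.le
      rw [hta] at this
      linarith
    have hglb := isGLB_objective_of_density ht0 hta
    have hup : freeEntropy G (activity G q) < L + ε :=
      (hglb.1 ⟨s, hs, rfl⟩).trans_lt h1
    have hlow : L ≤ freeEntropy G (activity G q) := by
      have ha := (isGLB_objective_maxDensity (G := G)).1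
        ⟨activity G q, zero_lt_one.trans_le ht1, rfl⟩
      refine ha.trans ?_
      rw [freeEntropy_eq_objective, hta, entropyObjective, entropyObjective]
      have := Real.log_nonneg ht1
      have h3' : q < maxDensity G := h3
      nlinarith
    rw [Real.dist_eq, abs_lt]
    constructor <;> linarith

lemma graphEntropy_maxDensity :
    graphEntropy G (maxDensity G) =
      Real.log (numMatchings G (maxMatchingSize G)) / (Nat.card V : ℝ) := by
  rw [graphEntropy, if_neg (lt_irrefl _), if_pos rfl]
  exact tendsto_freeEntropy_maxDensity.limUnder_eq

/-- The entropy as an infimum over the activity. -/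
theorem isGLB_graphEntropy {p : ℝ} (hp0 : 0 ≤ p) (hp : p ≤ maxDensity G) :
    IsGLB (entropyObjective G p '' Set.Ioi 0) (graphEntropy G p) := by
  rcases hp.lt_or_eq with hp | rfl
  · rw [graphEntropy, if_pos hp]
    exact isGLB_objective_of_density (activity_nonneg hp0 hp) (densityFn_activity hp0 hp)
  · rw [graphEntropy_maxDensity]
    exact isGLB_objective_maxDensity

lemma pow_max_le_matchingGen {s : ℝ} (hs : 0 ≤ s) : s ^ maxMatchingSize G ≤ matchingGen G s := by
  obtain ⟨N, hN, hc⟩ := exists_card_eq_max (G := G)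
  rw [matchingGen_eq_avoidSum, avoidSum, ← hc]
  exact Finset.single_le_sum (f := fun N : Finset (Sym2 V) => s ^ N.card)
    (fun _ _ => by positivity) (mem_avoidingMatchings.2 ⟨hN, by simp⟩)

/-- The objective is nonnegative: use `M ≥ 1` for `s ≤ 1` and `M ≥ s^ν` for `s ≥ 1`. This is needed
for a 2-lift at densities above its own `p^*`, where its entropy is `0` by definition. -/
lemma graphEntropy_nonneg {p : ℝ} (hp0 : 0 ≤ p) : 0 ≤ graphEntropy G p := by
  rcases le_or_gt p (maxDensity G) with hp | hp
  · refine (isGLB_graphEntropy hp0 hp).2 ?_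
    rintro _ ⟨s, hs, rfl⟩
    have hs0 : 0 < s := hs
    have hv := card_pos_real (V := V)
    rw [entropyObjective]
    rcases le_total s 1 with h1 | h1
    · have := Real.log_nonpos hs0.le h1
      have := div_nonneg (Real.log_nonneg (one_le_matchingGen (G := G) hs0.le)) hv.le
      nlinarith
    · have hl := Real.log_nonneg h1
      have h2 := Real.log_le_log (by positivity) (pow_max_le_matchingGen (G := G) hs0.le)
      rw [Real.log_pow] at h2
      have h3 : p / 2 * Real.log s ≤ maxMatchingSize G * Real.log s / (Nat.card V : ℝ) := by
        rw [maxDensity, le_div_iff₀ hv] at hp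
        rw [le_div_iff₀ hv]
        nlinarith
      have h4 : maxMatchingSize G * Real.log s / (Nat.card V : ℝ) ≤
        Real.log (matchingGen G s) / (Nat.card V : ℝ) := by gcongr
      linarith
  · rw [graphEntropy, if_neg hp.not_gt, if_neg hp.ne']

end Variational

/-! ### Zeros of the matching polynomial and log-concavity -/

section RealRoots

variable {V : Type u} {G : SimpleGraph V} [Fintype V]

/-- Heilmann--Lieb: the ratios of matching polynomials stay in the right half plane. -/
lemma avoidSum_ratio_re_pos {z t : ℂ} (hz : 0 < z.re) (hzt : z ^ 2 * t = 1) (n : ℕ) :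
    ∀ S : Set V, Sᶜ.ncard ≤ n → avoidSum G S t ≠ 0 ∧
      ∀ x ∉ S, 0 < (z * avoidSum G S t / avoidSum G (insert x S) t).re := by
  have hz0 : z ≠ 0 := by rintro rfl; simp at hz
  induction n with
  | zero =>
    intro S hS
    have hS' : S = Set.univ := by
      rw [← Set.compl_empty_iff]
      exact (Set.ncard_eq_zero (Set.toFinite _)).1 (Nat.le_zero.1 hS)
    subst hS'
    exact ⟨by rw [avoidSum_univ]; exact one_ne_zero, fun x hx => absurd (Set.mem_univ x) hx⟩
  | succ n ih =>
    intro S hS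
    have hins : ∀ x ∉ S, (insert x S)ᶜ.ncard ≤ n := by
      intro x hx
      have : (insert x S)ᶜ.ncard < Sᶜ.ncard := by
        refine Set.ncard_lt_ncard ⟨Set.compl_subset_compl.2 (Set.subset_insert _ _), ?_⟩
          (Set.toFinite _)
        intro h
        exact (h hx) (Set.mem_insert _ _)
      omega
    have key : ∀ x ∉ S, 0 < (z * avoidSum G S t / avoidSum G (insert x S) t).re := by
      intro x hx
      obtain ⟨hne, hpos⟩ := ih _ (hins x hx)
      -- With `z^2 t = 1` the recursion reads `r = z + ∑ 1 / r_u`, and the open right half plane is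
      -- stable under inversion and addition.
      have h1 : z * avoidSum G S t / avoidSum G (insert x S) t =
          z + ∑ u ∈ freeNeighbors G S x,
            (z * avoidSum G (insert x S) t / avoidSum G (insert u (insert x S)) t)⁻¹ := by
        rw [avoidSum_recursion hx t, mul_add, add_div, mul_div_cancel_right₀ _ hne]
        congr 1
        rw [Finset.mul_sum, Finset.mul_sum, Finset.sum_div]
        refine Finset.sum_congr rfl fun u hu => ?_
        rw [inv_div, div_eq_div_iff hne (mul_ne_zero hz0 hne)]
        linear_combination avoidSum G (insert u (insert x S)) t * avoidSum G (insert x S) t * hzt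
      rw [h1, Complex.add_re, Complex.re_sum]
      refine add_pos_of_pos_of_nonneg hz (Finset.sum_nonneg fun u hu => ?_)
      rw [mem_freeNeighbors] at hu
      have hu' : u ∉ insert x S := by
        rintro (rfl | h)
        · exact G.irrefl hu.1
        · exact hu.2 h
      rw [Complex.inv_re]
      exact div_nonneg (hpos u hu').le (Complex.normSq_nonneg _)
    refine ⟨?_, key⟩
    by_cases h : ∃ x, x ∉ S
    · obtain ⟨x, hx⟩ := h
      intro h0
      have := key x hx
      simp [h0] at this
    · have hS' : S = Set.univ := by
        push Not at h
        exact Set.eq_univ_of_forall h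
      rw [hS', avoidSum_univ]; exact one_ne_zero

/-- Write `w = 1 / z^2`. If `z` is not purely imaginary, `z` or `-z` lies in the right half plane,
where the sum does not vanish. So `z = iy` and `w = -1 / y^2`. -/
lemma neg_of_avoidSum_eq_zero {w : ℂ} (h : avoidSum G ∅ w = 0) : w.im = 0 ∧ w.re < 0 := by
  have hw0 : w ≠ 0 := by
    rintro rfl
    have h1 := map_avoidSum (G := G) (Complex.ofRealHom) ∅ 0
    rw [← matchingGen_eq_avoidSum, matchingGen_zero] at h1
    simp only [map_one, map_zero] at h1
    rw [h] at h1
    exact one_ne_zero h1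
  obtain ⟨z, hz⟩ := IsAlgClosed.exists_pow_nat_eq (w⁻¹) (n := 2) (by norm_num)
  have hzw : z ^ 2 * w = 1 := by rw [hz]; exact inv_mul_cancel₀ hw0
  have hre : z.re = 0 := by
    rcases lt_trichotomy z.re 0 with hlt | h0 | hgt
    · refine absurd h (avoidSum_ratio_re_pos (G := G) (z := -z) (t := w) ?_ ?_ _ ∅ le_rfl).1
      · simpa using hlt
      · rw [neg_sq]; exact hzw
    · exact h0
    · exact absurd h (avoidSum_ratio_re_pos (G := G) hgt hzw _ ∅ le_rfl).1
  have hz' : z = (z.im : ℂ) * Complex.I := by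
    apply Complex.ext <;> simp [hre]
  have him : z.im ≠ 0 := by
    intro h0
    rw [h0] at hz'
    rw [hz'] at hzw
    simp at hzw
  have hw : w = ((-(z.im ^ 2)⁻¹ : ℝ) : ℂ) := by
    have h1 : w = (z ^ 2)⁻¹ := by rw [hz, inv_inv]
    rw [h1, hz', mul_pow, Complex.I_sq]
    push_cast
    simp
  rw [hw]
  refine ⟨Complex.ofReal_im _, ?_⟩
  rw [Complex.ofReal_re]
  have : 0 < (z.im ^ 2)⁻¹ := by positivity
  linarith

end RealRoots

/-- Log-concave sequences without internal zeros. -/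
def IsLogConcave (a : ℕ → ℝ) : Prop :=
  (∀ k, 0 ≤ a k) ∧ ∀ j k, j ≤ k → a j * a (k + 2) ≤ a (j + 1) * a (k + 1)

/-- The two-index inequality, rather than only its diagonal `j = k`, survives multiplication by `X +
γ`; it also encodes the absence of internal zeros. -/
lemma IsLogConcave.mul_X_add_C {P : Polynomial ℝ} (h : IsLogConcave P.coeff) {γ : ℝ}
    (hγ : 0 ≤ γ) : IsLogConcave ((Polynomial.X + Polynomial.C γ) * P).coeff := by
  have hs : ∀ k, ((Polynomial.X + Polynomial.C γ) * P).coeff (k + 1) =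
      P.coeff k + γ * P.coeff (k + 1) := by
    intro k
    rw [add_mul, Polynomial.coeff_add, Polynomial.coeff_X_mul, Polynomial.coeff_C_mul]
  have h0 : ((Polynomial.X + Polynomial.C γ) * P).coeff 0 = γ * P.coeff 0 := by
    simp [add_mul]
  obtain ⟨hn, hl⟩ := h
  refine ⟨?_, ?_⟩
  · rintro (_ | k)
    · rw [h0]; exact mul_nonneg hγ (hn _)
    · rw [hs]; exact add_nonneg (hn _) (mul_nonneg hγ (hn _))
  · rintro (_ | j) k hjk
    · rw [h0, hs, hs, hs]
      have h1 := hl 0 k (Nat.zero_le _)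
      have h2 := mul_le_mul_of_nonneg_left h1 (mul_nonneg hγ hγ)
      have h3 := mul_nonneg (hn 0) (hn k)
      have h4 := mul_nonneg hγ (mul_nonneg (hn (0 + 1)) (hn k))
      linear_combination h2 + h3 + h4
    · obtain ⟨i, rfl⟩ : ∃ i, k = i + 1 := ⟨k - 1, by omega⟩
      rw [hs, hs, hs, hs]
      have hji : j ≤ i := by omega
      have h1 := mul_le_mul_of_nonneg_left (hl (j + 1) (i + 1) hjk) (mul_nonneg hγ hγ)
      have h2 := hl j i hji
      -- The mixed terms need the indices moved inwards by two steps; for `j = i` a single step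
      -- already gives the same product.
      have h3 : P.coeff j * P.coeff (i + 3) ≤ P.coeff (j + 2) * P.coeff (i + 1) := by
        have h4 := hl j (i + 1) (by omega)
        rcases hji.eq_or_lt with rfl | hlt
        · linarith
        · exact h4.trans (hl (j + 1) i hlt)
      linear_combination h1 + h2 + γ * h3

lemma isLogConcave_multiset_prod (s : Multiset ℝ) (hs : ∀ γ ∈ s, 0 ≤ γ) :
    IsLogConcave ((s.map fun γ => Polynomial.X + Polynomial.C γ).prod).coeff := by
  induction s using Multiset.induction_on with
  | empty =>
    simp only [Multiset.map_zero, Multiset.prod_zero]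
    refine ⟨fun k => ?_, fun j k _ => ?_⟩
    · rw [Polynomial.coeff_one]; split_ifs <;> norm_num
    · simp [Polynomial.coeff_one]
  | cons γ s ih =>
    rw [Multiset.map_cons, Multiset.prod_cons]
    exact (ih fun δ hδ => hs δ (Multiset.mem_cons_of_mem hδ)).mul_X_add_C
      (hs γ (Multiset.mem_cons_self _ _))

lemma IsLogConcave.const_mul {a : ℕ → ℝ} (h : IsLogConcave a) {c : ℝ} (hc : 0 ≤ c) :
    IsLogConcave (fun k => c * a k) := by
  refine ⟨fun k => mul_nonneg hc (h.1 k), fun j k hjk => ?_⟩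
  have := mul_le_mul_of_nonneg_left (h.2 j k hjk) (mul_nonneg hc hc)
  linear_combination this

lemma IsLogConcave.mul_pow {a : ℕ → ℝ} (h : IsLogConcave a) {t : ℝ} (ht : 0 ≤ t) :
    IsLogConcave (fun k => a k * t ^ k) := by
  refine ⟨fun k => mul_nonneg (h.1 k) (pow_nonneg ht k), fun j k hjk => ?_⟩
  have := mul_le_mul_of_nonneg_right (h.2 j k hjk) (pow_nonneg ht (j + k + 2))
  have e1 : a j * t ^ j * (a (k + 2) * t ^ (k + 2)) = a j * a (k + 2) * t ^ (j + k + 2) := by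
    ring
  have e2 : a (j + 1) * t ^ (j + 1) * (a (k + 1) * t ^ (k + 1)) =
    a (j + 1) * a (k + 1) * t ^ (j + k + 2) := by ring
  simp only [e1, e2]
  exact this

/-- A log-concave sequence on `{0, …, n}` with integer mean `k` carries at least the fraction
`1 / (n + 1)` of its mass at `k`. -/
lemma IsLogConcave.sum_le_of_mean {w : ℕ → ℝ} (h : IsLogConcave w) {n k : ℕ}
    (hk : 0 < w k) (hk1 : 0 < w (k + 1))
    (hmean : ∑ j ∈ Finset.range (n + 1), w j * ((j : ℝ) - k) = 0) :
    ∑ j ∈ Finset.range (n + 1), w j ≤ (n + 1) * w k := by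
  -- `a` is the slope of `log w` just to the right of `k`. By log-concavity the whole sequence lies
  -- below the geometric sequence through `w k` with ratio `e^a`.
  set a := Real.log (w (k + 1) / w k) with ha
  have hexp : Real.exp a = w (k + 1) / w k := Real.exp_log (div_pos hk1 hk)
  have hup : ∀ i : ℕ, w (k + i) ≤ w k * Real.exp (a * i) := by
    intro i
    induction i with
    | zero => simp
    | succ i ih =>
      have h1 : w (k + (i + 1)) * w k ≤ w (k + i) * w (k + 1) := by
        rcases i with _ | i
        · simp [mul_comm]
        · have := h.2 k (k + i) (by omega)
          simp only [Nat.add_assoc, Nat.reduceAdd] at this ⊢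
          linarith
      have h2 : w (k + (i + 1)) ≤ w (k + i) * Real.exp a := by
        rw [hexp, ← mul_div_assoc, le_div_iff₀ hk]; exact h1
      refine h2.trans ?_
      push_cast
      rw [mul_add, Real.exp_add, mul_one, ← mul_assoc]
      exact mul_le_mul_of_nonneg_right ih (Real.exp_pos _).le
  have hdown : ∀ i : ℕ, i ≤ k → w (k - i) ≤ w k * Real.exp (-(a * i)) := by
    intro i
    induction i with
    | zero => simp
    | succ i ih =>
      intro hi
      have h1 : w (k - (i + 1)) * w (k + 1) ≤ w (k - i) * w k := by
        have := h.2 (k - (i + 1)) (k - 1) (by omega)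
        rwa [show k - 1 + 2 = k + 1 by omega, show k - (i + 1) + 1 = k - i by omega,
          show k - 1 + 1 = k by omega] at this
      have h2 : w (k - (i + 1)) ≤ w (k - i) * Real.exp (-a) := by
        rw [Real.exp_neg, hexp, inv_div, ← mul_div_assoc, le_div_iff₀ hk1]; exact h1
      refine h2.trans ?_
      push_cast
      rw [mul_add, neg_add, Real.exp_add, mul_one, ← mul_assoc]
      exact mul_le_mul_of_nonneg_right (ih (by omega)) (Real.exp_pos _).le
  have hall : ∀ j : ℕ, w j ≤ w k * Real.exp (a * ((j : ℝ) - k)) := by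
    intro j
    rcases le_total k j with hkj | hjk
    · obtain ⟨i, rfl⟩ := Nat.exists_eq_add_of_le hkj
      have := hup i
      push_cast
      rwa [add_sub_cancel_left]
    · obtain ⟨i, hi⟩ := Nat.exists_eq_add_of_le hjk
      have := hdown i (by omega)
      rw [show k - i = j by omega] at this
      rwa [show a * ((j : ℝ) - k) = -(a * i) by rw [hi]; push_cast; ring]
  -- Here `1 - x ≤ e^(-x)` cancels the geometric factor. Summed over `j`, the linear correction
  -- disappears by the hypothesis on the mean.
  have hterm : ∀ j : ℕ, w j * (1 - a * ((j : ℝ) - k)) ≤ w k := by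
    intro j
    set x := a * ((j : ℝ) - k) with hx
    rcases le_total 0 (1 - x) with hx1 | hx1
    · calc w j * (1 - x) ≤ w k * Real.exp x * (1 - x) := mul_le_mul_of_nonneg_right (hall j) hx1
        _ ≤ w k * Real.exp x * Real.exp (-x) := by
          refine mul_le_mul_of_nonneg_left ?_ (by positivity)
          linarith [Real.add_one_le_exp (-x)]
        _ = w k := by rw [mul_assoc, ← Real.exp_add]; simp
    · exact (mul_nonpos_of_nonneg_of_nonpos (h.1 j) hx1).trans hk.le
  calc ∑ j ∈ Finset.range (n + 1), w j
      = ∑ j ∈ Finset.range (n + 1), w j * (1 - a * ((j : ℝ) - k)) := by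
        have : ∀ j ∈ Finset.range (n + 1), w j * (1 - a * ((j : ℝ) - k)) =
          w j - a * (w j * ((j : ℝ) - k)) := fun j _ => by ring
        rw [Finset.sum_congr rfl this, Finset.sum_sub_distrib, ← Finset.mul_sum, hmean]
        ring
    _ ≤ ∑ j ∈ Finset.range (n + 1), w k := Finset.sum_le_sum fun j _ => hterm j
    _ = (n + 1) * w k := by simp

/-! ### From entropy to the number of matchings of a given size -/

section MatchingSequence

variable {V : Type u} {G : SimpleGraph V} [Fintype V]

lemma coeff_avoidSum_X (k : ℕ) :
    (avoidSum G ∅ (Polynomial.X : Polynomial ℝ)).coeff k = numMatchings G k := by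
  rw [avoidSum, Polynomial.finsetSum_coeff, numMatchings_eq_card, Finset.card_filter,
    Nat.cast_sum]
  refine Finset.sum_congr rfl fun N _ => ?_
  rw [Polynomial.coeff_X_pow]
  simp [eq_comm]

/-- Over `ℂ` the generating polynomial splits, and all its roots are real and negative. So over `ℝ`
it is a nonnegative constant times a product of factors `X + γ` with `γ > 0`. -/
lemma isLogConcave_numMatchings : IsLogConcave (fun k => (numMatchings G k : ℝ)) := by
  set P : Polynomial ℝ := avoidSum G ∅ Polynomial.X with hP
  have hcoeff : P.coeff = fun k => (numMatchings G k : ℝ) := funext coeff_avoidSum_X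
  have hmap : P.map Complex.ofRealHom = avoidSum G ∅ Polynomial.X := by
    have := map_avoidSum (G := G) (Polynomial.mapRingHom Complex.ofRealHom) ∅ Polynomial.X
    simpa using this
  have heval : ∀ w : ℂ, (P.map Complex.ofRealHom).eval w = avoidSum G ∅ w := by
    intro w
    rw [hmap]
    have := map_avoidSum (G := G) (Polynomial.evalRingHom w) ∅ Polynomial.X
    simpa using this
  set Q := P.map Complex.ofRealHom with hQ
  have hroot : ∀ w ∈ Q.roots, w.im = 0 ∧ w.re < 0 := by
    intro w hw
    have := (Polynomial.mem_roots'.1 hw).2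
    rw [Polynomial.IsRoot.def, heval] at this
    exact neg_of_avoidSum_eq_zero this
  have hsplit : Q = Polynomial.C Q.leadingCoeff *
      (Q.roots.map fun a => Polynomial.X - Polynomial.C a).prod :=
    (IsAlgClosed.splits Q).eq_prod_roots
  set s : Multiset ℝ := Q.roots.map fun a => -a.re with hs
  have hfac : P = Polynomial.C P.leadingCoeff *
      (s.map fun γ => Polynomial.X + Polynomial.C γ).prod := by
    apply Polynomial.map_injective Complex.ofRealHom Complex.ofRealHom.injective
    rw [Polynomial.map_mul, Polynomial.map_multiset_prod, Polynomial.map_C, ← hQ]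
    have hl : Complex.ofRealHom P.leadingCoeff = Q.leadingCoeff :=
      (Polynomial.leadingCoeff_map_of_injective Complex.ofRealHom.injective P).symm
    rw [hl]
    conv_lhs => rw [hsplit]
    congr 2
    rw [hs, Multiset.map_map, Multiset.map_map]
    refine Multiset.map_congr rfl fun a ha => ?_
    have h1 : ((a.re : ℝ) : ℂ) = a := Complex.ext (by simp) (by simp [(hroot a ha).1])
    simp [sub_eq_add_neg, h1]
  have hlead : 0 ≤ P.leadingCoeff := by
    rw [Polynomial.leadingCoeff, hcoeff]; positivity
  have hlc := (isLogConcave_multiset_prod s (by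
    intro γ hγ
    obtain ⟨a, ha, rfl⟩ := Multiset.mem_map.1 hγ
    linarith [(hroot a ha).2])).const_mul hlead
  rw [← hcoeff, hfac]
  have : (Polynomial.C P.leadingCoeff *
      (s.map fun γ => Polynomial.X + Polynomial.C γ).prod).coeff =
      fun k => P.leadingCoeff * (s.map fun γ => Polynomial.X + Polynomial.C γ).prod.coeff k :=
    funext fun k => Polynomial.coeff_C_mul _
  rw [this]
  exact hlc

lemma weightedCardSum_eq_sum (t : ℝ) :
    weightedCardSum G t =
      ∑ k ∈ Finset.range (Nat.card V / 2 + 1), (numMatchings G k : ℝ) * t ^ k * k := by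
  classical
  rw [weightedCardSum, ← Finset.sum_fiberwise_of_maps_to (g := Finset.card)
    (t := Finset.range (Nat.card V / 2 + 1))]
  · refine Finset.sum_congr rfl fun k _ => ?_
    rw [numMatchings_eq_card, Finset.sum_congr rfl (g := fun _ => t ^ k * k), Finset.sum_const,
      nsmul_eq_mul, mul_assoc]
    · intro N hN
      rw [(Finset.mem_filter.1 hN).2, mul_comm]
  · intro N hN
    have := (mem_avoidingMatchings.1 hN).1.two_mul_card_le
    rw [Finset.mem_range]
    omega

/-- At the activity of density `k / n` the mean matching size is `k`, which gives `M ≤ (n + 1) m_k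
t^k`; in logarithms the power of `t` cancels against `(p / 2) ln t`. This uses `m_{k+1} > 0`, so `k
= n` is treated apart, where the entropy equals `ln m_n / v(G)`. -/
lemma graphEntropy_le_log_numMatchings [Nonempty V] {n k : ℕ} (hn : Nat.card V = 2 * n)
    (hmax : maxMatchingSize G = n) (hk : k ≤ n) :
    graphEntropy G ((k : ℝ) / n) - Real.log (2 * (n : ℝ)) / (2 * (n : ℝ)) ≤
      Real.log (numMatchings G k : ℝ) / (2 * (n : ℝ)) := by
  have hv := card_pos_real (V := V)
  have hcast : (Nat.card V : ℝ) = 2 * n := by rw [hn]; push_cast; ring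
  have hn0 : (0 : ℝ) < n := by rw [hcast] at hv; linarith
  have hn1 : (1 : ℝ) ≤ n := by
    have : 0 < n := by exact_mod_cast hn0
    exact_mod_cast this
  have hmd : maxDensity G = 1 := by
    rw [maxDensity, hmax, hcast]; field_simp
  have hlogn : 0 ≤ Real.log (2 * (n : ℝ)) / (2 * n) :=
    div_nonneg (Real.log_nonneg (by linarith)) (by positivity)
  rcases hk.lt_or_eq with hlt | rfl
  · have hltR : (k : ℝ) < n := by exact_mod_cast hlt
    have hp1 : (k : ℝ) / n < maxDensity G := by
      rw [hmd, div_lt_one hn0]; exact hltR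
    have hp0 : (0 : ℝ) ≤ (k : ℝ) / n := by positivity
    have ht0 := activity_nonneg (G := G) hp0 hp1
    have hd := densityFn_activity (G := G) hp0 hp1
    rw [graphEntropy, if_pos hp1, freeEntropy_eq_objective, hd]
    set t := activity G ((k : ℝ) / n) with ht
    have hM := matchingGen_pos (G := G) ht0
    have hmk : ∀ j ≤ n, (0 : ℝ) < numMatchings G j := fun j hj => by
      exact_mod_cast numMatchings_pos_of_le (G := G) (hmax ▸ hj)
    rcases ht0.eq_or_lt with h0 | htpos
    · rw [← h0, densityFn_zero] at hd
      have hk0 : k = 0 := by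
        rcases div_eq_zero_iff.1 hd.symm with h | h
        · exact_mod_cast h
        · exact absurd h hn0.ne'
      subst hk0
      have := Real.log_nonneg (show (1 : ℝ) ≤ numMatchings G 0 by
        exact_mod_cast numMatchings_pos_of_le (G := G) (Nat.zero_le _))
      rw [← h0]
      simp only [entropyObjective, matchingGen_zero, Real.log_one]
      have := div_nonneg this (show (0 : ℝ) ≤ 2 * n by positivity)
      simp only [zero_div, Nat.cast_zero, zero_mul, sub_zero, zero_sub]
      linarith
    · have hw : weightedCardSum G t = k * matchingGen G t := by
        rw [densityFn_eq, hcast, div_eq_div_iff (by positivity) (by positivity)] at hd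
        have : (2 * (n : ℝ)) * weightedCardSum G t = (2 * n) * (k * matchingGen G t) := by
          linarith
        exact mul_left_cancel₀ (by positivity) this
      have hhalf : Nat.card V / 2 = n := by omega
      have hsum : matchingGen G t ≤ (n + 1) * (numMatchings G k * t ^ k) := by
        have hmean : ∑ j ∈ Finset.range (n + 1),
            (numMatchings G j : ℝ) * t ^ j * ((j : ℝ) - k) = 0 := by
          have h1 := weightedCardSum_eq_sum (G := G) t
          rw [hw, matchingGen, hhalf, Finset.mul_sum] at h1
          rw [Finset.sum_congr rfl fun j _ => mul_sub _ _ _, Finset.sum_sub_distrib, ← h1,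
            sub_eq_zero]
          exact Finset.sum_congr rfl fun j _ => by ring
        have := (isLogConcave_numMatchings (G := G).mul_pow ht0).sum_le_of_mean (n := n) (k := k)
          (mul_pos (hmk k hk) (pow_pos htpos _)) (mul_pos (hmk (k + 1) hlt) (pow_pos htpos _)) hmean
        rwa [matchingGen, hhalf]
      have hlog := Real.log_le_log hM hsum
      have hmkp := hmk k hk
      rw [Real.log_mul (by positivity) (by positivity), Real.log_mul hmkp.ne' (by positivity),
        Real.log_pow] at hlog
      -- The factor `n + 1` is at most the number `2n` of vertices since `n ≥ 1`.
      have hlog2 : Real.log ((n : ℝ) + 1) ≤ Real.log (2 * n) :=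
        Real.log_le_log (by positivity) (by linarith)
      rw [entropyObjective, hcast]
      have e : (k : ℝ) / n / 2 * Real.log t = k * Real.log t / (2 * n) := by
        field_simp
      rw [e, ← sub_div, ← sub_div]
      gcongr
      linarith
  · have h1 : (k : ℝ) / k = maxDensity G := by rw [hmd, div_self hn0.ne']
    rw [h1, graphEntropy_maxDensity, hmax, hcast]
    linarith

end MatchingSequence

/-! ### Two-colouring a union of two partial matchings -/

section TwoColoring

/-- Two fixed-point-free involutions admit a common two-colouring. -/
lemma exists_coloring_of_involutions {Y : Type*} (f g : Equiv.Perm Y) (hf : ∀ y, f (f y) = y)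
    (hg : ∀ y, g (g y) = y) (hf' : ∀ y, f y ≠ y) (hg' : ∀ y, g y ≠ y) :
    ∃ c : Y → Prop, (∀ y, ¬ (c (f y) ↔ c y)) ∧ ∀ y, ¬ (c (g y) ↔ c y) := by
  set ρ : Equiv.Perm Y := g * f with hρ
  have hconj1 : f * ρ * f⁻¹ = ρ⁻¹ := by
    ext y
    rw [hρ, mul_inv_rev]
    have h1 : g⁻¹ y = g y := by rw [Equiv.Perm.inv_eq_iff_eq]; exact (hg y).symm
    have h2 : f⁻¹ (g⁻¹ y) = f (g⁻¹ y) := by rw [Equiv.Perm.inv_eq_iff_eq]; exact (hf _).symm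
    have h3 : f⁻¹ y = f y := by rw [Equiv.Perm.inv_eq_iff_eq]; exact (hf _).symm
    simp only [Equiv.Perm.mul_apply]
    rw [h2, h1, h3, hf]
  have hconj : ∀ (k : ℤ) (y : Y), f ((ρ ^ k) y) = (ρ ^ (-k)) (f y) := by
    intro k y
    have h1 : f * ρ ^ k * f⁻¹ = ρ ^ (-k) := by
      rw [← conj_zpow, hconj1, inv_zpow, zpow_neg]
    rw [← h1]
    simp [Equiv.Perm.mul_apply]
  -- Since `f` conjugates `ρ` to its inverse, `f y = ρ^(2j) y` would make `ρ^j y` a fixed point of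
  -- `f`, and `f y = ρ^(2j+1) y` would make `f (ρ^j y)` a fixed point of `g`.
  have hcyc : ∀ y, ¬ ρ.SameCycle y (f y) := by
    rintro y ⟨k, hk⟩
    rcases Int.even_or_odd' k with ⟨j, rfl | rfl⟩
    · refine hf' ((ρ ^ j) y) ?_
      rw [hconj, ← hk, ← Equiv.Perm.mul_apply, ← zpow_add]
      congr 2; ring
    · refine hg' (f ((ρ ^ j) y)) ?_
      have h1 : g (f ((ρ ^ j) y)) = (ρ ^ (1 + j)) y := by
        rw [zpow_add, zpow_one]; rfl
      rw [h1, hconj, ← hk, ← Equiv.Perm.mul_apply, ← zpow_add]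
      congr 2; ring
  let s : Setoid Y := Equiv.Perm.SameCycle.setoid ρ
  classical
  -- Both `f` and `g` exchange the same pairs of distinct `ρ`-cycles. An arbitrary linear order on
  -- the cycles selects one cycle of each pair as a colour class.
  let _ : LinearOrder (Quotient s) := linearOrderOfSTO WellOrderingRel
  have hq : ∀ y, (⟦y⟧ : Quotient s) ≠ ⟦f y⟧ := fun y h => hcyc y (Quotient.exact h)
  have hlt : ∀ a b : Quotient s, a ≠ b → ¬ (a < b ↔ b < a) := by
    intro a b hab h
    rcases lt_or_gt_of_ne hab with h1 | h1
    · exact lt_asymm h1 (h.1 h1)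
    · exact lt_asymm h1 (h.2 h1)
  have hg1 : ∀ y, (⟦g y⟧ : Quotient s) = ⟦f y⟧ := by
    intro y
    refine (Quotient.sound (show ρ.SameCycle (f y) (g y) from ⟨1, ?_⟩)).symm
    rw [zpow_one, hρ, Equiv.Perm.mul_apply, hf]
  have hg2 : ∀ y, (⟦f (g y)⟧ : Quotient s) = ⟦y⟧ := by
    intro y
    refine Quotient.sound (show ρ.SameCycle (f (g y)) y from ⟨1, ?_⟩)
    rw [zpow_one, hρ, Equiv.Perm.mul_apply, hf, hg]
  refine ⟨fun y => (⟦y⟧ : Quotient s) < ⟦f y⟧, fun y => ?_, fun y => ?_⟩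
  · simp only [hf]
    exact hlt _ _ (hq y).symm
  · simp only [hg1, hg2]
    exact hlt _ _ (hq y).symm

open scoped Classical in
/-- A relation in which every element has at most one partner extends to a fixed-point-free
involution of the double. -/
lemma exists_involution_of_partner {X : Type*} (P : X → X → Prop) (hsymm : ∀ a b, P a b → P b a)
    (hirr : ∀ a, ¬ P a a) (huniq : ∀ a b c, P a b → P a c → b = c) :
    ∃ f : Equiv.Perm (X × Bool), (∀ y, f (f y) = y) ∧ (∀ y, f y ≠ y) ∧
      ∀ a b i, P a b → f (a, i) = (b, i) := by
  set F : X × Bool → X × Bool := fun y =>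
    if h : ∃ b, P y.1 b then (h.choose, y.2) else (y.1, !y.2) with hF
  have h1 : ∀ a b i, P a b → F (a, i) = (b, i) := by
    intro a b i hab
    have h : ∃ b, P (a, i).1 b := ⟨b, hab⟩
    simp only [hF]
    rw [dif_pos h, huniq a _ _ h.choose_spec hab]
  have h2 : ∀ a i, (¬ ∃ b, P a b) → F (a, i) = (a, !i) := by
    intro a i h
    simp only [hF]
    rw [dif_neg h]
  have hinv : Function.Involutive F := by
    rintro ⟨a, i⟩
    by_cases h : ∃ b, P a b
    · obtain ⟨b, hb⟩ := h
      rw [h1 a b i hb, h1 b a i (hsymm _ _ hb)]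
    · rw [h2 a i h, h2 a _ h, Bool.not_not]
  refine ⟨hinv.toPerm, hinv, ?_, h1⟩
  rintro ⟨a, i⟩ h
  have h' : F (a, i) = (a, i) := h
  by_cases hex : ∃ b, P a b
  · obtain ⟨b, hb⟩ := hex
    rw [h1 a b i hb] at h'
    have : b = a := congrArg Prod.fst h'
    exact hirr a (this ▸ hb)
  · rw [h2 a i hex] at h'
    have : (!i) = i := congrArg Prod.snd h'
    cases i <;> simp at this

/-- Both involutions of the double stay on one copy wherever a partner exists, so colouring the
double and restricting to the copy `true` suffices. -/
lemma exists_coloring_of_partners {X : Type*} (P : Fin 2 → X → X → Prop)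
    (hsymm : ∀ k a b, P k a b → P k b a) (hirr : ∀ k a, ¬ P k a a)
    (huniq : ∀ k a b c, P k a b → P k a c → b = c) :
    ∃ c : X → Prop, ∀ k a b, P k a b → ¬ (c a ↔ c b) := by
  obtain ⟨f, hf, hf', hfP⟩ := exists_involution_of_partner (P 0) (hsymm 0) (hirr 0) (huniq 0)
  obtain ⟨g, hg, hg', hgP⟩ := exists_involution_of_partner (P 1) (hsymm 1) (hirr 1) (huniq 1)
  obtain ⟨c, hc, hc'⟩ := exists_coloring_of_involutions f g hf hg hf' hg'
  refine ⟨fun a => c (a, true), fun k a b hab h => ?_⟩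
  fin_cases k
  · refine hc (a, true) ?_
    rw [hfP a b true hab]
    exact h.symm
  · refine hc' (a, true) ?_
    rw [hgP a b true hab]
    exact h.symm

end TwoColoring

/-! ### Two-lifts of bipartite graphs and their matchings -/

section TwoLift

variable {V : Type u} {G : SimpleGraph V} {H : SimpleGraph (V × Fin 2)}

lemma IsTwoLift.adj (h : IsTwoLift G H) {x y : V} {i j : Fin 2} (hxy : H.Adj (x, i) (y, j)) :
    G.Adj x y := by
  by_contra hn
  exact (h x y).2 hn i j hxy

lemma IsTwoLift.exists_adj (h : IsTwoLift G H) {x y : V} (hxy : G.Adj x y) (i : Fin 2) :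
    ∃ j, H.Adj (x, i) (y, j) := by
  rcases (h x y).1 hxy with ⟨h0, h1, -⟩ | ⟨h0, h1, -⟩ <;> fin_cases i
  exacts [⟨0, h0⟩, ⟨1, h1⟩, ⟨1, h0⟩, ⟨0, h1⟩]

lemma IsTwoLift.adj_unique (h : IsTwoLift G H) {x y : V} {i j k : Fin 2}
    (hj : H.Adj (x, i) (y, j)) (hk : H.Adj (x, i) (y, k)) : j = k := by
  have hxy := h.adj hj
  rcases (h x y).1 hxy with ⟨h0, h1, h2, h3⟩ | ⟨h0, h1, h2, h3⟩ <;> fin_cases i <;>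
    fin_cases j <;> fin_cases k <;> simp_all

/-- The projection of unordered pairs to the base graph. -/
abbrev liftProj : Sym2 (V × Fin 2) → Sym2 V := Sym2.map Prod.fst

lemma exists_mem_of_mem_liftProj {e : Sym2 (V × Fin 2)} {x : V} (hx : x ∈ liftProj e) :
    ∃ i, (x, i) ∈ e := by
  obtain ⟨⟨y, i⟩, hy, rfl⟩ := Sym2.mem_map.1 hx
  exact ⟨i, hy⟩

lemma mem_liftProj {e : Sym2 (V × Fin 2)} {x : V} {i : Fin 2} (hx : (x, i) ∈ e) :
    x ∈ liftProj e := Sym2.mem_map.2 ⟨(x, i), hx, rfl⟩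

lemma IsTwoLift.liftProj_mem (h : IsTwoLift G H) {e : Sym2 (V × Fin 2)} (he : e ∈ H.edgeSet) :
    liftProj e ∈ G.edgeSet := by
  induction e with | _ a b => exact h.adj (i := a.2) (j := b.2) he

lemma IsTwoLift.edge_eq (h : IsTwoLift G H) {e f : Sym2 (V × Fin 2)} (he : e ∈ H.edgeSet)
    (hf : f ∈ H.edgeSet) (hef : liftProj e = liftProj f) {x : V} {i : Fin 2}
    (hxe : (x, i) ∈ e) (hxf : (x, i) ∈ f) : e = f := by
  obtain ⟨⟨y, j⟩, rfl⟩ := hxe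
  obtain ⟨⟨z, k⟩, rfl⟩ := hxf
  simp only [liftProj, Sym2.map_mk] at hef
  obtain rfl : y = z := Sym2.congr_right.1 hef
  rw [h.adj_unique he hf]

lemma fin_two_eq {i j k : Fin 2} (h1 : i ≠ k) (h2 : j ≠ k) : i = j := by omega

/-- `N` contains two edges over `e`. -/
def IsDoubleOver (N : Finset (Sym2 (V × Fin 2))) (e : Sym2 V) : Prop :=
  ∃ a ∈ N, ∃ b ∈ N, a ≠ b ∧ liftProj a = e ∧ liftProj b = e

/-- Two disjoint edges over `e` cover all four points over `e`. Consequently no other edge of the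
matching can meet the fibre of an end of `e`. -/
lemma IsDoubleOver.exists_mem {N : Finset (Sym2 (V × Fin 2))} (hN : IsEdgeMatching H N)
    {e : Sym2 V} (hd : IsDoubleOver N e) {x : V} (hx : x ∈ e) (i : Fin 2) :
    ∃ a ∈ N, liftProj a = e ∧ (x, i) ∈ a := by
  obtain ⟨a, ha, b, hb, hab, rfl, hbe⟩ := hd
  obtain ⟨j, hj⟩ := exists_mem_of_mem_liftProj hx
  obtain ⟨k, hk⟩ := exists_mem_of_mem_liftProj (hbe.symm ▸ hx)
  by_cases hij : i = j
  · exact ⟨a, ha, rfl, hij ▸ hj⟩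
  · have hjk : k ≠ j := by
      rintro rfl
      exact hab (hN.eq_of_mem ha hb hj hk)
    exact ⟨b, hb, hbe, fin_two_eq hij hjk ▸ hk⟩

lemma IsDoubleOver.eq_of_mem {N : Finset (Sym2 (V × Fin 2))} (hN : IsEdgeMatching H N)
    {e : Sym2 V} (hd : IsDoubleOver N e) {f : Sym2 (V × Fin 2)} (hf : f ∈ N) {x : V}
    (hxe : x ∈ e) (hxf : x ∈ liftProj f) : liftProj f = e := by
  obtain ⟨i, hi⟩ := exists_mem_of_mem_liftProj hxf
  obtain ⟨a, ha, rfl, hxa⟩ := hd.exists_mem hN hxe i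
  rw [hN.eq_of_mem hf ha hi hxa]

lemma IsDoubleOver.mem (h : IsTwoLift G H) {N : Finset (Sym2 (V × Fin 2))}
    (hN : IsEdgeMatching H N) {f : Sym2 (V × Fin 2)} (hd : IsDoubleOver N (liftProj f))
    (hf : f ∈ H.edgeSet) : f ∈ N := by
  induction f with | _ a b =>
  obtain ⟨e, he, hp, hm⟩ := hd.exists_mem hN (x := a.1) (mem_liftProj (i := a.2) (by simp)) a.2
  rwa [← h.edge_eq (hN.1 _ he) hf hp hm (by simp)]

/-- The multiset of projected edges of `N`. -/
def projMultiset (N : Finset (Sym2 (V × Fin 2))) : Multiset (Sym2 V) := N.val.map liftProj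

lemma mem_projMultiset {N : Finset (Sym2 (V × Fin 2))} {e : Sym2 V} :
    e ∈ projMultiset N ↔ ∃ a ∈ N, liftProj a = e := by
  simp [projMultiset]

open scoped Classical

lemma count_projMultiset (N : Finset (Sym2 (V × Fin 2))) (e : Sym2 V) :
    (projMultiset N).count e = (N.filter fun a => liftProj a = e).card := by
  rw [projMultiset, Multiset.count_map, Finset.card_def, Finset.filter_val]
  simp only [eq_comm]

lemma isDoubleOver_iff {N : Finset (Sym2 (V × Fin 2))} {e : Sym2 V} :
    IsDoubleOver N e ↔ 2 ≤ (projMultiset N).count e := by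
  rw [count_projMultiset, Nat.succ_le_iff, Finset.one_lt_card]
  constructor
  · rintro ⟨a, ha, b, hb, hab, h1, h2⟩
    exact ⟨a, by simp [ha, h1], b, by simp [hb, h2], hab⟩
  · rintro ⟨a, ha, b, hb, hab⟩
    rw [Finset.mem_filter] at ha hb
    exact ⟨a, ha.1, b, hb.1, hab, ha.2, hb.2⟩

/-- Every edge over `xy` uses one of the two points over `x`, and distinct edges of a matching use
distinct ones. -/
lemma count_projMultiset_le {N : Finset (Sym2 (V × Fin 2))} (hN : IsEdgeMatching H N)
    (e : Sym2 V) : (projMultiset N).count e ≤ 2 := by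
  rw [count_projMultiset]
  induction e with | _ x y =>
  have hx : ∀ a ∈ N.filter (fun a => liftProj a = s(x, y)), ∃ i, (x, i) ∈ a := by
    intro a ha
    rw [Finset.mem_filter] at ha
    exact exists_mem_of_mem_liftProj (by rw [ha.2]; simp)
  choose! idx hidx using hx
  have := Finset.card_le_card_of_injOn (s := N.filter fun a => liftProj a = s(x, y))
    (t := Finset.univ) idx (fun _ _ => Finset.mem_coe.2 (Finset.mem_univ _)) (by
      intro a ha b hb hab
      have h1 := hidx a ha
      have h2 := hidx b hb
      rw [hab] at h1
      rw [Finset.mem_coe, Finset.mem_filter] at ha hb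
      exact hN.eq_of_mem ha.1 hb.1 h1 h2)
  simpa using this

/-- `N` and `N₀` share an edge over `e`. -/
def SharesLift (N N₀ : Finset (Sym2 (V × Fin 2))) (e : Sym2 V) : Prop :=
  ∃ a ∈ N, a ∈ N₀ ∧ liftProj a = e

/-- The two partial matchings into which a projected matching is split with the help of a
reference matching `N₀` and a colouring `c`. -/
def splitPart [Fintype V] (N₀ : Finset (Sym2 (V × Fin 2))) (c : Sym2 V → Prop)
    (N : Finset (Sym2 (V × Fin 2))) : Finset (Sym2 V) :=
  Finset.univ.filter fun e => e ∈ projMultiset N ∧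
    (IsDoubleOver N e ∨ (SharesLift N N₀ e ↔ c e))

/-- `c` is a proper colouring of the edges over which `N₀` lives. -/
def IsSplitColoring (N₀ : Finset (Sym2 (V × Fin 2))) (c : Sym2 V → Prop) : Prop :=
  ∀ e ∈ projMultiset N₀, ∀ f ∈ projMultiset N₀, e ≠ f → ∀ x ∈ e, x ∈ f → ¬ (c e ↔ c f)

/-- At most two distinct projected edges meet at a vertex. Sort these meetings by the side of the
bipartition: an edge has only one end on each side, so it has at most one partner per side, and the
two-colouring applies. -/
lemma exists_splitColoring (h : IsTwoLift G H) (hG : G.IsBipartite)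
    {N₀ : Finset (Sym2 (V × Fin 2))} (hN : IsEdgeMatching H N₀) :
    ∃ c, IsSplitColoring N₀ c := by
  obtain ⟨χ⟩ := hG
  obtain ⟨c, hc⟩ := exists_coloring_of_partners (X := Sym2 V)
    (fun k e f => e ∈ projMultiset N₀ ∧ f ∈ projMultiset N₀ ∧ e ≠ f ∧
      ∃ x, χ x = k ∧ x ∈ e ∧ x ∈ f)
    (fun k a b ⟨h1, h2, h3, x, h4, h5, h6⟩ => ⟨h2, h1, h3.symm, x, h4, h6, h5⟩)
    (fun k a ⟨_, _, h3, _⟩ => h3 rfl) (by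
      rintro k e f g ⟨h1, h2, h3, x, h4, h5, h6⟩ ⟨-, h2', h3', y, h4', h5', h6'⟩
      obtain ⟨a, ha, rfl⟩ := mem_projMultiset.1 h1
      obtain ⟨b, hb, rfl⟩ := mem_projMultiset.1 h2
      obtain ⟨b', hb', rfl⟩ := mem_projMultiset.1 h2'
      have hxy : x = y := by
        by_contra hne
        have he := (Sym2.mem_and_mem_iff hne).1 ⟨h5, h5'⟩
        have := h.liftProj_mem (hN.1 a ha)
        rw [he] at this
        exact χ.valid this (h4.trans h4'.symm)
      subst hxy
      obtain ⟨i, hi⟩ := exists_mem_of_mem_liftProj h5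
      obtain ⟨j, hj⟩ := exists_mem_of_mem_liftProj h6
      obtain ⟨k', hk⟩ := exists_mem_of_mem_liftProj h6'
      have h7 : j ≠ i := by
        rintro rfl; exact h3 (by rw [hN.eq_of_mem ha hb hi hj])
      have h8 : k' ≠ i := by
        rintro rfl; exact h3' (by rw [hN.eq_of_mem ha hb' hi hk])
      rw [fin_two_eq h7 h8] at hj
      rw [hN.eq_of_mem hb hb' hj hk])
  exact ⟨c, fun e he f hf hne x hx hx' => hc (χ x) e f ⟨he, hf, hne, x, rfl, hx, hx'⟩⟩

variable [Fintype V]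

/-- Let `e` and `f` be projected edges that meet at `x`. Each of `N` and `N₀` uses opposite sheets
over `x` for them, so agreement of `N` with `N₀` over `e` forces agreement over `f`. Agreement is
thus constant along components while `c` alternates, so `e` and `f` land in different parts. -/
lemma splitPart_isEdgeMatching (h : IsTwoLift G H) {N₀ N : Finset (Sym2 (V × Fin 2))}
    (hN₀ : IsEdgeMatching H N₀) (hN : IsEdgeMatching H N)
    (hp : projMultiset N = projMultiset N₀) {c : Sym2 V → Prop} (hc : IsSplitColoring N₀ c) :
    IsEdgeMatching G (splitPart N₀ c N) := by
  have hkey : ∀ e ∈ projMultiset N, ∀ f ∈ projMultiset N, e ≠ f → ∀ x ∈ e, x ∈ f →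
      SharesLift N N₀ e → SharesLift N N₀ f := by
    rintro e he f hf hne x hxe hxf ⟨a, ha, ha0, rfl⟩
    obtain ⟨i, hi⟩ := exists_mem_of_mem_liftProj hxe
    obtain ⟨b, hb, rfl⟩ := mem_projMultiset.1 hf
    rw [hp] at hf
    obtain ⟨b0, hb0, hbb⟩ := mem_projMultiset.1 hf
    obtain ⟨j, hj⟩ := exists_mem_of_mem_liftProj hxf
    obtain ⟨k, hk⟩ := exists_mem_of_mem_liftProj (hbb.symm ▸ hxf)
    have h7 : j ≠ i := by
      rintro rfl; exact hne (by rw [hN.eq_of_mem ha hb hi hj])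
    have h8 : k ≠ i := by
      rintro rfl; exact hne (by rw [← hbb, hN₀.eq_of_mem ha0 hb0 hi hk])
    rw [fin_two_eq h7 h8] at hj
    have := h.edge_eq (hN.1 _ hb) (hN₀.1 _ hb0) hbb.symm hj hk
    exact ⟨b, hb, this ▸ hb0, rfl⟩
  refine ⟨fun e he => ?_, fun e he f hf hne x hxe hxf => ?_⟩
  · obtain ⟨a, ha, rfl⟩ := mem_projMultiset.1 (Finset.mem_filter.1 he).2.1
    exact h.liftProj_mem (hN.1 a ha)
  · obtain ⟨-, he, he'⟩ := Finset.mem_filter.1 he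
    obtain ⟨-, hf, hf'⟩ := Finset.mem_filter.1 hf
    have hcol := hc e (hp ▸ he) f (hp ▸ hf) hne x hxe hxf
    rcases he' with hd | he'
    · obtain ⟨b, hb, rfl⟩ := mem_projMultiset.1 hf
      exact hne (hd.eq_of_mem hN hb hxe hxf).symm
    rcases hf' with hd | hf'
    · obtain ⟨b, hb, rfl⟩ := mem_projMultiset.1 he
      exact hne (hd.eq_of_mem hN hb hxf hxe)
    have h1 := hkey e he f hf hne x hxe hxf
    have h2 := hkey f hf e he hne.symm x hxf hxe
    tauto

lemma IsSplitColoring.not {N₀ : Finset (Sym2 (V × Fin 2))} {c : Sym2 V → Prop}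
    (hc : IsSplitColoring N₀ c) : IsSplitColoring N₀ (fun e => ¬ c e) := by
  intro e he f hf hne x hxe hxf
  have := hc e he f hf hne x hxe hxf
  tauto

/-- An edge of multiplicity two is put in both parts; an edge of multiplicity one satisfies exactly
one of the two complementary conditions. -/
lemma splitPart_add {N₀ N : Finset (Sym2 (V × Fin 2))} (hN : IsEdgeMatching H N)
    (c : Sym2 V → Prop) :
    (splitPart N₀ c N).val + (splitPart N₀ (fun e => ¬ c e) N).val = projMultiset N := by
  ext e
  have hle := count_projMultiset_le hN e
  have hd : IsDoubleOver N e ↔ 2 ≤ (projMultiset N).count e := isDoubleOver_iff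
  have hm : e ∈ projMultiset N ↔ 1 ≤ (projMultiset N).count e := Multiset.one_le_count_iff_mem.symm
  rw [Multiset.count_add, Multiset.count_eq_of_nodup (Finset.nodup _),
    Multiset.count_eq_of_nodup (Finset.nodup _)]
  simp only [Finset.mem_val, splitPart, Finset.mem_filter, Finset.mem_univ, true_and, hd, hm]
  set n := (projMultiset N).count e
  by_cases h : (SharesLift N N₀ e ↔ c e)
  · simp only [h, or_true, and_true]
    interval_cases n <;> simp
  · have h' : (SharesLift N N₀ e ↔ ¬ c e) := by tauto
    simp only [h', or_true, and_true]
    interval_cases n <;> simp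

/-- Over an edge of multiplicity two, a matching contains every lift. Over an edge of multiplicity
one, the part records whether the lift is that of `N₀`, and if not it is the only other one. So one
part and the projection determine the matching. -/
lemma subset_of_splitPart_eq (h : IsTwoLift G H) {N₀ N N' : Finset (Sym2 (V × Fin 2))}
    (hN₀ : IsEdgeMatching H N₀) (hN : IsEdgeMatching H N) (hN' : IsEdgeMatching H N')
    (hp : projMultiset N = projMultiset N₀) (hp' : projMultiset N' = projMultiset N₀)
    {c : Sym2 V → Prop} (heq : splitPart N₀ c N = splitPart N₀ c N') : N ⊆ N' := by
  intro a ha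
  have hmem : liftProj a ∈ projMultiset N := mem_projMultiset.2 ⟨a, ha, rfl⟩
  obtain ⟨b, hb, hba⟩ := mem_projMultiset.1 (hp'.trans hp.symm ▸ hmem :
    liftProj a ∈ projMultiset N')
  obtain ⟨a0, ha0, haa0⟩ := mem_projMultiset.1 (hp ▸ hmem : liftProj a ∈ projMultiset N₀)
  by_cases hd : IsDoubleOver N' (liftProj a)
  · exact hd.mem h hN' (hN.1 a ha)
  have hd0 : ¬ IsDoubleOver N₀ (liftProj a) := by
    rwa [isDoubleOver_iff, ← hp', ← isDoubleOver_iff]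
  have hdN : ¬ IsDoubleOver N (liftProj a) := by
    rwa [isDoubleOver_iff, hp, ← isDoubleOver_iff]
  have huniq : ∀ M : Finset (Sym2 (V × Fin 2)), ¬ IsDoubleOver M (liftProj a) →
      ∀ e ∈ M, ∀ f ∈ M, liftProj e = liftProj a → liftProj f = liftProj a → e = f := by
    intro M hM e he f hf h1 h2
    by_contra hne
    exact hM ⟨e, he, f, hf, hne, h1, h2⟩
  have hiff : SharesLift N N₀ (liftProj a) ↔ SharesLift N' N₀ (liftProj a) := by
    have h1 := Finset.ext_iff.1 heq (liftProj a)
    have hmem' : liftProj a ∈ projMultiset N' := mem_projMultiset.2 ⟨b, hb, hba⟩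
    simp only [splitPart, Finset.mem_filter, Finset.mem_univ, true_and, hmem, hmem', hd, hdN,
      false_or] at h1
    tauto
  by_cases hD : SharesLift N N₀ (liftProj a)
  · obtain ⟨e', he', he0', hpe'⟩ := hiff.1 hD
    obtain ⟨e, he, he0, hpe⟩ := hD
    rw [huniq N hdN a ha e he rfl hpe, huniq N₀ hd0 e he0 e' he0' hpe hpe']
    exact he'
  · have hD' : ¬ SharesLift N' N₀ (liftProj a) := fun hh => hD (hiff.2 hh)
    obtain ⟨x, hx⟩ : ∃ x, x ∈ liftProj a := by
      induction a with | _ p q => exact ⟨p.1, by simp⟩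
    obtain ⟨i, hi⟩ := exists_mem_of_mem_liftProj hx
    obtain ⟨j, hj⟩ := exists_mem_of_mem_liftProj (hba.symm ▸ hx)
    obtain ⟨k, hk⟩ := exists_mem_of_mem_liftProj (haa0.symm ▸ hx)
    have h7 : i ≠ k := by
      rintro rfl
      have := h.edge_eq (hN.1 _ ha) (hN₀.1 _ ha0) haa0.symm hi hk
      exact hD ⟨a, ha, this ▸ ha0, rfl⟩
    have h8 : j ≠ k := by
      rintro rfl
      have := h.edge_eq (hN'.1 _ hb) (hN₀.1 _ ha0) (hba.trans haa0.symm) hj hk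
      exact hD' ⟨b, hb, this ▸ ha0, hba⟩
    rw [fin_two_eq h7 h8] at hi
    rw [h.edge_eq (hN.1 _ ha) (hN'.1 _ hb) hba.symm hi hj]
    exact hb

lemma card_fiber_le (h : IsTwoLift G H) (hG : G.IsBipartite) (E : Multiset (Sym2 V)) :
    ((avoidingMatchings H ∅).filter fun N => projMultiset N = E).card ≤
      ((avoidingMatchings G ∅ ×ˢ avoidingMatchings G ∅).filter
        fun p => p.1.val + p.2.val = E).card := by
  rcases Finset.eq_empty_or_nonempty ((avoidingMatchings H ∅).filter fun N => projMultiset N = E)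
    with h0 | ⟨N₀, hmem⟩
  · rw [h0]; simp
  obtain ⟨hmem', rfl⟩ := Finset.mem_filter.1 hmem
  have hN₀ := (mem_avoidingMatchings.1 hmem').1
  obtain ⟨c, hc⟩ := exists_splitColoring h hG hN₀
  refine Finset.card_le_card_of_injOn
    (fun N => (splitPart N₀ c N, splitPart N₀ (fun e => ¬ c e) N)) ?_ ?_
  · intro N hN
    obtain ⟨hN, hp⟩ := Finset.mem_filter.1 (Finset.mem_coe.1 hN)
    replace hN := (mem_avoidingMatchings.1 hN).1
    refine Finset.mem_coe.2 (Finset.mem_filter.2 ⟨Finset.mem_product.2 ⟨?_, ?_⟩, ?_⟩)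
    · exact mem_avoidingMatchings.2 ⟨splitPart_isEdgeMatching h hN₀ hN hp hc, by simp⟩
    · exact mem_avoidingMatchings.2 ⟨splitPart_isEdgeMatching h hN₀ hN hp hc.not, by simp⟩
    · rw [← hp]; exact splitPart_add hN c
  · intro N hN N' hN' heq
    obtain ⟨hN, hp⟩ := Finset.mem_filter.1 (Finset.mem_coe.1 hN)
    obtain ⟨hN', hp'⟩ := Finset.mem_filter.1 (Finset.mem_coe.1 hN')
    replace hN := (mem_avoidingMatchings.1 hN).1
    replace hN' := (mem_avoidingMatchings.1 hN').1
    have h1 : splitPart N₀ c N = splitPart N₀ c N' := congrArg Prod.fst heq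
    exact (subset_of_splitPart_eq h hN₀ hN hN' hp hp' h1).antisymm
      (subset_of_splitPart_eq h hN₀ hN' hN hp' hp h1.symm)

/-- The matching generating function of a `2`-lift is at most the square of that of the graph. -/
theorem matchingGen_twoLift_le (h : IsTwoLift G H) (hG : G.IsBipartite) {t : ℝ} (ht : 0 ≤ t) :
    matchingGen H t ≤ matchingGen G t ^ 2 := by
  set I := (avoidingMatchings H ∅).image projMultiset with hI
  have h1 : matchingGen H t = ∑ E ∈ I,
      ((avoidingMatchings H ∅).filter fun N => projMultiset N = E).card * t ^ E.card := by
    rw [matchingGen_eq_avoidSum, avoidSum, ← Finset.sum_fiberwise_of_maps_to (g := projMultiset)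
      (t := I) fun N hN => Finset.mem_image_of_mem _ hN]
    refine Finset.sum_congr rfl fun E _ => ?_
    rw [Finset.sum_congr rfl (g := fun _ => t ^ E.card), Finset.sum_const, nsmul_eq_mul]
    intro N hN
    rw [← (Finset.mem_filter.1 hN).2, projMultiset, Multiset.card_map, Finset.card_def]
  have h2 : ∑ E ∈ I, ((avoidingMatchings G ∅ ×ˢ avoidingMatchings G ∅).filter
      fun p => p.1.val + p.2.val = E).card * t ^ E.card ≤ matchingGen G t ^ 2 := by
    rw [matchingGen_eq_avoidSum, avoidSum, sq, Finset.sum_mul_sum, ← Finset.sum_product']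
    have h3 : ∀ E ∈ I, (((avoidingMatchings G ∅ ×ˢ avoidingMatchings G ∅).filter
        fun p => p.1.val + p.2.val = E).card : ℝ) * t ^ E.card =
        ∑ p ∈ (avoidingMatchings G ∅ ×ˢ avoidingMatchings G ∅).filter
          (fun p => p.1.val + p.2.val = E), t ^ p.1.card * t ^ p.2.card := by
      intro E _
      rw [Finset.sum_congr rfl (g := fun _ => t ^ E.card), Finset.sum_const, nsmul_eq_mul]
      intro p hp
      rw [← (Finset.mem_filter.1 hp).2, Multiset.card_add, pow_add]
      rfl
    rw [Finset.sum_congr rfl h3, Finset.sum_fiberwise_eq_sum_filter]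
    exact Finset.sum_le_sum_of_subset_of_nonneg (Finset.filter_subset _ _)
      fun _ _ _ => by positivity
  rw [h1]
  refine le_trans (Finset.sum_le_sum fun E _ => ?_) h2
  have := card_fiber_le h hG E
  gcongr

/-- Splitting a largest matching of `H`, with itself as reference, gives two matchings of `G` with
the same total size. -/
lemma maxMatchingSize_twoLift_le [Nonempty V] (h : IsTwoLift G H) (hG : G.IsBipartite) :
    maxMatchingSize H ≤ 2 * maxMatchingSize G := by
  obtain ⟨N₀, hN₀, hc₀⟩ := exists_card_eq_max (G := H)
  obtain ⟨c, hc⟩ := exists_splitColoring h hG hN₀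
  have h1 := congrArg Multiset.card (splitPart_add (N₀ := N₀) hN₀ c)
  have h2 := (splitPart_isEdgeMatching h hN₀ hN₀ rfl hc).card_le_max
  have h3 := (splitPart_isEdgeMatching h hN₀ hN₀ rfl hc.not).card_le_max
  rw [Multiset.card_add, projMultiset, Multiset.card_map] at h1
  simp only [Finset.card_val] at h1
  omega

lemma maxDensity_twoLift_le [Nonempty V] (h : IsTwoLift G H) (hG : G.IsBipartite) :
    maxDensity H ≤ maxDensity G := by
  have h1 : (maxMatchingSize H : ℝ) ≤ 2 * maxMatchingSize G := by
    exact_mod_cast maxMatchingSize_twoLift_le h hG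
  have hv := card_pos_real (V := V)
  have h2 : (Nat.card (V × Fin 2) : ℝ) = Nat.card V * 2 := by
    rw [Nat.card_prod]; simp
  rw [maxDensity, maxDensity, h2, div_le_div_iff₀ (by positivity) hv]
  nlinarith

/-- A `2`-lift of a bipartite graph does not have larger entropy. -/
theorem graphEntropy_twoLift_le [Nonempty V] (h : IsTwoLift G H) (hG : G.IsBipartite) {p : ℝ}
    (hp : 0 ≤ p) : graphEntropy H p ≤ graphEntropy G p := by
  rcases le_or_gt p (maxDensity H) with hpH | hpH
  · have hv := card_pos_real (V := V)
    have h2 : (Nat.card (V × Fin 2) : ℝ) = Nat.card V * 2 := by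
      rw [Nat.card_prod]; simp
    refine (isGLB_graphEntropy hp (hpH.trans (maxDensity_twoLift_le h hG))).2 ?_
    rintro _ ⟨s, hs, rfl⟩
    have hs0 : 0 < s := hs
    refine ((isGLB_graphEntropy hp hpH).1 ⟨s, hs, rfl⟩).trans ?_
    have h3 := Real.log_le_log (matchingGen_pos hs0.le) (matchingGen_twoLift_le h hG hs0.le)
    rw [Real.log_pow] at h3
    unfold entropyObjective
    gcongr ?_ - _
    rw [h2, div_le_div_iff₀ (by positivity) hv]
    push_cast at h3
    nlinarith
  · rw [graphEntropy, if_neg hpH.not_gt, if_neg hpH.ne']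
    exact graphEntropy_nonneg hp

end TwoLift

/-! ### Balls in graphs -/

section Ball

variable {V : Type u} {G : SimpleGraph V}

lemma mem_graphBall_iff {x y : V} {r : ℕ} :
    y ∈ graphBall G x r ↔ ∃ p : G.Walk x y, p.length ≤ r := by
  constructor
  · intro h
    have h' : G.edist x y ≤ r := h
    obtain ⟨p, hp⟩ := SimpleGraph.exists_walk_of_edist_ne_top
      (ne_top_of_le_ne_top (ENat.natCast_ne_top r) h')
    refine ⟨p, ?_⟩
    rw [← hp] at h'
    exact_mod_cast h'
  · rintro ⟨p, hp⟩
    exact (SimpleGraph.edist_le p).trans (by exact_mod_cast hp)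

lemma self_mem_graphBall (x : V) (r : ℕ) : x ∈ graphBall G x r :=
  mem_graphBall_iff.2 ⟨SimpleGraph.Walk.nil, by simp⟩

lemma graphBall_succ_of_adj {x y z : V} {r : ℕ} (hy : y ∈ graphBall G x r) (hyz : G.Adj y z) :
    z ∈ graphBall G x (r + 1) := by
  obtain ⟨p, hp⟩ := mem_graphBall_iff.1 hy
  exact mem_graphBall_iff.2 ⟨p.concat hyz, by rw [SimpleGraph.Walk.length_concat]; omega⟩

end Ball

/-! ### Balls of the regular tree and their copies in a graph -/

section Tree

variable {d : ℕ}

lemma regularTree_adj_length {w w' : TreeVertex d} (h : (regularTree d).Adj w w') :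
    w'.1.length ≤ w.1.length + 1 := by
  rcases h with ⟨c, hc⟩ | ⟨c, hc⟩
  · rw [hc]; simp
  · rw [hc]; simp only [List.length_cons]; omega

lemma regularTree_walk_length {w w' : TreeVertex d} (p : (regularTree d).Walk w w') :
    w'.1.length ≤ w.1.length + p.length := by
  induction p with
  | nil => simp
  | cons h p ih =>
    have := regularTree_adj_length h
    rw [SimpleGraph.Walk.length_cons]
    omega

lemma exists_tree_walk (l : List (Fin d)) (hl : l.IsChain (· ≠ ·)) :
    ∃ p : (regularTree d).Walk (treeRoot d) ⟨l, hl⟩, p.length = l.length := by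
  induction l with
  | nil => exact ⟨SimpleGraph.Walk.nil, rfl⟩
  | cons c l ih =>
    have hl' : l.IsChain (· ≠ ·) := hl.tail
    obtain ⟨p, hp⟩ := ih hl'
    have hadj : (regularTree d).Adj ⟨l, hl'⟩ ⟨c :: l, hl⟩ := Or.inl ⟨c, rfl⟩
    refine ⟨p.concat hadj, ?_⟩
    rw [SimpleGraph.Walk.length_concat, hp, List.length_cons]

lemma mem_treeBall {w : TreeVertex d} {r : ℕ} :
    w ∈ graphBall (regularTree d) (treeRoot d) r ↔ w.1.length ≤ r := by
  rw [mem_graphBall_iff]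
  constructor
  · rintro ⟨p, hp⟩
    have := regularTree_walk_length p
    have h0 : (treeRoot d).1.length = 0 := rfl
    omega
  · intro h
    obtain ⟨p, hp⟩ := exists_tree_walk w.1 w.2
    exact ⟨p, hp.trans_le h⟩

/-- `ψ` identifies the `r`-ball of the tree with the `r`-ball of `G` around `x`. -/
structure IsTreeBall {V : Type u} (G : SimpleGraph V) (x : V) (r : ℕ)
    (ψ : TreeVertex d → V) : Prop where
  root : ψ (treeRoot d) = x
  inj : ∀ w w' : TreeVertex d, w.1.length ≤ r → w'.1.length ≤ r → ψ w = ψ w' → w = w'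
  adj : ∀ w w' : TreeVertex d, w.1.length ≤ r → w'.1.length ≤ r →
    (G.Adj (ψ w) (ψ w') ↔ (regularTree d).Adj w w')
  mem : ∀ w : TreeVertex d, w.1.length ≤ r → ψ w ∈ graphBall G x r
  surj : ∀ y ∈ graphBall G x r, ∃ w : TreeVertex d, w.1.length ≤ r ∧ ψ w = y

variable {V : Type u} {G : SimpleGraph V}

open scoped Classical in
lemma exists_isTreeBall {x : V} {r m : ℕ} {α : SimpleGraph (Fin m)} {a : Fin m}
    (hT : BallIso (regularTree d) (treeRoot d) r α a) (hG : BallIso G x r α a) :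
    ∃ ψ : TreeVertex d → V, IsTreeBall G x r ψ := by
  obtain ⟨φ, hφ⟩ := hT
  obtain ⟨φ', hφ'⟩ := hG
  set Φ := φ.symm.trans φ' with hΦ
  refine ⟨fun w => if h : w ∈ graphBall (regularTree d) (treeRoot d) r then
    (Φ ⟨w, h⟩ : V) else x, ?_⟩
  have hval : ∀ (w : TreeVertex d) (h : w.1.length ≤ r),
      (if h : w ∈ graphBall (regularTree d) (treeRoot d) r then (Φ ⟨w, h⟩ : V) else x) =
        Φ ⟨w, mem_treeBall.2 h⟩ := fun w h => dif_pos _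
  refine ⟨?_, ?_, ?_, ?_, ?_⟩
  · rw [hval _ (Nat.zero_le _)]
    have : (⟨treeRoot d, mem_treeBall.2 (Nat.zero_le _)⟩ :
        graphBall (regularTree d) (treeRoot d) r) = φ a := Subtype.ext hφ.symm
    rw [this, hΦ]
    simpa using hφ'
  · intro w w' h h' heq
    simp only [hval _ h, hval _ h'] at heq
    have := Φ.injective (Subtype.ext heq)
    exact congrArg Subtype.val this
  · intro w w' h h'
    simp only [hval _ h, hval _ h']
    exact Φ.map_rel_iff (a := ⟨w, mem_treeBall.2 h⟩) (b := ⟨w', mem_treeBall.2 h'⟩)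
  · intro w h
    simp only [hval _ h]
    exact (Φ _).2
  · intro y hy
    obtain ⟨⟨w, hw⟩, hwy⟩ := Φ.surjective ⟨y, hy⟩
    refine ⟨w, mem_treeBall.1 hw, ?_⟩
    simp only [hval _ (mem_treeBall.1 hw)]
    rw [hwy]

lemma IsTreeBall.ballIso_iff {x : V} {r : ℕ} {ψ : TreeVertex d → V} (h : IsTreeBall G x r ψ)
    {m : ℕ} (α : SimpleGraph (Fin m)) (a : Fin m) :
    BallIso G x r α a ↔ BallIso (regularTree d) (treeRoot d) r α a := by
  have hbij : Function.Bijective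
      (fun w : graphBall (regularTree d) (treeRoot d) r =>
        (⟨ψ w, h.mem _ (mem_treeBall.1 w.2)⟩ : graphBall G x r)) := by
    constructor
    · intro w w' heq
      exact Subtype.ext (h.inj _ _ (mem_treeBall.1 w.2) (mem_treeBall.1 w'.2)
        (congrArg Subtype.val heq))
    · rintro ⟨y, hy⟩
      obtain ⟨w, hw, rfl⟩ := h.surj y hy
      exact ⟨⟨w, mem_treeBall.2 hw⟩, rfl⟩
  let Φ : (regularTree d).induce (graphBall (regularTree d) (treeRoot d) r) ≃g
      G.induce (graphBall G x r) :=
    { Equiv.ofBijective _ hbij with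
      map_rel_iff' := fun {w w'} => h.adj _ _ (mem_treeBall.1 w.2) (mem_treeBall.1 w'.2) }
  have hΦ : ∀ w, (Φ w : V) = ψ w := fun w => rfl
  constructor
  · rintro ⟨φ, hφ⟩
    refine ⟨φ.trans Φ.symm, ?_⟩
    have h1 : Φ ((φ.trans Φ.symm) a) = φ a := by simp
    have h2 : ψ ((φ.trans Φ.symm) a) = x := by rw [← hΦ, h1, hφ]
    exact h.inj _ _ (mem_treeBall.1 ((φ.trans Φ.symm) a).2) (Nat.zero_le _) (h2.trans h.root.symm)
  · rintro ⟨φ, hφ⟩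
    refine ⟨φ.trans Φ, ?_⟩
    have h1 : ((φ.trans Φ) a : V) = ψ (φ a) := rfl
    rw [h1, hφ, h.root]

lemma exists_treeBall_model (d r : ℕ) : ∃ (m : ℕ) (α : SimpleGraph (Fin m)) (a : Fin m),
    BallIso (regularTree d) (treeRoot d) r α a := by
  have hfin : Finite (graphBall (regularTree d) (treeRoot d) r) := by
    have h1 : {l : List (Fin d) | l.length ≤ r}.Finite := List.finite_length_le _ _
    have h2 : (graphBall (regularTree d) (treeRoot d) r) ⊆
        Subtype.val ⁻¹' {l : List (Fin d) | l.length ≤ r} := fun w hw => mem_treeBall.1 hw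
    exact ((h1.preimage Subtype.val_injective.injOn).subset h2).to_subtype
  obtain ⟨m, ⟨e⟩⟩ := Finite.exists_equiv_fin (graphBall (regularTree d) (treeRoot d) r)
  set B := (regularTree d).induce (graphBall (regularTree d) (treeRoot d) r)
  refine ⟨m, B.comap e.symm, e ⟨treeRoot d, self_mem_graphBall _ _⟩, ?_⟩
  refine ⟨SimpleGraph.Iso.comap e.symm B, ?_⟩
  simp

end Tree

/-! ### Convergence of the recursion on the tree -/

section CavityBounds

/-- Alternating lower and upper bounds for the iteration `q ↦ 1 / (1 + c q)`. -/
def cavityBounds (c : ℝ) : ℕ → ℝ × ℝ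
  | 0 => (0, 1)
  | k + 1 => (1 / (1 + c * (cavityBounds c k).2), 1 / (1 + c * (cavityBounds c k).1))

variable {c q : ℝ}

lemma cavityBounds_nonneg (hc : 0 ≤ c) (k : ℕ) :
    0 ≤ (cavityBounds c k).1 ∧ 0 ≤ (cavityBounds c k).2 := by
  induction k with
  | zero => simp [cavityBounds]
  | succ k ih =>
    obtain ⟨h1, h2⟩ := ih
    simp only [cavityBounds]
    constructor <;> positivity

lemma cavityBounds_bracket (hc : 0 ≤ c) (hq : 0 < q) (hfix : q * (1 + c * q) = 1) (k : ℕ) :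
    (cavityBounds c k).1 ≤ q ∧ q ≤ (cavityBounds c k).2 := by
  have hq1 : q = 1 / (1 + c * q) := by
    rw [eq_div_iff (by positivity)]; exact hfix
  induction k with
  | zero =>
    simp only [cavityBounds]
    refine ⟨hq.le, ?_⟩
    nlinarith [mul_nonneg hc (mul_nonneg hq.le hq.le)]
  | succ k ih =>
    obtain ⟨h1, h2⟩ := ih
    obtain ⟨h3, h4⟩ := cavityBounds_nonneg hc k
    simp only [cavityBounds]
    constructor
    · conv_rhs => rw [hq1]
      exact one_div_le_one_div_of_le (by positivity) (by gcongr)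
    · conv_lhs => rw [hq1]
      exact one_div_le_one_div_of_le (by positivity) (by gcongr)

/-- For an upper bound `y` and the next lower bound `x`, the fixed point equation gives `q - x = c q
x (y - q)`, and `c q x ≤ c q^2 = 1 - q`. The upper gap shrinks by `(1 - q)^2` over two steps. Since
`q > 0` the contraction is strict for every activity. -/
lemma cavityBounds_gap (hc : 0 ≤ c) (hq : 0 < q) (hfix : q * (1 + c * q) = 1) (k : ℕ) :
    (cavityBounds c k).2 - q ≤ (1 - q) ^ k ∧ q - (cavityBounds c k).1 ≤ (1 - q) ^ k := by
  have hcq : c * q ^ 2 = 1 - q := by linear_combination hfix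
  have hq1 : 0 ≤ 1 - q := by rw [← hcq]; positivity
  have hx : ∀ k, (cavityBounds c (k + 1)).1 * (1 + c * (cavityBounds c k).2) = 1 := by
    intro k
    have := (cavityBounds_nonneg hc k).2
    exact one_div_mul_cancel (by positivity)
  have hy : ∀ k, (cavityBounds c (k + 1)).2 * (1 + c * (cavityBounds c k).1) = 1 := by
    intro k
    have := (cavityBounds_nonneg hc k).1
    exact one_div_mul_cancel (by positivity)
  have hlow : ∀ k, q - (cavityBounds c (k + 1)).1 ≤ (1 - q) * ((cavityBounds c k).2 - q) := by
    intro k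
    have h1 := (cavityBounds_bracket hc hq hfix (k + 1)).1
    have h2 := (cavityBounds_bracket hc hq hfix k).2
    have h3 := hx k
    set x := (cavityBounds c (k + 1)).1
    set y := (cavityBounds c k).2
    have h4 : q - x = c * q * x * (y - q) := by linear_combination x * hfix - q * h3
    rw [h4, ← hcq]
    have : c * q * x ≤ c * q ^ 2 := by rw [sq, ← mul_assoc]; gcongr
    exact mul_le_mul_of_nonneg_right this (by linarith)
  have hup : ∀ k, (cavityBounds c (k + 2)).2 - q ≤ (1 - q) ^ 2 * ((cavityBounds c k).2 - q) := by
    intro k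
    have h1 := (cavityBounds_bracket hc hq hfix (k + 2)).2
    have h2 := (cavityBounds_bracket hc hq hfix k).2
    have h3 := hx k
    have h5 := hy (k + 1)
    set x := (cavityBounds c (k + 1)).1
    set y := (cavityBounds c k).2
    set y' := (cavityBounds c (k + 1 + 1)).2
    have h4 : q - x = c * q * x * (y - q) := by linear_combination x * hfix - q * h3
    have h6 : y' - q = (1 - q) * (1 - y') * (y - q) := by
      have h7 : y' - q = q * c * y' * (q - x) := by linear_combination q * h5 - y' * hfix
      have h8 : c * x * y' = 1 - y' := by linear_combination h5
      rw [h7, h4, ← h8, ← hcq]; ring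
    change y' - q ≤ _
    rw [h6, sq]
    gcongr
  have hub : ∀ k, (cavityBounds c k).2 - q ≤ (1 - q) ^ k := by
    intro k
    induction k using Nat.twoStepInduction with
    | zero => simp only [cavityBounds, pow_zero]; linarith
    | one => simp [cavityBounds]
    | more k ih _ =>
      refine (hup k).trans ?_
      rw [pow_add, mul_comm]
      exact mul_le_mul_of_nonneg_right ih (sq_nonneg _)
  refine ⟨hub k, ?_⟩
  cases k with
  | zero => simp only [cavityBounds, pow_zero]; linarith
  | succ k =>
    refine (hlow k).trans ?_
    rw [pow_succ, mul_comm]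
    exact mul_le_mul_of_nonneg_right (hub k) hq1

lemma tendsto_cavityBounds (hc : 0 ≤ c) (hq : 0 < q) (hfix : q * (1 + c * q) = 1) :
    Tendsto (fun k => (cavityBounds c k).1) atTop (𝓝 q) ∧
      Tendsto (fun k => (cavityBounds c k).2) atTop (𝓝 q) := by
  have hcq : c * q ^ 2 = 1 - q := by linear_combination hfix
  have hq1 : 0 ≤ 1 - q := by rw [← hcq]; positivity
  have h0 : Tendsto (fun k : ℕ => (1 - q) ^ k) atTop (𝓝 0) :=
    tendsto_pow_atTop_nhds_zero_of_lt_one hq1 (by linarith)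
  constructor
  · refine tendsto_of_tendsto_of_tendsto_of_le_of_le (g := fun k => q - (1 - q) ^ k)
      (h := fun _ => q) (by simpa using h0.const_sub q) tendsto_const_nhds ?_ ?_
    · intro k
      have := (cavityBounds_gap hc hq hfix k).2
      change q - (1 - q) ^ k ≤ (cavityBounds c k).1
      linarith
    · exact fun k => (cavityBounds_bracket hc hq hfix k).1
  · refine tendsto_of_tendsto_of_tendsto_of_le_of_le (g := fun _ => q)
      (h := fun k => q + (1 - q) ^ k) tendsto_const_nhds (by simpa using h0.const_add q) ?_ ?_
    · exact fun k => (cavityBounds_bracket hc hq hfix k).2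
    · intro k
      have := (cavityBounds_gap hc hq hfix k).1
      change (cavityBounds c k).2 ≤ q + (1 - q) ^ k
      linarith

end CavityBounds

/-! ### The recursion inside a tree ball -/

section LocalRecursion

variable {V : Type u} {G : SimpleGraph V} [Fintype V]

/-- The ratio is the probability that `x` is uncovered by a random matching of the graph without
`S`, so the vertex recursion becomes one for these probabilities. -/
lemma avoidSum_ratio_eq {S : Set V} {x : V} (hx : x ∉ S) {t : ℝ} (ht : 0 ≤ t) :
    avoidSum G (insert x S) t / avoidSum G S t =
      1 / (1 + t * ∑ u ∈ freeNeighbors G S x,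
        avoidSum G (insert u (insert x S)) t / avoidSum G (insert x S) t) := by
  have h1 := avoidSum_pos (G := G) (insert x S) ht
  rw [avoidSum_recursion hx t, ← Finset.sum_div]
  have h2 : 0 ≤ ∑ u ∈ freeNeighbors G S x, avoidSum G (insert u (insert x S)) t :=
    Finset.sum_nonneg fun u _ => (avoidSum_pos _ ht).le
  have : 0 < avoidSum G (insert x S) t +
    t * ∑ u ∈ freeNeighbors G S x, avoidSum G (insert u (insert x S)) t := by positivity
  field_simp

lemma avoidSum_ratio_mem {S : Set V} (x : V) {t : ℝ} (ht : 0 ≤ t) :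
    0 ≤ avoidSum G (insert x S) t / avoidSum G S t ∧
      avoidSum G (insert x S) t / avoidSum G S t ≤ 1 := by
  have h1 := avoidSum_pos (G := G) (insert x S) ht
  have h2 := avoidSum_pos (G := G) S ht
  exact ⟨by positivity, (div_le_one h2).2 (avoidSum_anti (Set.subset_insert _ _) ht)⟩

lemma ratio_bounds_of_free {S : Set V} {x : V} (hx : x ∉ S) {t : ℝ} (ht : 0 ≤ t) {b : ℕ}
    (hb : (freeNeighbors G S x).card = b) {l h : ℝ} (hl0 : 0 ≤ l)
    (hbd : ∀ u ∈ freeNeighbors G S x,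
      l ≤ avoidSum G (insert u (insert x S)) t / avoidSum G (insert x S) t ∧
        avoidSum G (insert u (insert x S)) t / avoidSum G (insert x S) t ≤ h) :
    1 / (1 + b * t * h) ≤ avoidSum G (insert x S) t / avoidSum G S t ∧
      avoidSum G (insert x S) t / avoidSum G S t ≤ 1 / (1 + b * t * l) := by
  have h1 := Finset.card_nsmul_le_sum _ _ _ fun u hu => (hbd u hu).1
  have h2 := Finset.sum_le_card_nsmul _ _ _ fun u hu => (hbd u hu).2
  rw [hb, nsmul_eq_mul] at h1 h2
  rw [avoidSum_ratio_eq hx ht]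
  set s := ∑ u ∈ freeNeighbors G S x,
    avoidSum G (insert u (insert x S)) t / avoidSum G (insert x S) t
  have hs : 0 ≤ s := le_trans (by positivity) h1
  have h1' := mul_le_mul_of_nonneg_left h1 ht
  have h2' := mul_le_mul_of_nonneg_left h2 ht
  constructor
  · exact one_div_le_one_div_of_le (by positivity) (by linarith)
  · exact one_div_le_one_div_of_le (by positivity) (by linarith)

variable {d : ℕ}

/-- The images of the proper suffixes of a word. -/
def suffixImage (ψ : TreeVertex d → V) (w : TreeVertex d) : Set V :=
  {y | ∃ w' : TreeVertex d, w'.1 <:+ w.1 ∧ w' ≠ w ∧ ψ w' = y}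

lemma suffixImage_root (ψ : TreeVertex d → V) : suffixImage ψ (treeRoot d) = ∅ := by
  rw [Set.eq_empty_iff_forall_notMem]
  rintro y ⟨w', h1, h2, -⟩
  exact h2 (Subtype.ext (List.suffix_nil.1 h1))

lemma suffixImage_cons (ψ : TreeVertex d → V) (w : TreeVertex d) (c : Fin d)
    (hc : (c :: w.1).IsChain (· ≠ ·)) :
    suffixImage ψ ⟨c :: w.1, hc⟩ = insert (ψ w) (suffixImage ψ w) := by
  ext y
  constructor
  · rintro ⟨w', h1, h2, rfl⟩
    rcases List.suffix_cons_iff.1 h1 with h | h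
    · exact absurd (Subtype.ext h) h2
    · by_cases hw : w' = w
      · left; rw [hw]
      · right; exact ⟨w', h, hw, rfl⟩
  · rintro (rfl | ⟨w', h1, h2, rfl⟩)
    · refine ⟨w, List.suffix_cons _ _, fun h => ?_, rfl⟩
      have := congrArg (fun w : TreeVertex d => w.1.length) h
      simp at this
    · refine ⟨w', h1.trans (List.suffix_cons _ _), fun h => ?_, rfl⟩
      have h3 := h1.length_le
      rw [h] at h3
      simp at h3

variable {x : V} {r : ℕ} {ψ : TreeVertex d → V}

lemma IsTreeBall.notMem_suffixImage (h : IsTreeBall G x r ψ) {w : TreeVertex d}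
    (hw : w.1.length ≤ r) : ψ w ∉ suffixImage ψ w := by
  rintro ⟨w', h1, h2, h3⟩
  exact h2 (h.inj _ _ (h1.length_le.trans hw) hw h3)

lemma IsTreeBall.mem_ball_length (h : IsTreeBall G x r ψ) (l : List (Fin d))
    (hl : l.IsChain (· ≠ ·)) (hr : l.length ≤ r) : ψ ⟨l, hl⟩ ∈ graphBall G x l.length := by
  induction l with
  | nil =>
    have : ψ ⟨[], hl⟩ = x := h.root
    rw [this]; exact self_mem_graphBall _ _
  | cons c l ih =>
    have hl' : l.IsChain (· ≠ ·) := hl.tail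
    rw [List.length_cons] at hr ⊢
    refine graphBall_succ_of_adj (ih hl' (by omega)) ?_
    rw [h.adj _ _ (by simp only; omega) (by simp only [List.length_cons]; omega)]
    exact Or.inl ⟨c, rfl⟩

/-- Deleting the images of the proper suffixes removes the parent, so only the children of `w`
remain. The strict inequality keeps all neighbours of `ψ w` inside the ball. -/
lemma IsTreeBall.mem_freeNeighbors_iff (h : IsTreeBall G x r ψ) {w : TreeVertex d}
    (hw : w.1.length < r) {u : V} :
    u ∈ freeNeighbors G (suffixImage ψ w) (ψ w) ↔
      ∃ (c : Fin d) (hc : (c :: w.1).IsChain (· ≠ ·)), u = ψ ⟨c :: w.1, hc⟩ := by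
  rw [mem_freeNeighbors]
  constructor
  · rintro ⟨hadj, hu⟩
    have hmem : u ∈ graphBall G x (w.1.length + 1) :=
      graphBall_succ_of_adj (h.mem_ball_length w.1 w.2 hw.le) hadj
    have hmem' : u ∈ graphBall G x r := by
      obtain ⟨p, hp⟩ := mem_graphBall_iff.1 hmem
      exact mem_graphBall_iff.2 ⟨p, by omega⟩
    obtain ⟨w', hw', rfl⟩ := h.surj u hmem'
    rw [h.adj _ _ hw.le hw'] at hadj
    rcases hadj with ⟨c, hc⟩ | ⟨c, hc⟩
    · refine ⟨c, hc ▸ w'.2, ?_⟩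
      congr 1
      exact Subtype.ext hc
    · refine absurd ⟨w', ?_, ?_, rfl⟩ hu
      · rw [hc]; exact List.suffix_cons _ _
      · intro heq
        have := congrArg (fun w : TreeVertex d => w.1.length) heq
        simp only [hc, List.length_cons] at this
        omega
  · rintro ⟨c, hc, rfl⟩
    refine ⟨(h.adj w ⟨c :: w.1, hc⟩ hw.le hw).2 (Or.inl ⟨c, rfl⟩), ?_⟩
    rintro ⟨w', h1, -, h3⟩
    have h4 := h.inj w' ⟨c :: w.1, hc⟩ (h1.length_le.trans hw.le) hw h3
    have h5 := h1.length_le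
    rw [h4] at h5
    simp at h5

open scoped Classical in
lemma IsTreeBall.card_freeNeighbors (h : IsTreeBall G x r ψ) {w : TreeVertex d}
    (hw : w.1.length < r) :
    (freeNeighbors G (suffixImage ψ w) (ψ w)).card = if w.1 = [] then d else d - 1 := by
  have h1 : (Finset.univ.filter fun c : Fin d => (c :: w.1).IsChain (· ≠ ·)).card =
      (freeNeighbors G (suffixImage ψ w) (ψ w)).card := by
    refine Finset.card_bij (fun c hc => ψ ⟨c :: w.1, (Finset.mem_filter.1 hc).2⟩) ?_ ?_ ?_
    · intro c hc
      exact (h.mem_freeNeighbors_iff hw).2 ⟨c, _, rfl⟩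
    · intro c hc c' hc' heq
      have := congrArg Subtype.val (h.inj ⟨c :: w.1, (Finset.mem_filter.1 hc).2⟩
        ⟨c' :: w.1, (Finset.mem_filter.1 hc').2⟩ hw hw heq)
      exact (List.cons_eq_cons.1 this).1
    · intro u hu
      obtain ⟨c, hc, rfl⟩ := (h.mem_freeNeighbors_iff hw).1 hu
      exact ⟨c, by simpa using hc, rfl⟩
  rw [← h1]
  split_ifs with hw0
  · simp [hw0]
  · obtain ⟨l, hl⟩ := w
    cases l with
    | nil => exact absurd rfl hw0
    | cons a l =>
      have h2 : (Finset.univ.filter fun c : Fin d => (c :: a :: l).IsChain (· ≠ ·)) =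
          Finset.univ.erase a := by
        ext c
        simp only [Finset.mem_filter, Finset.mem_univ, true_and, Finset.mem_erase, and_true,
          List.isChain_cons_cons, hl]
      simp only [h2]
      rw [Finset.card_erase_of_mem (Finset.mem_univ _), Finset.card_univ, Fintype.card_fin]

/-- Nothing is known beyond the ball, so the induction starts from the trivial bounds `0` and `1`.
Below the root every vertex has `d - 1` free neighbours, hence the constant `(d - 1) t`. -/
lemma IsTreeBall.ratio_bounds (h : IsTreeBall G x r ψ) {t : ℝ} (ht : 0 ≤ t) (k : ℕ) :
    ∀ w : TreeVertex d, w.1 ≠ [] → w.1.length + k ≤ r →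
      (cavityBounds ((d - 1 : ℕ) * t) k).1 ≤
          avoidSum G (insert (ψ w) (suffixImage ψ w)) t / avoidSum G (suffixImage ψ w) t ∧
        avoidSum G (insert (ψ w) (suffixImage ψ w)) t / avoidSum G (suffixImage ψ w) t ≤
          (cavityBounds ((d - 1 : ℕ) * t) k).2 := by
  induction k with
  | zero =>
    intro w _ _
    exact avoidSum_ratio_mem _ ht
  | succ k ih =>
    intro w hw0 hw
    have hnn := cavityBounds_nonneg (c := (d - 1 : ℕ) * t) (by positivity) k
    have hwr : w.1.length < r := by omega
    refine ratio_bounds_of_free (h.notMem_suffixImage hwr.le) ht (b := d - 1) ?_ hnn.1 ?_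
    · rw [h.card_freeNeighbors hwr, if_neg hw0]
    · intro u hu
      obtain ⟨c, hc, rfl⟩ := (h.mem_freeNeighbors_iff hwr).1 hu
      rw [← suffixImage_cons ψ w c hc]
      exact ih _ (List.cons_ne_nil _ _) (by simp only [List.length_cons]; omega)

lemma IsTreeBall.root_ratio_bounds {k : ℕ} (h : IsTreeBall G x (k + 1) ψ) {t : ℝ} (ht : 0 ≤ t) :
    1 / (1 + d * t * (cavityBounds ((d - 1 : ℕ) * t) k).2) ≤
        avoidSum G {x} t / avoidSum G ∅ t ∧
      avoidSum G {x} t / avoidSum G ∅ t ≤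
        1 / (1 + d * t * (cavityBounds ((d - 1 : ℕ) * t) k).1) := by
  have hnn := cavityBounds_nonneg (c := (d - 1 : ℕ) * t) (by positivity) k
  have h0 : (treeRoot d).1.length < k + 1 := Nat.succ_pos _
  have hx : ψ (treeRoot d) = x := h.root
  have hfree := h.card_freeNeighbors h0
  rw [if_pos (show (treeRoot d).1 = [] from rfl)] at hfree
  have := ratio_bounds_of_free (h.notMem_suffixImage h0.le) ht hfree hnn.1 (by
    intro u hu
    obtain ⟨c, hc, rfl⟩ := (h.mem_freeNeighbors_iff h0).1 hu
    rw [← suffixImage_cons ψ _ c hc]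
    refine h.ratio_bounds ht k _ (List.cons_ne_nil _ _) ?_
    simp only [List.length_cons, treeRoot, List.length_nil]
    omega)
  rwa [suffixImage_root, hx, insert_empty_eq] at this

/-- A vertex is uncovered with probability at least `1 - D t`. This keeps `p(G, t) / (2t)` bounded
near `t = 0`, uniformly in the graph, as dominated convergence requires later. -/
lemma densityFn_le_degree [Nonempty V] {D : ℕ} (hD : ∀ x : V, (G.neighborSet x).ncard ≤ D)
    {t : ℝ} (ht : 0 ≤ t) : densityFn G t ≤ D * t := by
  have hv := card_pos_real (V := V)
  have h1 := one_sub_densityFn (G := G) ht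
  have h2 : ∀ x ∈ (Finset.univ : Finset V),
      (1 - D * t) ≤ avoidSum G {x} t / avoidSum G ∅ t := by
    intro x _
    have hZ := avoidSum_pos (G := G) ∅ ht
    rw [le_div_iff₀ hZ]
    have hrec := avoidSum_recursion (G := G) (Set.notMem_empty x) t
    rw [insert_empty_eq] at hrec
    have hcard : ((freeNeighbors G ∅ x).card : ℝ) ≤ D := by
      have : (freeNeighbors G ∅ x).card = (G.neighborSet x).ncard := by
        rw [← Set.ncard_coe_finset]
        congr 1
        ext u
        simp [mem_freeNeighbors]
      rw [this]
      exact_mod_cast hD x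
    have hsum : ∑ u ∈ freeNeighbors G ∅ x, avoidSum G (insert u {x}) t ≤ D * avoidSum G ∅ t := by
      refine (Finset.sum_le_card_nsmul _ _ (avoidSum G ∅ t) fun u _ =>
        avoidSum_anti (Set.empty_subset _) ht).trans ?_
      rw [nsmul_eq_mul]
      exact mul_le_mul_of_nonneg_right hcard hZ.le
    have := mul_le_mul_of_nonneg_left hsum ht
    linarith
  have h3 := Finset.card_nsmul_le_sum _ _ _ h2
  rw [Finset.card_univ, nsmul_eq_mul, ← Nat.card_eq_fintype_card] at h3
  have h4 : 1 - D * t ≤ 1 - densityFn G t := by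
    rw [h1, le_div_iff₀ hv]
    linarith
  linarith

end LocalRecursion

/-! ### Convergence of the densities -/

section DensityLimit

/-- The number `1 - p(G, t)` is the average probability of being uncovered. Vertices outside `B`
change it by at most their proportion. -/
lemma abs_one_sub_densityFn_sub_le {V : Type u} [Fintype V] [Nonempty V] {G : SimpleGraph V}
    {t R δ : ℝ} (ht : 0 ≤ t) (hR : 0 ≤ R) (hR1 : R ≤ 1) (B : Set V)
    (hgood : ∀ x ∈ B, |avoidSum G {x} t / avoidSum G ∅ t - R| ≤ δ) (hδ : 0 ≤ δ) :
    |(1 - densityFn G t) - R| ≤ δ + (1 - (B.ncard : ℝ) / Nat.card V) := by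
  classical
  have hv := card_pos_real (V := V)
  have hsum : ∀ x ∈ (Finset.univ : Finset V), |avoidSum G {x} t / avoidSum G ∅ t - R| ≤
      δ + if x ∈ Bᶜ then 1 else 0 := by
    intro x _
    by_cases hx : x ∈ B
    · have := hgood x hx
      simp [hx, this]
    · have h1 := avoidSum_ratio_mem (G := G) (S := ∅) x ht
      rw [insert_empty_eq] at h1
      have : |avoidSum G {x} t / avoidSum G ∅ t - R| ≤ 1 := by
        rw [abs_le]; constructor <;> linarith [h1.1, h1.2]
      simp only [Set.mem_compl_iff, hx, not_false_eq_true, if_true]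
      linarith
  have h2 : ∑ x : V, (δ + if x ∈ Bᶜ then (1 : ℝ) else 0) =
      Nat.card V * δ + (Nat.card V - B.ncard) := by
    rw [Finset.sum_add_distrib, Finset.sum_const, Finset.card_univ, nsmul_eq_mul,
      ← Nat.card_eq_fintype_card]
    congr 1
    rw [← Finset.sum_filter, Finset.sum_const, nsmul_eq_mul, mul_one, ← Set.ncard_coe_finset]
    have h3 : ((Finset.univ.filter fun x => x ∈ Bᶜ : Finset V) : Set V) = Bᶜ := by
      ext x; simp
    rw [h3, ← Set.ncard_add_ncard_compl B]
    push_cast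
    ring
  have h4 : (1 - densityFn G t) - R =
      (∑ x : V, (avoidSum G {x} t / avoidSum G ∅ t - R)) / Nat.card V := by
    rw [one_sub_densityFn ht, Finset.sum_sub_distrib, Finset.sum_const, Finset.card_univ,
      nsmul_eq_mul, ← Nat.card_eq_fintype_card]
    field_simp
  rw [h4, abs_div, abs_of_pos hv, div_le_iff₀ hv]
  refine (Finset.abs_sum_le_sum_abs _ _).trans ((Finset.sum_le_sum hsum).trans ?_)
  rw [h2]
  have : (δ + (1 - (B.ncard : ℝ) / Nat.card V)) * Nat.card V =
    Nat.card V * δ + (Nat.card V - B.ncard) := by field_simp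
  rw [this]

/-- Choose a depth at which both bounds at the root are within `ε / 2` of the limit. The vertices
whose ball of the next radius is not the tree ball have proportion tending to `0`. -/
lemma tendsto_densityFn_of_BS {V : ℕ → Type u} {G : ∀ i, SimpleGraph (V i)} {d : ℕ}
    (h : BSConvergesTo G (regularTree d) (treeRoot d)) {t q : ℝ} (ht : 0 ≤ t) (hq : 0 < q)
    (hfix : q * (1 + (d - 1 : ℕ) * t * q) = 1) :
    Tendsto (fun i => densityFn (G i) t) atTop (𝓝 (1 - 1 / (1 + d * t * q))) := by
  obtain ⟨hfin, -, hconv⟩ := h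
  set R := 1 / (1 + d * t * q) with hR
  have hR0 : 0 ≤ R := by positivity
  have hR1 : R ≤ 1 := by
    rw [hR, div_le_one (by positivity)]
    have : 0 ≤ d * t * q := by positivity
    linarith
  obtain ⟨hlo, hhi⟩ := tendsto_cavityBounds (c := (d - 1 : ℕ) * t) (by positivity) hq hfix
  have hcont : ContinuousAt (fun y : ℝ => 1 / (1 + d * t * y)) q := by
    refine ContinuousAt.div continuousAt_const (by fun_prop) (by positivity)
  have hlo' := hcont.tendsto.comp hlo
  have hhi' := hcont.tendsto.comp hhi
  rw [Metric.tendsto_nhds]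
  intro ε hε
  obtain ⟨k, hk1, hk2⟩ := ((Metric.tendsto_nhds.1 hlo' (ε / 2) (by positivity)).and
    (Metric.tendsto_nhds.1 hhi' (ε / 2) (by positivity))).exists
  simp only [Function.comp, Real.dist_eq, abs_lt] at hk1 hk2
  obtain ⟨m, α, a, hα⟩ := exists_treeBall_model d (k + 1)
  have hprob := hconv (k + 1) (Nat.succ_pos _) m α a
  rw [rootedBallProb, if_pos hα] at hprob
  filter_upwards [Metric.tendsto_nhds.1 hprob (ε / 2) (by positivity)] with i hi
  obtain ⟨_, _⟩ := hfin i
  cases nonempty_fintype (V i)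
  rw [Real.dist_eq, abs_lt] at hi
  have := abs_one_sub_densityFn_sub_le (G := G i) ht hR0 hR1
    {x | BallIso (G i) x (k + 1) α a} (δ := ε / 2) (by
      intro x hx
      obtain ⟨ψ, hψ⟩ := exists_isTreeBall hα hx
      obtain ⟨h1, h2⟩ := hψ.root_ratio_bounds ht
      rw [abs_le]
      constructor <;> linarith) (by positivity)
  rw [Real.dist_eq, ← abs_neg]
  have e : -(densityFn (G i) t - (1 - R)) = (1 - densityFn (G i) t) - R := by ring
  rw [e]
  rw [ballProb] at hi
  linarith

end DensityLimit

/-! ### Pressure and entropy in the limit -/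

section TreeEntropy

/-- The activity at which the `d`-regular tree has density `x`. -/
def treeActivity (d : ℕ) (x : ℝ) : ℝ := x * (d - x) / (d ^ 2 * (1 - x) ^ 2)

/-- The pressure of the `d`-regular tree at density `x`. -/
def treePressure (d : ℕ) (x : ℝ) : ℝ := -Real.log (1 - x) + d / 2 * Real.log (1 - x / d)

/-- The derivative of `treeActivity d`. -/
def treeActivityDeriv (d : ℕ) (x : ℝ) : ℝ := (d - 2 * x + d * x) / (d ^ 2 * (1 - x) ^ 3)

/-- The derivative of `treePressure d`. -/
def treePressureDeriv (d : ℕ) (x : ℝ) : ℝ := (d - 2 * x + d * x) / (2 * (1 - x) * (d - x))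

variable {d : ℕ} {x : ℝ}

lemma hasDerivAt_treeActivity (hd : 1 ≤ d) (hx : x < 1) :
    HasDerivAt (treeActivity d) (treeActivityDeriv d x) x := by
  have hd1 : (1 : ℝ) ≤ d := by exact_mod_cast hd
  have h1x : 0 < 1 - x := by linarith
  have hN : HasDerivAt (fun x : ℝ => x * (d - x)) (1 * (d - x) + x * (0 - 1)) x :=
    (hasDerivAt_id x).mul ((hasDerivAt_const x (d : ℝ)).sub (hasDerivAt_id x))
  have hD : HasDerivAt (fun x : ℝ => (d : ℝ) ^ 2 * (1 - x) ^ 2)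
      ((d : ℝ) ^ 2 * ((2 : ℕ) * (1 - x) ^ (2 - 1) * (0 - 1))) x :=
    (((hasDerivAt_const x (1 : ℝ)).sub (hasDerivAt_id x)).pow 2).const_mul _
  have := hN.div hD (by positivity)
  refine this.congr_deriv ?_
  rw [treeActivityDeriv]
  field_simp
  push_cast
  ring

lemma hasDerivAt_treePressure (hd : 1 ≤ d) (hx : x < 1) :
    HasDerivAt (treePressure d) (treePressureDeriv d x) x := by
  have hd1 : (1 : ℝ) ≤ d := by exact_mod_cast hd
  have h1x : 0 < 1 - x := by linarith
  have hdx : 0 < d - x := by linarith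
  have h1d : 0 < 1 - x / d := by
    rw [sub_pos, div_lt_one (by linarith)]; linarith
  have h1 : HasDerivAt (fun x : ℝ => -Real.log (1 - x)) (-((0 - 1) / (1 - x))) x :=
    (((hasDerivAt_const x (1 : ℝ)).sub (hasDerivAt_id x)).log h1x.ne').neg
  have h2 : HasDerivAt (fun x : ℝ => (d : ℝ) / 2 * Real.log (1 - x / d))
      ((d : ℝ) / 2 * ((0 - 1 / d) / (1 - x / d))) x :=
    (((hasDerivAt_const x (1 : ℝ)).sub ((hasDerivAt_id x).div_const _)).log h1d.ne').const_mul _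
  refine (h1.add h2).congr_deriv ?_
  rw [treePressureDeriv]
  have h3 : 1 - x / d = (d - x) / d := by field_simp
  rw [h3]
  field_simp
  ring

lemma treeActivity_pos (hd : 1 ≤ d) (hx0 : 0 < x) (hx : x < 1) : 0 < treeActivity d x := by
  have hd1 : (1 : ℝ) ≤ d := by exact_mod_cast hd
  have h1x : 0 < 1 - x := by linarith
  have hdx : 0 < d - x := by linarith
  unfold treeActivity; positivity

lemma treeActivity_zero : treeActivity d 0 = 0 := by simp [treeActivity]

lemma treePressure_zero : treePressure d 0 = 0 := by simp [treePressure]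

lemma treeActivity_nonneg (hd : 1 ≤ d) (hx0 : 0 ≤ x) (hx : x < 1) : 0 ≤ treeActivity d x := by
  rcases hx0.eq_or_lt with rfl | h
  · rw [treeActivity_zero]
  · exact (treeActivity_pos hd h hx).le

/-- The tree pressure satisfies the same law `dP = p dt / (2t)` as `ln M / v` of a finite graph,
here parametrised by the density; this identifies it as the limit pressure. -/
lemma mul_treeActivityDeriv (hd : 1 ≤ d) (hx0 : 0 < x) (hx : x < 1) :
    x / (2 * treeActivity d x) * treeActivityDeriv d x = treePressureDeriv d x := by
  have hd1 : (1 : ℝ) ≤ d := by exact_mod_cast hd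
  have h1x : 0 < 1 - x := by linarith
  have hdx : 0 < d - x := by linarith
  rw [treeActivity, treeActivityDeriv, treePressureDeriv]
  field_simp

lemma continuousOn_treeActivityDeriv (hd : 1 ≤ d) :
    ContinuousOn (treeActivityDeriv d) (Set.Iio 1) := by
  have hd1 : (1 : ℝ) ≤ d := by exact_mod_cast hd
  unfold treeActivityDeriv
  refine ContinuousOn.div (by fun_prop) (by fun_prop) fun x hx => ?_
  have h1x : 0 < 1 - x := by linarith [show x < 1 from hx]
  positivity

lemma continuousOn_treePressureDeriv (hd : 1 ≤ d) :
    ContinuousOn (treePressureDeriv d) (Set.Iio 1) := by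
  have hd1 : (1 : ℝ) ≤ d := by exact_mod_cast hd
  unfold treePressureDeriv
  refine ContinuousOn.div (by fun_prop) (by fun_prop) fun x hx => ?_
  have h1x : 0 < 1 - x := by linarith [show x < 1 from hx]
  have hdx : 0 < d - x := by linarith
  positivity

lemma continuousOn_treeActivity (hd : 1 ≤ d) :
    ContinuousOn (treeActivity d) (Set.Iio 1) := fun _ hx =>
  (hasDerivAt_treeActivity hd hx).continuousAt.continuousWithinAt

lemma objective_tree_eq_gurvits (hd : 1 ≤ d) (hx0 : 0 < x) (hx : x < 1) :
    treePressure d x - x / 2 * Real.log (treeActivity d x) = gurvitsFn d x := by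
  have hd1 : (1 : ℝ) ≤ d := by exact_mod_cast hd
  have hd0 : (d : ℝ) ≠ 0 := by positivity
  have h1x : 0 < 1 - x := by linarith
  have hdx : 0 < d - x := by linarith
  have h3 : 1 - x / d = (d - x) / d := by field_simp
  rw [treePressure, gurvitsFn, treeActivity, h3, Real.log_div hdx.ne' hd0,
    Real.log_div hd0 hx0.ne', Real.log_div (by positivity) (by positivity),
    Real.log_mul hx0.ne' hdx.ne', Real.log_mul (by positivity) (by positivity), Real.log_pow,
    Real.log_pow]
  push_cast
  ring

lemma gurvitsFn_zero : gurvitsFn d 0 = 0 := by simp [gurvitsFn]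

lemma tendsto_densityFn_treeActivity {V : ℕ → Type u} {G : ∀ i, SimpleGraph (V i)}
    (hd : 1 ≤ d) (h : BSConvergesTo G (regularTree d) (treeRoot d)) (hx0 : 0 ≤ x) (hx : x < 1) :
    Tendsto (fun i => densityFn (G i) (treeActivity d x)) atTop (𝓝 x) := by
  have hd1 : (1 : ℝ) ≤ d := by exact_mod_cast hd
  have h1x : 0 < 1 - x := by linarith
  have hdx : 0 < d - x := by linarith
  have hcast : ((d - 1 : ℕ) : ℝ) = d - 1 := by push_cast [hd]; ring
  -- The value `d (1 - x) / (d - x)` solves the fixed point equation at this activity: it is the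
  -- probability that a non-root tree vertex is uncovered once its parent is deleted.
  have := tendsto_densityFn_of_BS h (t := treeActivity d x) (q := d * (1 - x) / (d - x))
    (treeActivity_nonneg hd hx0 hx) (by positivity) (by
      rw [hcast, treeActivity]; field_simp; ring)
  convert this using 2
  have h4 : d * treeActivity d x * (d * (1 - x) / (d - x)) = x / (1 - x) := by
    rw [treeActivity]; field_simp
  rw [h4]
  have h5 : 1 + x / (1 - x) = 1 / (1 - x) := by field_simp; ring
  rw [h5]
  simp

section PressureGap

variable {V : Type u} {G : SimpleGraph V} [Fintype V]

/-- The derivative of `log M(G, t) / v(G)` in `t`. -/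
def pressureDeriv (G : SimpleGraph V) (t : ℝ) : ℝ :=
  (∑ N ∈ avoidingMatchings G ∅, (N.card : ℝ) * t ^ (N.card - 1)) /
    matchingGen G t / (Nat.card V : ℝ)

/-- The derivative in `x` of the difference of the pressures of `G` and of the tree. -/
def pressureGapDeriv (G : SimpleGraph V) (d : ℕ) (x : ℝ) : ℝ :=
  pressureDeriv G (treeActivity d x) * treeActivityDeriv d x - treePressureDeriv d x

lemma pressureDeriv_eq [Nonempty V] {t : ℝ} (ht : 0 < t) :
    pressureDeriv G t = densityFn G t / (2 * t) := by
  have hv := card_pos_real (V := V)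
  have hM := matchingGen_pos (G := G) ht.le
  have h1 := mul_deriv_matchingGen (G := G) t
  rw [(hasDerivAt_matchingGen t).deriv] at h1
  rw [pressureDeriv, densityFn_eq, ← h1]
  field_simp

lemma hasDerivAt_pressureGap (hd : 1 ≤ d) (hx0 : 0 ≤ x) (hx : x < 1) :
    HasDerivAt (fun x => Real.log (matchingGen G (treeActivity d x)) / (Nat.card V : ℝ) -
      treePressure d x) (pressureGapDeriv G d x) x := by
  have hM := matchingGen_pos (G := G) (treeActivity_nonneg hd hx0 hx)
  have h1 := ((hasDerivAt_matchingGen (G := G) (treeActivity d x)).comp x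
    (hasDerivAt_treeActivity hd hx)).log hM.ne'
  refine ((h1.div_const _).sub (hasDerivAt_treePressure hd hx)).congr_deriv ?_
  rw [pressureGapDeriv, pressureDeriv, Function.comp_apply]
  ring

lemma continuousOn_pressureGapDeriv [Nonempty V] (hd : 1 ≤ d) :
    ContinuousOn (pressureGapDeriv G d) (Set.Ico 0 1) := by
  have hsub : Set.Ico 0 1 ⊆ Set.Iio (1 : ℝ) := fun x hx => hx.2
  have hTc := (continuousOn_treeActivity hd).mono hsub
  unfold pressureGapDeriv pressureDeriv
  refine ContinuousOn.sub (ContinuousOn.mul ?_ ((continuousOn_treeActivityDeriv hd).mono hsub))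
    ((continuousOn_treePressureDeriv hd).mono hsub)
  refine ContinuousOn.div_const (ContinuousOn.div ?_ ?_ ?_) _
  · have : Continuous fun t : ℝ =>
        ∑ N ∈ avoidingMatchings G ∅, (N.card : ℝ) * t ^ (N.card - 1) := by fun_prop
    exact this.comp_continuousOn hTc
  · exact continuous_matchingGen.comp_continuousOn hTc
  · intro x hx
    exact (matchingGen_pos (treeActivity_nonneg hd hx.1 hx.2)).ne'

lemma integral_pressureGapDeriv [Nonempty V] (hd : 1 ≤ d) {p : ℝ} (hp0 : 0 ≤ p) (hp : p < 1) :
    ∫ x in (0 : ℝ)..p, pressureGapDeriv G d x =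
      Real.log (matchingGen G (treeActivity d p)) / (Nat.card V : ℝ) - treePressure d p := by
  have hsub : Set.uIcc 0 p ⊆ Set.Ico (0 : ℝ) 1 := by
    rw [Set.uIcc_of_le hp0]
    exact fun x hx => ⟨hx.1, hx.2.trans_lt hp⟩
  rw [intervalIntegral.integral_eq_sub_of_hasDerivAt
    (fun x hx => hasDerivAt_pressureGap hd (hsub hx).1 (hsub hx).2)
    ((continuousOn_pressureGapDeriv hd).mono hsub).intervalIntegrable,
    treeActivity_zero, matchingGen_zero, treePressure_zero]
  simp

lemma abs_pressureGapDeriv_le [Nonempty V] (hd : 1 ≤ d) {D : ℕ}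
    (hD : ∀ x : V, (G.neighborSet x).ncard ≤ D) (hx0 : 0 < x) (hx : x < 1) :
    |pressureGapDeriv G d x| ≤ D / 2 * |treeActivityDeriv d x| + |treePressureDeriv d x| := by
  have ht := treeActivity_pos hd hx0 hx
  have h1 : |pressureDeriv G (treeActivity d x)| ≤ D / 2 := by
    rw [pressureDeriv_eq ht, abs_of_nonneg (div_nonneg (densityFn_nonneg ht.le) (by positivity)),
      div_le_iff₀ (by positivity)]
    have := densityFn_le_degree hD ht.le
    linarith
  refine (abs_sub _ _).trans ?_
  rw [abs_mul]
  gcongr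

end PressureGap

lemma tendsto_pressureGapDeriv {V : ℕ → Type u} {G : ∀ i, SimpleGraph (V i)}
    [∀ i, Fintype (V i)] [∀ i, Nonempty (V i)]
    (hd : 1 ≤ d) (h : BSConvergesTo G (regularTree d) (treeRoot d)) (hx0 : 0 < x) (hx : x < 1) :
    Tendsto (fun i => pressureGapDeriv (G i) d x) atTop (𝓝 0) := by
  have ht := treeActivity_pos hd hx0 hx
  have h1 := tendsto_densityFn_treeActivity hd h hx0.le hx
  have h2 := ((h1.div_const (2 * treeActivity d x)).mul_const
    (treeActivityDeriv d x)).sub_const (treePressureDeriv d x)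
  rw [mul_treeActivityDeriv hd hx0 hx, sub_self] at h2
  refine h2.congr fun i => ?_
  rw [pressureGapDeriv, pressureDeriv_eq ht]

/-- Both pressures vanish at density `0`. The derivative of their difference tends to `0` pointwise
and is dominated through the degree bound, so its integral tends to `0`. -/
lemma tendsto_log_matchingGen {V : ℕ → Type u} {G : ∀ i, SimpleGraph (V i)}
    [∀ i, Fintype (V i)] [∀ i, Nonempty (V i)]
    (hd : 1 ≤ d) (h : BSConvergesTo G (regularTree d) (treeRoot d)) {p : ℝ} (hp0 : 0 ≤ p)
    (hp : p < 1) :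
    Tendsto (fun i => Real.log (matchingGen (G i) (treeActivity d p)) / (Nat.card (V i) : ℝ))
      atTop (𝓝 (treePressure d p)) := by
  obtain ⟨D, hD⟩ := h.2.1
  have hsub : Set.uIcc 0 p ⊆ Set.Ico (0 : ℝ) 1 := by
    rw [Set.uIcc_of_le hp0]
    exact fun x hx => ⟨hx.1, hx.2.trans_lt hp⟩
  have hsub' : Set.uIcc 0 p ⊆ Set.Iio (1 : ℝ) := fun x hx => (hsub hx).2
  have hlim : Tendsto (fun i => ∫ x in (0 : ℝ)..p, pressureGapDeriv (G i) d x) atTop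
      (𝓝 (∫ x in (0 : ℝ)..p, (0 : ℝ))) := by
    refine intervalIntegral.tendsto_integral_filter_of_dominated_convergence
      (fun x => D / 2 * |treeActivityDeriv d x| + |treePressureDeriv d x|) ?_ ?_ ?_ ?_
    · refine Eventually.of_forall fun i => ?_
      exact ((continuousOn_pressureGapDeriv hd).mono
        (Set.uIoc_subset_uIcc.trans hsub)).aestronglyMeasurable measurableSet_uIoc
    · refine Eventually.of_forall fun i => Eventually.of_forall fun x hx => ?_
      rw [Set.uIoc_of_le hp0] at hx
      exact abs_pressureGapDeriv_le hd (hD i) hx.1 (hx.2.trans_lt hp)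
    · refine ContinuousOn.intervalIntegrable ?_
      exact (((continuousOn_treeActivityDeriv hd).mono hsub').abs.const_smul ((D : ℝ) / 2)).add
        ((continuousOn_treePressureDeriv hd).mono hsub').abs
    · refine Eventually.of_forall fun x hx => ?_
      rw [Set.uIoc_of_le hp0] at hx
      exact tendsto_pressureGapDeriv hd h hx.1 (hx.2.trans_lt hp)
  rw [intervalIntegral.integral_zero] at hlim
  have := (hlim.congr fun i => integral_pressureGapDeriv hd hp0 hp).add_const (treePressure d p)
  simpa using this

/-- The entropies of graphs that converge to the `d`-regular tree converge to `𝔾_d`. -/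
theorem tendsto_graphEntropy_of_BS {V : ℕ → Type u} {G : ∀ i, SimpleGraph (V i)}
    (hd : 1 ≤ d) (h : BSConvergesTo G (regularTree d) (treeRoot d))
    (hmax : ∀ i, 1 ≤ maxDensity (G i)) {p : ℝ} (hp0 : 0 ≤ p) (hp : p < 1) :
    Tendsto (fun i => graphEntropy (G i) p) atTop (𝓝 (gurvitsFn d p)) := by
  have hfin : ∀ i, Finite (V i) := fun i => (h.1 i).1
  have hne : ∀ i, Nonempty (V i) := fun i => (h.1 i).2
  let _ : ∀ i, Fintype (V i) := fun i => Fintype.ofFinite _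
  have hglb : ∀ i, IsGLB (entropyObjective (G i) p '' Set.Ioi 0) (graphEntropy (G i) p) :=
    fun i => isGLB_graphEntropy hp0 (hp.le.trans (hmax i))
  rcases hp0.eq_or_lt with rfl | hp0
  · have h0 : ∀ i, graphEntropy (G i) 0 = 0 := by
      intro i
      have h1 := isGLB_objective_of_density (G := G i) le_rfl densityFn_zero
      rw [(hglb i).unique h1]
      simp [freeEntropy, matchingGen_zero]
    simp [h0, gurvitsFn_zero]
  -- Two auxiliary densities around `p`: eventually `p(G_i, ·)` is below `p` at `t₁` and above `p`
  -- at `t₂`, which confines the minimisation of the objective to a fixed compact range of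
  -- activities.
  set p₁ := p / 2 with hp₁
  set p₂ := (p + 1) / 2 with hp₂
  have hp₁0 : 0 < p₁ := by positivity
  have hp₁1 : p₁ < 1 := by rw [hp₁]; linarith
  have hp₂0 : 0 < p₂ := by positivity
  have hp₂1 : p₂ < 1 := by rw [hp₂]; linarith
  set t := treeActivity d p with ht
  set t₁ := treeActivity d p₁ with ht₁
  set t₂ := treeActivity d p₂ with ht₂
  have ht0 : 0 < t := treeActivity_pos hd hp0 hp
  have ht₁0 : 0 < t₁ := treeActivity_pos hd hp₁0 hp₁1
  have ht₂0 : 0 < t₂ := treeActivity_pos hd hp₂0 hp₂1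
  have hδ := tendsto_densityFn_treeActivity hd h hp0.le hp
  have hδ₁ := (tendsto_densityFn_treeActivity hd h hp₁0.le hp₁1).eventually
    (gt_mem_nhds (show p₁ < p by rw [hp₁]; linarith))
  have hδ₂ := (tendsto_densityFn_treeActivity hd h hp₂0.le hp₂1).eventually
    (lt_mem_nhds (show p < p₂ by rw [hp₂]; linarith))
  set K := |Real.log t₁ - Real.log t| + |Real.log t₂ - Real.log t| with hK
  have hobj : Tendsto (fun i => entropyObjective (G i) p t) atTop (𝓝 (gurvitsFn d p)) := by
    rw [← objective_tree_eq_gurvits hd hp0 hp]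
    exact (tendsto_log_matchingGen hd h hp0.le hp).sub_const _
  have hlow : Tendsto (fun i => entropyObjective (G i) p t - |densityFn (G i) t - p| / 2 * K)
      atTop (𝓝 (gurvitsFn d p)) := by
    have h1 : Tendsto (fun i => |densityFn (G i) t - p| / 2 * K) atTop (𝓝 0) := by
      have := (((hδ.sub_const p).abs).div_const 2).mul_const K
      simpa using this
    simpa using hobj.sub h1
  refine tendsto_of_tendsto_of_tendsto_of_le_of_le' hlow hobj ?_ ?_
  · filter_upwards [hδ₁, hδ₂] with i h1 h2
    refine (hglb i).2 ?_
    rintro _ ⟨s, hs, rfl⟩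
    have hs0 : 0 < s := hs
    have hmid : ∀ s', 0 < s' → |Real.log s' - Real.log t| ≤ K →
        entropyObjective (G i) p t - |densityFn (G i) t - p| / 2 * K ≤
          entropyObjective (G i) p s' := by
      intro s' hs' hsK
      have h3 := entropyObjective_ge (G := G i) hs' ht0 p
      have h4 : |(densityFn (G i) t - p) / 2 * (Real.log s' - Real.log t)| ≤
          |densityFn (G i) t - p| / 2 * K := by
        rw [abs_mul, abs_div, abs_two]
        gcongr
      have := (abs_le.1 h4).1
      linarith
    have hK1 : |Real.log t₁ - Real.log t| ≤ K := by
      rw [hK]; linarith [abs_nonneg (Real.log t₂ - Real.log t)]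
    have hK2 : |Real.log t₂ - Real.log t| ≤ K := by
      rw [hK]; linarith [abs_nonneg (Real.log t₁ - Real.log t)]
    -- Beyond `t₂` or before `t₁`, the tangent at that point shows that the objective is no smaller
    -- than there. Between them, the tangent at `t` is almost horizontal and `|log s - log t| ≤ K`.
    rcases le_or_gt (Real.log t₂) (Real.log s) with hs2 | hs2
    · refine (hmid t₂ ht₂0 hK2).trans ?_
      have := entropyObjective_ge (G := G i) hs0 ht₂0 p
      have : 0 ≤ (densityFn (G i) t₂ - p) / 2 * (Real.log s - Real.log t₂) :=
        mul_nonneg (by linarith) (by linarith)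
      linarith
    rcases le_or_gt (Real.log s) (Real.log t₁) with hs1 | hs1
    · refine (hmid t₁ ht₁0 hK1).trans ?_
      have := entropyObjective_ge (G := G i) hs0 ht₁0 p
      have : 0 ≤ (densityFn (G i) t₁ - p) / 2 * (Real.log s - Real.log t₁) :=
        mul_nonneg_of_nonpos_of_nonpos (by linarith) (by linarith)
      linarith
    · refine hmid s hs0 (abs_le.2 ⟨?_, ?_⟩)
      · linarith [(abs_le.1 hK1).1]
      · linarith [(abs_le.1 hK2).2]
  · exact Eventually.of_forall fun i => (hglb i).1 ⟨t, ht0, rfl⟩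

lemma continuousAt_gurvitsFn (hd : 1 ≤ d) : ContinuousAt (gurvitsFn d) 1 := by
  have hd1 : (1 : ℝ) ≤ d := by exact_mod_cast hd
  have hd0 : (d : ℝ) ≠ 0 := by positivity
  have e : gurvitsFn d = fun p : ℝ => 1 / 2 * (p * Real.log (d / p) +
      d * ((1 - p / d) * Real.log (1 - p / d)) - 2 * ((1 - p) * Real.log (1 - p))) := by
    funext p
    -- Written through `y log y`, the function is continuous at `1` even for `d = 1`, where `1 - p /
    -- d` vanishes.
    have h3 : (d : ℝ) - p = d * (1 - p / d) := by field_simp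
    rw [gurvitsFn, h3]
    ring
  rw [e]
  have h1 : ContinuousAt (fun p : ℝ => p * Real.log (d / p)) 1 := by
    refine continuousAt_id.mul (ContinuousAt.log (continuousAt_const.div continuousAt_id ?_) ?_)
    · exact one_ne_zero
    · simpa using hd0
  have h2 : Continuous fun p : ℝ => (1 - p / d) * Real.log (1 - p / d) :=
    Real.continuous_mul_log.comp (by fun_prop)
  have h3 : Continuous fun p : ℝ => (1 - p) * Real.log (1 - p) :=
    Real.continuous_mul_log.comp (by fun_prop)
  exact continuousAt_const.mul
    ((h1.add (h2.continuousAt.const_mul _)).sub (h3.continuousAt.const_mul 2))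

end TreeEntropy

/-! ### Iterated two-lifts without short closed walks -/

section Girth

variable {V : Type u} {G : SimpleGraph V}

/-- `w 0, …, w n` is a closed walk of positive length without backtracking, except possibly at
its base point. -/
structure IsClosedNB (G : SimpleGraph V) (w : ℕ → V) (n : ℕ) : Prop where
  pos : 0 < n
  adj : ∀ i < n, G.Adj (w i) (w (i + 1))
  nb : ∀ i, i + 2 ≤ n → w i ≠ w (i + 2)
  closed : w 0 = w n

/-- There is no closed non-backtracking walk of length at most `R`. -/
def NoShortNB (G : SimpleGraph V) (R : ℕ) : Prop := ∀ n ≤ R, ∀ w, ¬ IsClosedNB G w n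

/-- A backtrack in the projection lifts to a backtrack, because a point of the lift has only one
neighbour over each neighbour of its projection. -/
lemma IsTwoLift.isClosedNB_fst {H : SimpleGraph (V × Fin 2)} (h : IsTwoLift G H)
    {w : ℕ → V × Fin 2} {n : ℕ} (hw : IsClosedNB H w n) : IsClosedNB G (fun i => (w i).1) n where
  pos := hw.pos
  adj i hi := h.adj (i := (w i).2) (j := (w (i + 1)).2) (hw.adj i hi)
  nb i hi heq := by
    refine hw.nb i hi (Prod.ext heq ?_)
    have h1 : H.Adj ((w (i + 1)).1, (w (i + 1)).2) ((w i).1, (w i).2) :=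
      (hw.adj i (by omega)).symm
    have h2 : H.Adj ((w (i + 1)).1, (w (i + 1)).2) ((w i).1, (w (i + 2)).2) := by
      have := hw.adj (i + 1) (by omega)
      have heq' : (w i).1 = (w (i + 2)).1 := heq
      rw [heq']
      exact this
    exact h.adj_unique h1 h2
  closed := congrArg Prod.fst hw.closed

lemma NoShortNB.twoLift {H : SimpleGraph (V × Fin 2)} (h : IsTwoLift G H) {R : ℕ}
    (hR : NoShortNB G R) : NoShortNB H R :=
  fun n hn _ hw => hR n hn _ (h.isClosedNB_fst hw)

open scoped Classical in
/-- The voltage assignment that is nonzero exactly at `e`. -/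
def edgeVoltage (e f : Sym2 V) : Fin 2 := if f = e then 1 else 0

/-- A closed non-backtracking walk that uses every edge an even number of times contains one of
at most half its length. -/
lemma IsClosedNB.exists_half {w : ℕ → V} {n : ℕ} (hw : IsClosedNB G w n)
    (heven : ∀ e : Sym2 V, ∑ i ∈ Finset.range n, edgeVoltage e s(w i, w (i + 1)) = 0) :
    ∃ m w', 2 * m ≤ n ∧ IsClosedNB G w' m := by
  classical
  have hex : ∃ m, 0 < m ∧ ∃ i, i + m ≤ n ∧ w i = w (i + m) :=
    ⟨n, hw.pos, 0, by omega, by rw [Nat.zero_add]; exact hw.closed⟩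
  -- Take a shortest closed stretch of positive length. A repeated edge in it would give either a
  -- shorter closed stretch or a backtrack, so its edges are distinct.
  obtain ⟨hm0, i, him, hwi⟩ := Nat.find_spec hex
  set m := Nat.find hex with hm
  have hmin : ∀ a b, a < b → b ≤ n → b - a < m → w a ≠ w b := by
    intro a b hab hb hlt heq
    refine Nat.find_min hex hlt ⟨by omega, a, by omega, ?_⟩
    rwa [Nat.add_sub_cancel' hab.le]
  refine ⟨m, fun k => w (i + k), ?_, hm0, fun k hk => hw.adj (i + k) (by omega),
    fun k hk => hw.nb (i + k) (by omega), by simpa using hwi⟩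
  set E : ℕ → Sym2 V := fun k => s(w k, w (k + 1)) with hE
  have hinj : Set.InjOn E (Finset.Ico i (i + m) : Finset ℕ) := by
    have key : ∀ a b, i ≤ a → a < b → b < i + m → E a ≠ E b := by
      intro a b ha hab hb heq
      rcases Sym2.eq_iff.1 heq with ⟨h1, -⟩ | ⟨h1, h2⟩
      · exact hmin a b hab (by omega) (by omega) h1
      · rcases (Nat.succ_le_of_lt hab).eq_or_lt with hb' | hb'
        · subst hb'
          exact hw.nb a (by omega) h1
        · exact hmin (a + 1) b hb' (by omega) (by omega) h2
    intro a ha b hb heq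
    rw [Finset.mem_coe, Finset.mem_Ico] at ha hb
    rcases lt_trichotomy a b with h | h | h
    · exact absurd heq (key a b ha.1 h hb.2)
    · exact h
    · exact absurd heq.symm (key b a hb.1 h ha.2)
  -- Each edge of the stretch occurs in the whole walk, and by parity at least twice. Summing over
  -- the `m` distinct edges gives `2 * m ≤ n`.
  have hcount : ∀ e ∈ (Finset.Ico i (i + m)).image E,
      2 ≤ ((Finset.range n).filter fun k => E k = e).card := by
    intro e he
    obtain ⟨k, hk, rfl⟩ := Finset.mem_image.1 he
    rw [Finset.mem_Ico] at hk
    have h1 : 0 < ((Finset.range n).filter fun k' => E k' = E k).card :=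
      Finset.card_pos.2 ⟨k, by rw [Finset.mem_filter, Finset.mem_range]; exact ⟨by omega, rfl⟩⟩
    have h2 : ((Finset.range n).filter fun k' => E k' = E k).card ≠ 1 := by
      intro h
      have h3 := heven (E k)
      simp only [edgeVoltage] at h3
      rw [← Finset.sum_filter, Finset.sum_const] at h3
      change ((Finset.range n).filter fun k' => E k' = E k).card • (1 : Fin 2) = 0 at h3
      rw [h, one_smul] at h3
      exact absurd h3 (by decide)
    omega
  have hle : ∑ e ∈ (Finset.Ico i (i + m)).image E,
      ((Finset.range n).filter fun k => E k = e).card ≤ n := by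
    have h1 := Finset.card_eq_sum_card_fiberwise (f := E)
      (s := (Finset.range n).filter fun k => E k ∈ (Finset.Ico i (i + m)).image E)
      (t := (Finset.Ico i (i + m)).image E) (by
        intro k hk
        exact Finset.mem_coe.2 (Finset.mem_filter.1 (Finset.mem_coe.1 hk)).2)
    have h2 : ((Finset.range n).filter fun k => E k ∈ (Finset.Ico i (i + m)).image E).card ≤ n :=
      (Finset.card_filter_le _ _).trans (by simp)
    refine le_trans (le_of_eq ?_) (h1.symm.trans_le h2)
    refine Finset.sum_congr rfl fun e he => ?_
    congr 1
    ext k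
    simp only [Finset.mem_filter]
    constructor
    · rintro ⟨hk, rfl⟩; exact ⟨⟨hk, he⟩, rfl⟩
    · rintro ⟨⟨hk, -⟩, rfl⟩; exact ⟨hk, rfl⟩
  have h3 := Finset.card_nsmul_le_sum _ _ _ hcount
  rw [Finset.card_image_of_injOn hinj, Nat.card_Ico, smul_eq_mul] at h3
  omega

/-- The `2`-lift in which the edges of voltage `1` are crossed. -/
def twistedLift (G : SimpleGraph V) (s : Sym2 V → Fin 2) : SimpleGraph (V × Fin 2) where
  Adj p q := G.Adj p.1 q.1 ∧ q.2 = p.2 + s s(p.1, q.1)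
  symm := ⟨fun p q ⟨h1, h2⟩ => ⟨h1.symm, by
    have h3 : ∀ a : Fin 2, a + a = 0 := by decide
    rw [h2, Sym2.eq_swap, add_assoc, h3, add_zero]⟩⟩
  loopless := ⟨fun p h => G.irrefl h.1⟩

lemma isTwoLift_twistedLift (G : SimpleGraph V) (s : Sym2 V → Fin 2) :
    IsTwoLift G (twistedLift G s) := by
  intro x y
  refine ⟨fun h => ?_, fun h i j hij => h hij.1⟩
  simp only [twistedLift, h, true_and]
  generalize s s(x, y) = a
  revert a
  decide

/-- The sheet coordinate accumulates the voltages along the walk and must return to its initial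
value. -/
lemma IsClosedNB.sum_voltage {s : Sym2 V → Fin 2} {w : ℕ → V × Fin 2} {n : ℕ}
    (hw : IsClosedNB (twistedLift G s) w n) :
    ∑ i ∈ Finset.range n, s s((w i).1, (w (i + 1)).1) = 0 := by
  have key : ∀ k ≤ n, (w k).2 = (w 0).2 + ∑ i ∈ Finset.range k, s s((w i).1, (w (i + 1)).1) := by
    intro k
    induction k with
    | zero => simp
    | succ k ih =>
      intro hk
      rw [(hw.adj k (by omega)).2, ih (by omega), Finset.sum_range_succ, add_assoc]
  have h1 := key n le_rfl
  rw [← hw.closed] at h1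
  exact (left_eq_add.1 h1)

/-- No closed non-backtracking walk of length at most `R` has zero total voltage for all voltage
assignments in `L`. -/
def NoShortBalanced (S : SimpleGraph V × List (Sym2 V → Fin 2)) (R : ℕ) : Prop :=
  ∀ n ≤ R, ∀ w, IsClosedNB S.1 w n →
    ¬ ∀ s ∈ S.2, ∑ i ∈ Finset.range n, s s(w i, w (i + 1)) = 0

open scoped Classical in
/-- The voltage assignments of all single edges. -/
def allEdgeVoltages (V : Type u) : List (Sym2 V → Fin 2) :=
  if _ : Finite (Sym2 V) then (Set.finite_univ (α := Sym2 V)).toFinset.toList.map edgeVoltage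
  else []

lemma edgeVoltage_mem [Finite V] (e : Sym2 V) : edgeVoltage e ∈ allEdgeVoltages V := by
  have : Finite (Sym2 V) := inferInstance
  rw [allEdgeVoltages, dif_pos this, List.mem_map]
  exact ⟨e, by simp, rfl⟩

/-- Zero voltage for every single edge means even use of every edge. Halving a length of at most `2R
+ 1` gives at most `R`, which is excluded. -/
lemma noShortBalanced_all [Finite V] {R : ℕ} (h : NoShortNB G R) :
    NoShortBalanced (G, allEdgeVoltages V) (2 * R + 1) := by
  intro n hn w hw hbal
  obtain ⟨m, w', hm, hw'⟩ := hw.exists_half fun e => hbal _ (edgeVoltage_mem e)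
  exact h m (by omega) w' hw'

/-- One step of the construction: lift along the first voltage assignment of the queue, and refill
an empty queue with all edges. -/
def liftStep (S : SimpleGraph V × List (Sym2 V → Fin 2)) :
    SimpleGraph (V × Fin 2) × List (Sym2 (V × Fin 2) → Fin 2) :=
  match S.2 with
  | [] => (twistedLift S.1 0, allEdgeVoltages (V × Fin 2))
  | s :: L => (twistedLift S.1 s, L.map fun s' => s' ∘ liftProj)

lemma isTwoLift_liftStep (S : SimpleGraph V × List (Sym2 V → Fin 2)) :
    IsTwoLift S.1 (liftStep S).1 := by
  obtain ⟨G, _ | ⟨s, L⟩⟩ := S <;> exact isTwoLift_twistedLift _ _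

/-- A closed walk in the lift along `s` projects to a walk balanced for `s`, so `s` may leave the
queue. The remaining voltages are pulled back and have the same sums. -/
lemma NoShortBalanced.liftStep {s : Sym2 V → Fin 2} {L : List (Sym2 V → Fin 2)} {R : ℕ}
    (h : NoShortBalanced (G, s :: L) R) : NoShortBalanced (liftStep (G, s :: L)) R := by
  intro n hn w hw hbal
  refine h n hn _ ((isTwoLift_twistedLift G s).isClosedNB_fst hw) ?_
  intro s' hs'
  rcases List.mem_cons.1 hs' with rfl | hs'
  · exact hw.sum_voltage
  · exact hbal (s' ∘ liftProj) (List.mem_map.2 ⟨s', hs', rfl⟩)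

instance liftVertex_finite [Finite V] : ∀ i, Finite (LiftVertex V i)
  | 0 => ‹Finite V›
  | i + 1 =>
    have := liftVertex_finite i
    inferInstanceAs (Finite (LiftVertex V i × Fin 2))

instance liftVertex_nonempty [Nonempty V] : ∀ i, Nonempty (LiftVertex V i)
  | 0 => ‹Nonempty V›
  | i + 1 =>
    have := liftVertex_nonempty i
    inferInstanceAs (Nonempty (LiftVertex V i × Fin 2))

/-- The iterated construction. -/
def liftState (G : SimpleGraph V) :
    ∀ i, SimpleGraph (LiftVertex V i) × List (Sym2 (LiftVertex V i) → Fin 2)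
  | 0 => (G, [])
  | i + 1 => liftStep (liftState G i)

lemma isTwoLiftSequence_liftState (G : SimpleGraph V) :
    IsTwoLiftSequence G fun i => (liftState G i).1 :=
  ⟨rfl, fun i => isTwoLift_liftStep (liftState G i)⟩

lemma exists_empty_queue (G : SimpleGraph V) {R : ℕ} (ℓ : ℕ) :
    ∀ i, (liftState G i).2.length = ℓ → NoShortBalanced (liftState G i) R →
      ∃ j, (liftState G j).2 = [] ∧ NoShortBalanced (liftState G j) R := by
  induction ℓ with
  | zero => exact fun i hi h => ⟨i, List.length_eq_zero_iff.1 hi, h⟩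
  | succ ℓ ih =>
    intro i hi h
    have hstep : liftState G (i + 1) = liftStep (liftState G i) := rfl
    refine ih (i + 1) ?_ ?_
    · rw [hstep]
      revert hi
      generalize liftState G i = S
      obtain ⟨G', _ | ⟨s, L⟩⟩ := S
      · intro hi; simp at hi
      · intro hi
        exact (List.length_map _).trans (Nat.succ.inj hi)
    · rw [hstep]
      revert hi h
      generalize liftState G i = S
      obtain ⟨G', _ | ⟨s, L⟩⟩ := S
      · intro hi; simp at hi
      · intro _ h
        exact h.liftStep

/-- One round takes `R` to `2R + 1`: an empty queue is refilled with all single-edge voltages after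
a trivial lift. Once the queue is empty again, the balance condition is vacuous and every closed
walk within the bound is excluded. -/
lemma exists_noShortNB_liftState [Finite V] (G : SimpleGraph V) (k : ℕ) :
    ∃ i, (liftState G i).2 = [] ∧ ∃ R, k ≤ R ∧ NoShortNB (liftState G i).1 R := by
  induction k with
  | zero =>
    exact ⟨0, rfl, 0, le_rfl, fun n hn w hw => absurd hw.pos (by omega)⟩
  | succ k ih =>
    obtain ⟨i, hi, R, hkR, hR⟩ := ih
    have hstep : liftState G (i + 1) =
        (twistedLift (liftState G i).1 0, allEdgeVoltages (LiftVertex V i × Fin 2)) := by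
      change liftStep (liftState G i) = _
      rw [liftStep, hi]
    have hbal : NoShortBalanced (liftState G (i + 1)) (2 * R + 1) := by
      rw [hstep]
      exact noShortBalanced_all (hR.twoLift (isTwoLift_twistedLift _ _))
    obtain ⟨j, hj, hbal'⟩ := exists_empty_queue G _ (i + 1) rfl hbal
    refine ⟨j, hj, 2 * R + 1, by omega, fun n hn w hw => hbal' n hn w hw ?_⟩
    rw [hj]
    simp

lemma eventually_noShortNB_liftState [Finite V] (G : SimpleGraph V) (k : ℕ) :
    ∃ i, ∀ j ≥ i, NoShortNB (liftState G j).1 k := by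
  obtain ⟨i, -, R, hkR, hR⟩ := exists_noShortNB_liftState G k
  refine ⟨i, fun j hj => ?_⟩
  induction j, hj using Nat.le_induction with
  | base => exact fun n hn => hR n (hn.trans hkR)
  | succ j _ ih => exact ih.twoLift (isTwoLift_liftStep _)

end Girth

/-! ### Properties inherited by two-lifts -/

section Regular

variable {V : Type u} {G : SimpleGraph V} {H : SimpleGraph (V × Fin 2)}

lemma IsTwoLift.ncard_neighborSet (h : IsTwoLift G H) (p : V × Fin 2) :
    (H.neighborSet p).ncard = (G.neighborSet p.1).ncard := by
  have himage : Prod.fst '' H.neighborSet p = G.neighborSet p.1 := by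
    ext y
    constructor
    · rintro ⟨q, hq, rfl⟩
      exact h.adj (i := p.2) (j := q.2) hq
    · intro hy
      obtain ⟨j, hj⟩ := h.exists_adj hy p.2
      exact ⟨(y, j), hj, rfl⟩
  rw [← himage, Set.InjOn.ncard_image]
  rintro ⟨y, j⟩ hj ⟨z, k⟩ hk rfl
  exact Prod.ext rfl (h.adj_unique (i := p.2) hj hk)

lemma IsTwoLift.isBipartite (h : IsTwoLift G H) (hG : G.IsBipartite) : H.IsBipartite := by
  obtain ⟨χ⟩ := hG
  exact ⟨SimpleGraph.Coloring.mk (fun p => χ p.1) fun {p q} hpq =>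
    χ.valid (h.adj (i := p.2) (j := q.2) hpq)⟩

end Regular

/-! ### Tree balls in regular graphs without short closed walks -/

section UniversalCover

variable {V : Type u} {G : SimpleGraph V} {d : ℕ}

/-- A bijective labelling of the neighbours of `x`. -/
def IsNeighborLabel (G : SimpleGraph V) (x : V) (f : Fin d → V) : Prop :=
  Function.Injective f ∧ ∀ y, G.Adj x y ↔ ∃ k, f k = y

lemma exists_neighborLabel [Finite V] {x : V} (hx : (G.neighborSet x).ncard = d) :
    ∃ f : Fin d → V, IsNeighborLabel G x f := by
  have e : G.neighborSet x ≃ Fin d := Finite.equivFinOfCardEq hx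
  refine ⟨fun k => e.symm k, fun a b hab => e.symm.injective (Subtype.ext hab), fun y => ?_⟩
  constructor
  · exact fun hy => ⟨e ⟨y, hy⟩, by simp⟩
  · rintro ⟨k, rfl⟩
    exact (e.symm k).2

lemma exists_neighborLabel_of_adj [Finite V] {x u : V} (hx : (G.neighborSet x).ncard = d)
    (c : Fin d) (hu : G.Adj x u) : ∃ f : Fin d → V, IsNeighborLabel G x f ∧ f c = u := by
  obtain ⟨f, hf, hf'⟩ := exists_neighborLabel hx
  obtain ⟨k, rfl⟩ := (hf' u).1 hu
  refine ⟨f ∘ Equiv.swap c k, ⟨hf.comp (Equiv.injective _), fun y => ?_⟩, by simp⟩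
  rw [hf' y]
  constructor
  · rintro ⟨j, rfl⟩; exact ⟨Equiv.swap c k j, by simp⟩
  · rintro ⟨j, rfl⟩; exact ⟨_, rfl⟩

/-- The covering map from words to the vertices of a `d`-regular graph. -/
def coverMap (x : V) (f₀ : Fin d → V) (F : V → Fin d → V → Fin d → V) : List (Fin d) → V
  | [] => x
  | [c] => f₀ c
  | c :: a :: l => F (coverMap x f₀ F (a :: l)) a (coverMap x f₀ F l) c

variable {x : V} {f₀ : Fin d → V} {F : V → Fin d → V → Fin d → V}

/-- On arriving at a vertex along the letter `a`, the labelling of its neighbours is chosen so that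
`a` leads back. Hence repeating a letter is the same as backtracking, and words without repeated
consecutive letters become non-backtracking walks. -/
lemma coverMap_label (h₀ : IsNeighborLabel G x f₀)
    (hF : ∀ y c u, G.Adj y u → IsNeighborLabel G y (F y c u) ∧ F y c u c = u)
    (l : List (Fin d)) :
    (∀ c, G.Adj (coverMap x f₀ F l) (coverMap x f₀ F (c :: l))) ∧
    (∀ c c', coverMap x f₀ F (c :: l) = coverMap x f₀ F (c' :: l) → c = c') ∧
    (∀ y, G.Adj (coverMap x f₀ F l) y → ∃ c, coverMap x f₀ F (c :: l) = y) ∧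
    ∀ a l', l = a :: l' → coverMap x f₀ F (a :: l) = coverMap x f₀ F l' := by
  induction l with
  | nil =>
    refine ⟨fun c => (h₀.2 _).2 ⟨c, rfl⟩, fun c c' h => h₀.1 h, fun y hy => (h₀.2 y).1 hy, ?_⟩
    intro a l' h
    exact absurd h (List.cons_ne_nil _ _).symm
  | cons a l ih =>
    obtain ⟨hlab, hval⟩ := hF (coverMap x f₀ F (a :: l)) a (coverMap x f₀ F l) (ih.1 a).symm
    refine ⟨fun c => (hlab.2 _).2 ⟨c, rfl⟩, fun c c' h => hlab.1 h, fun y hy => (hlab.2 y).1 hy, ?_⟩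
    intro b l' h
    obtain ⟨rfl, rfl⟩ := List.cons_eq_cons.1 h
    exact hval

/-- Join two words with equal image by the path through their longest common suffix. It is reduced,
so its image is a closed non-backtracking walk of length at most `2R`. -/
lemma coverMap_injective (h₀ : IsNeighborLabel G x f₀)
    (hF : ∀ y c u, G.Adj y u → IsNeighborLabel G y (F y c u) ∧ F y c u c = u) {R : ℕ}
    (hR : NoShortNB G (2 * R)) {l l' : List (Fin d)} (hl : l.IsChain (· ≠ ·))
    (hl' : l'.IsChain (· ≠ ·)) (hlR : l.length ≤ R) (hlR' : l'.length ≤ R)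
    (heq : coverMap x f₀ F l = coverMap x f₀ F l') : l = l' := by
  classical
  by_contra hne
  have hex : ∃ A, A ≤ l.length ∧ ∃ B, B ≤ l'.length ∧ l.drop A = l'.drop B :=
    ⟨l.length, le_rfl, l'.length, le_rfl, by simp⟩
  obtain ⟨hA, B, hB, hAB⟩ := Nat.find_spec hex
  set A := Nat.find hex with hAdef
  have hmin : ∀ A' < A, ∀ B' ≤ l'.length, l.drop A' ≠ l'.drop B' := fun A' hA' B' hB' h =>
    Nat.find_min hex hA' ⟨by omega, B', hB', h⟩
  -- The path strips `A` letters from `l` down to the common suffix, then rebuilds `l'` in `B`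
  -- further steps.
  set z : ℕ → List (Fin d) := fun i => if i ≤ A then l.drop i else l'.drop (A + B - i) with hz
  have hz1 : ∀ i, i ≤ A → z i = l.drop i := fun i hi => if_pos hi
  have hz2 : ∀ i, A ≤ i → z i = l'.drop (A + B - i) := by
    intro i hi
    rcases hi.eq_or_lt with rfl | hlt
    · rw [hz1 _ le_rfl, hAB]; congr 1; omega
    · exact if_neg (by omega)
  have hchain : ∀ i, (z i).IsChain (· ≠ ·) := by
    intro i
    rcases le_total i A with hi | hi
    · rw [hz1 i hi]; exact hl.drop i
    · rw [hz2 i hi]; exact hl'.drop _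
  have hdown : ∀ i < A, ∃ c, z i = c :: z (i + 1) := by
    intro i hi
    rw [hz1 i hi.le, hz1 (i + 1) hi]
    exact ⟨_, List.drop_eq_getElem_cons (by omega)⟩
  have hup : ∀ i, A ≤ i → i < A + B → ∃ c, z (i + 1) = c :: z i := by
    intro i hi hi'
    rw [hz2 i hi, hz2 (i + 1) (by omega)]
    refine ⟨l'[A + B - (i + 1)]'(by omega), ?_⟩
    have := List.drop_eq_getElem_cons (l := l') (i := A + B - (i + 1)) (by omega)
    rw [this]
    congr 2
    omega
  have hparent : ∀ c a m, (c :: a :: m).IsChain (· ≠ ·) →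
      coverMap x f₀ F (c :: a :: m) ≠ coverMap x f₀ F m := by
    intro c a m hc h
    obtain ⟨-, h2, -, h4⟩ := coverMap_label h₀ hF (a :: m)
    rw [← h4 a m rfl] at h
    exact (List.isChain_cons_cons.1 hc).1 (h2 _ _ h)
  refine hR (A + B) (by omega) (fun i => coverMap x f₀ F (z i)) ⟨?_, ?_, ?_, ?_⟩
  · by_contra h0
    have hA0 : A = 0 := by omega
    have hB0 : B = 0 := by omega
    rw [hA0, hB0] at hAB
    exact hne (by simpa using hAB)
  · intro i hi
    rcases lt_or_ge i A with h | h
    · obtain ⟨c, hc⟩ := hdown i h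
      simp only [hc]
      exact ((coverMap_label h₀ hF _).1 c).symm
    · obtain ⟨c, hc⟩ := hup i h hi
      simp only [hc]
      exact (coverMap_label h₀ hF _).1 c
  · intro i hi
    rcases le_or_gt (i + 2) A with h | h
    · obtain ⟨c, hc⟩ := hdown i (by omega)
      obtain ⟨a, ha⟩ := hdown (i + 1) (by omega)
      have h1 := hchain i
      rw [ha] at hc
      rw [hc] at h1
      simp only [hc]
      exact hparent c a _ h1
    rcases le_or_gt A i with h' | h'
    · obtain ⟨c, hc⟩ := hup i h' (by omega)
      obtain ⟨a, ha⟩ := hup (i + 1) (by omega) (by omega)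
      have h1 := hchain (i + 1 + 1)
      rw [hc] at ha
      rw [ha] at h1
      change coverMap x f₀ F (z i) ≠ coverMap x f₀ F (z (i + 1 + 1))
      rw [ha]
      exact (hparent a c _ h1).symm
    -- This is the turning point `i + 1 = A`. Equal letters on both sides would make `l.drop i` a
    -- suffix of `l'`, against the minimality of `A`.
    · obtain ⟨c, hc⟩ := hdown i h'
      obtain ⟨a, ha⟩ := hup (i + 1) (by omega) (by omega)
      change coverMap x f₀ F (z i) ≠ coverMap x f₀ F (z (i + 1 + 1))
      rw [ha, hc]
      intro h1
      have h2 := (coverMap_label h₀ hF _).2.1 _ _ h1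
      refine hmin i h' (A + B - (i + 1 + 1)) (by omega) ?_
      rw [← hz1 i h'.le, ← hz2 (i + 1 + 1) (by omega), hc, ha, h2]
  · rw [hz1 0 (Nat.zero_le _), hz2 (A + B) (by omega), Nat.sub_self, List.drop_zero,
      List.drop_zero]
    exact heq

/-- Injectivity is needed one level beyond `r`: an edge of `G` between images of two words lifts to
a tree edge from the first word, whose other end may have length `r + 1`. -/
lemma exists_isTreeBall_of_noShortNB [Finite V] (hreg : ∀ y : V, (G.neighborSet y).ncard = d)
    {r : ℕ} (hG : NoShortNB G (2 * (r + 1))) (x : V) :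
    ∃ ψ : TreeVertex d → V, IsTreeBall G x r ψ := by
  obtain ⟨f₀, h₀⟩ := exists_neighborLabel (hreg x)
  have hex : ∀ y c u, ∃ f : Fin d → V, G.Adj y u → IsNeighborLabel G y f ∧ f c = u := by
    intro y c u
    by_cases h : G.Adj y u
    · obtain ⟨f, hf⟩ := exists_neighborLabel_of_adj (hreg y) c h
      exact ⟨f, fun _ => hf⟩
    · exact ⟨fun _ => x, fun h' => absurd h' h⟩
  choose F hF using hex
  set cov := coverMap x f₀ F with hcov
  have hlab := coverMap_label h₀ hF
  have hinj : ∀ w w' : TreeVertex d, w.1.length ≤ r + 1 → w'.1.length ≤ r + 1 →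
      cov w.1 = cov w'.1 → w = w' := fun w w' hw hw' h =>
    Subtype.ext (coverMap_injective h₀ hF hG w.2 w'.2 hw hw' h)
  have hadj : ∀ w w' : TreeVertex d, (regularTree d).Adj w w' → G.Adj (cov w.1) (cov w'.1) := by
    rintro w w' (⟨c, hc⟩ | ⟨c, hc⟩)
    · rw [hc]; exact (hlab _).1 c
    · rw [hc]; exact ((hlab _).1 c).symm
  have hlift : ∀ (w : TreeVertex d) (y : V), G.Adj (cov w.1) y →
      ∃ w' : TreeVertex d, (regularTree d).Adj w w' ∧ cov w'.1 = y := by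
    rintro ⟨l, hl⟩ y hy
    obtain ⟨c, hc⟩ := (hlab l).2.2.1 y hy
    by_cases hcl : (c :: l).IsChain (· ≠ ·)
    · exact ⟨⟨c :: l, hcl⟩, Or.inl ⟨c, rfl⟩, hc⟩
    · cases l with
      | nil => exact absurd (List.isChain_singleton c) hcl
      | cons a l =>
        have hca : c = a := by
          by_contra hne
          exact hcl (List.isChain_cons_cons.2 ⟨hne, hl⟩)
        have hl' : l.IsChain (· ≠ ·) := hl.tail
        refine ⟨⟨l, hl'⟩, Or.inr ⟨a, rfl⟩, ?_⟩
        rw [← hc, hca]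
        exact ((hlab (a :: l)).2.2.2 a l rfl).symm
  have hball : ∀ (l : List (Fin d)), cov l ∈ graphBall G x l.length := by
    intro l
    induction l with
    | nil => exact self_mem_graphBall _ _
    | cons c l ih => exact graphBall_succ_of_adj ih ((hlab l).1 c)
  have hwalk : ∀ (u y : V) (p : G.Walk u y) (w : TreeVertex d), cov w.1 = u →
      ∃ w' : TreeVertex d, w'.1.length ≤ w.1.length + p.length ∧ cov w'.1 = y := by
    intro u y p
    induction p with
    | nil => exact fun w hw => ⟨w, by simp, hw⟩
    | cons h p ih =>
      intro w hw
      obtain ⟨w', hw', hw''⟩ := hlift w _ (hw.symm ▸ h)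
      obtain ⟨w₂, h₂, h₂'⟩ := ih w' hw''
      have := regularTree_adj_length hw'
      exact ⟨w₂, by rw [SimpleGraph.Walk.length_cons]; omega, h₂'⟩
  refine ⟨fun w => cov w.1, rfl, ?_, ?_, ?_, ?_⟩
  · exact fun w w' hw hw' h => hinj w w' (by omega) (by omega) h
  · intro w w' hw hw'
    refine ⟨fun h => ?_, hadj w w'⟩
    obtain ⟨w₂, h₂, h₂'⟩ := hlift w _ h
    have := regularTree_adj_length h₂
    rwa [← hinj w₂ w' (by omega) (by omega) h₂']
  · intro w hw
    obtain ⟨p, hp⟩ := mem_graphBall_iff.1 (hball w.1)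
    exact mem_graphBall_iff.2 ⟨p, hp.trans hw⟩
  · intro y hy
    obtain ⟨p, hp⟩ := mem_graphBall_iff.1 hy
    obtain ⟨w, hw, hw'⟩ := hwalk x y p (treeRoot d) rfl
    have h0 : (treeRoot d).1.length = 0 := rfl
    exact ⟨w, by omega, hw'⟩

lemma neighborSet_ncard_twoLiftSequence {Gs : ∀ i, SimpleGraph (LiftVertex V i)}
    (h : IsTwoLiftSequence G Gs) (hreg : ∀ y : V, (G.neighborSet y).ncard = d) (i : ℕ) :
    ∀ y, ((Gs i).neighborSet y).ncard = d := by
  induction i with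
  | zero =>
    rw [h.1]; exact hreg
  | succ i ih =>
    intro y
    exact ((h.2 i).ncard_neighborSet y).trans (ih _)

lemma isBipartite_twoLiftSequence {Gs : ∀ i, SimpleGraph (LiftVertex V i)}
    (h : IsTwoLiftSequence G Gs) (hG : G.IsBipartite) (i : ℕ) : (Gs i).IsBipartite := by
  induction i with
  | zero =>
    rw [h.1]; exact hG
  | succ i ih => exact (h.2 i).isBipartite ih

/-- Every regular graph starts a sequence of `2`-lifts that converges to the tree. -/
theorem exists_twoLiftSequence_converging [Finite V] [Nonempty V] (G : SimpleGraph V)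
    (hreg : ∀ y : V, (G.neighborSet y).ncard = d) :
    ∃ Gs : ∀ i : ℕ, SimpleGraph (LiftVertex V i),
      IsTwoLiftSequence G Gs ∧ BSConvergesTo Gs (regularTree d) (treeRoot d) := by
  have hseq := isTwoLiftSequence_liftState G
  refine ⟨_, hseq, fun i => ⟨inferInstance, inferInstance⟩,
    ⟨d, fun i y => (neighborSet_ncard_twoLiftSequence hseq hreg i y).le⟩, ?_⟩
  intro r _ m α a
  obtain ⟨i₀, hi₀⟩ := eventually_noShortNB_liftState G (2 * (r + 1))
  refine tendsto_const_nhds.congr' ?_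
  filter_upwards [eventually_ge_atTop i₀] with i hi
  have hiff : ∀ y, BallIso (liftState G i).1 y r α a ↔
      BallIso (regularTree d) (treeRoot d) r α a := by
    intro y
    obtain ⟨ψ, hψ⟩ := exists_isTreeBall_of_noShortNB
      (neighborSet_ncard_twoLiftSequence hseq hreg i) (hi₀ i hi) y
    exact hψ.ballIso_iff α a
  rw [rootedBallProb, ballProb]
  split_ifs with h
  · have : {y | BallIso (liftState G i).1 y r α a} = Set.univ :=
      Set.eq_univ_of_forall fun y => (hiff y).2 h
    rw [this, Set.ncard_univ, div_self]
    exact_mod_cast Nat.card_pos.ne'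
  · have : {y | BallIso (liftState G i).1 y r α a} = ∅ :=
      Set.eq_empty_of_forall_notMem fun y hy => h ((hiff y).1 hy)
    rw [this]
    simp

end UniversalCover

/-! ### Lower bounds for regular bipartite graphs -/

section RegularBipartite

variable {V : Type u} {G : SimpleGraph V} {d : ℕ}

/-- Hall's condition, by counting the edges leaving `s`: there are `d |s|`, and each neighbour
absorbs at most `d`. -/
lemma ncard_le_ncard_neighbors [Finite V] (hd : 1 ≤ d)
    (hreg : ∀ x : V, (G.neighborSet x).ncard = d) (s : Set V) :
    s.ncard ≤ (⋃ x ∈ s, G.neighborSet x).ncard := by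
  classical
  cases nonempty_fintype V
  set t : Set V := ⋃ x ∈ s, G.neighborSet x with ht
  rw [Set.ncard_eq_toFinset_card' s, Set.ncard_eq_toFinset_card' t]
  have key : s.toFinset.card * d ≤ t.toFinset.card * d := by
    refine Finset.card_mul_le_card_mul (fun x y => G.Adj x y) ?_ ?_
    · intro x hx
      rw [← hreg x, ← Set.ncard_coe_finset, Finset.coe_bipartiteAbove]
      refine Set.ncard_le_ncard (fun y hy => ⟨?_, hy⟩) (Set.toFinite _)
      rw [Set.mem_toFinset, ht]
      exact Set.mem_biUnion (Set.mem_toFinset.1 hx) hy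
    · intro y _
      rw [← hreg y, ← Set.ncard_coe_finset, Finset.coe_bipartiteBelow]
      exact Set.ncard_le_ncard (fun x hx => hx.2.symm) (Set.toFinite _)
  exact Nat.le_of_mul_le_mul_right key hd

lemma IsEdgeMatching.of_isPerfectMatching [Fintype V] {M : G.Subgraph}
    (hM : M.IsPerfectMatching) :
    ∃ N : Finset (Sym2 V), IsEdgeMatching G N ∧ coveredSet N = Set.univ := by
  classical
  have huniq := SimpleGraph.Subgraph.isPerfectMatching_iff.1 hM
  refine ⟨M.edgeSet.toFinset, ⟨fun e he => M.edgeSet_subset (Set.mem_toFinset.1 he), ?_⟩, ?_⟩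
  · intro e he f hf hne x hxe hxf
    rw [Set.mem_toFinset] at he hf
    obtain ⟨y, rfl⟩ := hxe
    obtain ⟨z, rfl⟩ := hxf
    have hyz : y = z := (huniq x).unique (SimpleGraph.Subgraph.mem_edgeSet.1 he)
      (SimpleGraph.Subgraph.mem_edgeSet.1 hf)
    exact hne (by rw [hyz])
  · refine Set.eq_univ_of_forall fun x => ?_
    obtain ⟨y, hy, -⟩ := huniq x
    exact ⟨s(x, y), Set.mem_toFinset.2 hy, by simp⟩

lemma two_mul_maxMatchingSize [Fintype V] [Nonempty V] (hd : 1 ≤ d) (hG : G.IsBipartite)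
    (hreg : ∀ x : V, (G.neighborSet x).ncard = d) :
    2 * maxMatchingSize G = Nat.card V := by
  classical
  obtain ⟨s, t, hst⟩ := hG.exists_isBipartiteWith
  obtain ⟨M, hM⟩ := SimpleGraph.exists_isPerfectMatching_of_forall_ncard_le hst
    (ncard_le_ncard_neighbors hd hreg)
  obtain ⟨N, hN, hcov⟩ := IsEdgeMatching.of_isPerfectMatching hM
  have h1 := hN.ncard_coveredSet
  rw [hcov, Set.ncard_univ] at h1
  have h2 := hN.card_le_max
  obtain ⟨N', hN', hc'⟩ := exists_card_eq_max (G := G)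
  have h3 := hN'.two_mul_card_le
  omega

lemma maxDensity_regular_bipartite [Fintype V] [Nonempty V] (hd : 1 ≤ d) (hG : G.IsBipartite)
    (hreg : ∀ x : V, (G.neighborSet x).ncard = d) : maxDensity G = 1 := by
  have h := two_mul_maxMatchingSize hd hG hreg
  have hv := card_pos_real (V := V)
  rw [maxDensity, div_eq_one_iff_eq hv.ne', ← h]
  push_cast
  ring

lemma numPerfectMatchings_eq [Fintype V] {n : ℕ} (hn : Nat.card V = 2 * n) :
    numPerfectMatchings G = numMatchings G n := by
  unfold numPerfectMatchings numMatchings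
  congr 1
  ext N
  refine and_congr_right fun hN => ?_
  have h1 := hN.ncard_coveredSet
  constructor
  · intro h
    have : coveredSet N = Set.univ := Set.eq_univ_of_forall h
    rw [this, Set.ncard_univ] at h1
    omega
  · intro h x
    have h2 : (coveredSet N) = Set.univ := by
      refine Set.eq_of_subset_of_ncard_le (Set.subset_univ _) ?_ (Set.toFinite _)
      rw [Set.ncard_univ, h1, h, hn]
    have : x ∈ coveredSet N := h2 ▸ Set.mem_univ x
    exact this

lemma graphEntropy_twoLiftSequence_le [Finite V] [Nonempty V] (hG : G.IsBipartite)
    {Gs : ∀ i, SimpleGraph (LiftVertex V i)} (h : IsTwoLiftSequence G Gs) {p : ℝ} (hp : 0 ≤ p)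
    (i : ℕ) : graphEntropy (Gs i) p ≤ graphEntropy G p := by
  induction i with
  | zero => rw [h.1]; exact le_rfl
  | succ i ih =>
    let _ : Fintype (LiftVertex V i) := Fintype.ofFinite _
    exact (graphEntropy_twoLift_le (h.2 i) (isBipartite_twoLiftSequence h hG i) hp).trans ih

lemma one_le_maxDensity_twoLiftSequence [Finite V] [Nonempty V] (hd : 1 ≤ d) (hG : G.IsBipartite)
    (hreg : ∀ x : V, (G.neighborSet x).ncard = d) {Gs : ∀ i, SimpleGraph (LiftVertex V i)}
    (h : IsTwoLiftSequence G Gs) (i : ℕ) : 1 ≤ maxDensity (Gs i) := by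
  let _ : Fintype (LiftVertex V i) := Fintype.ofFinite _
  exact (maxDensity_regular_bipartite hd (isBipartite_twoLiftSequence h hG i)
    (neighborSet_ncard_twoLiftSequence h hreg i)).ge

/-- For `p < 1` the entropies along a lift sequence converge to `𝔾_d(p)` and never exceed that of
`G`. At `p = 1` the bound passes to the limit in the objective for each fixed `s`, hence to the
infimum. -/
lemma gurvitsFn_le_graphEntropy [Finite V] [Nonempty V] (hd : 1 ≤ d) (hG : G.IsBipartite)
    (hreg : ∀ x : V, (G.neighborSet x).ncard = d) {p : ℝ} (hp0 : 0 ≤ p) (hp : p ≤ 1) :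
    gurvitsFn d p ≤ graphEntropy G p := by
  cases nonempty_fintype V
  have hlt : ∀ q : ℝ, 0 ≤ q → q < 1 → gurvitsFn d q ≤ graphEntropy G q := by
    intro q hq0 hq
    obtain ⟨Gs, hseq, hconv⟩ := exists_twoLiftSequence_converging G hreg
    exact le_of_tendsto (tendsto_graphEntropy_of_BS hd hconv
      (one_le_maxDensity_twoLiftSequence hd hG hreg hseq) hq0 hq)
      (Eventually.of_forall fun i => graphEntropy_twoLiftSequence_le hG hseq hq0 i)
  rcases hp.lt_or_eq with hp | rfl
  · exact hlt p hp0 hp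
  have hmax := maxDensity_regular_bipartite hd hG hreg
  refine (isGLB_graphEntropy zero_le_one hmax.ge).2 ?_
  rintro _ ⟨s, hs, rfl⟩
  have hc : ContinuousAt (fun q => entropyObjective G q s) 1 := by
    unfold entropyObjective; fun_prop
  refine le_of_tendsto_of_tendsto
    ((continuousAt_gurvitsFn hd).tendsto.mono_left nhdsWithin_le_nhds)
    (hc.tendsto.mono_left (nhdsWithin_le_nhds (s := Set.Iio 1))) ?_
  filter_upwards [self_mem_nhdsWithin, nhdsWithin_le_nhds (lt_mem_nhds zero_lt_one)] with q hq hq0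
  have hq1 : q < 1 := hq
  exact (hlt q (le_of_lt hq0) hq1).trans
    ((isGLB_graphEntropy (le_of_lt hq0) (hq1.le.trans hmax.ge)).1 ⟨s, hs, rfl⟩)

lemma schrijver_base_eq (hd : 1 ≤ d) :
    ((d : ℝ) - 1) ^ (d - 1) / (d : ℝ) ^ ((d : ℤ) - 2) = d * (1 - 1 / (d : ℝ)) ^ (d - 1) := by
  have hd0 : (d : ℝ) ≠ 0 := by positivity
  obtain ⟨e, rfl⟩ : ∃ e, d = e + 1 := ⟨d - 1, by omega⟩
  have h1 : (1 : ℝ) - 1 / ((e + 1 : ℕ) : ℝ) = (((e + 1 : ℕ) : ℝ) - 1) / ((e + 1 : ℕ) : ℝ) := by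
    field_simp
  rw [h1, div_pow, zpow_sub₀ hd0, zpow_natCast, Nat.add_sub_cancel]
  generalize ((e + 1 : ℕ) : ℝ) = y at hd0
  rw [pow_succ]
  have : y ^ (2 : ℤ) = y * y := by rw [zpow_ofNat, sq]
  rw [this]
  field_simp

lemma log_schrijver_base (hd : 1 ≤ d) :
    0 < (d : ℝ) * (1 - 1 / (d : ℝ)) ^ (d - 1) ∧
      Real.log (d * (1 - 1 / (d : ℝ)) ^ (d - 1)) = 2 * gurvitsFn d 1 := by
  have hd1 : (1 : ℝ) ≤ d := by exact_mod_cast hd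
  have hd0 : (0 : ℝ) < d := by linarith
  have hpos : 0 < (1 - 1 / (d : ℝ)) ^ (d - 1) := by
    rcases hd.eq_or_lt with rfl | h
    · simp
    · have h2 : (1 : ℝ) < d := by exact_mod_cast h
      have : 1 / (d : ℝ) < 1 := (div_lt_one hd0).2 h2
      exact pow_pos (by linarith) _
  refine ⟨mul_pos hd0 hpos, ?_⟩
  rw [Real.log_mul hd0.ne' hpos.ne', Real.log_pow, gurvitsFn, Nat.cast_sub hd]
  simp

/-- All largest matchings are perfect, so the entropy at `1` is `ln pm(G) / (2n)`; the base of the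
bound is `exp (2 𝔾_d(1))`. -/
lemma schrijver_bound [Finite V] [Nonempty V] (hd : 1 ≤ d) (hG : G.IsBipartite)
    (hreg : ∀ x : V, (G.neighborSet x).ncard = d) {n : ℕ} (hn : Nat.card V = 2 * n) :
    (((d : ℝ) - 1) ^ (d - 1) / (d : ℝ) ^ ((d : ℤ) - 2)) ^ n ≤ (numPerfectMatchings G : ℝ) := by
  cases nonempty_fintype V
  obtain ⟨hb, hlog⟩ := log_schrijver_base hd
  have hmaxD := maxDensity_regular_bipartite hd hG hreg
  have hmax : maxMatchingSize G = n := by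
    have := two_mul_maxMatchingSize hd hG hreg
    omega
  have hv := card_pos_real (V := V)
  have hcast : (Nat.card V : ℝ) = 2 * n := by rw [hn]; push_cast; ring
  have hm : (0 : ℝ) < numMatchings G n := by
    have := numMatchings_max_pos (G := G)
    rw [hmax] at this
    exact_mod_cast this
  have h1 := gurvitsFn_le_graphEntropy hd hG hreg zero_le_one le_rfl
  have h2 := graphEntropy_maxDensity (G := G)
  rw [hmaxD, hmax] at h2
  rw [h2, le_div_iff₀ hv, hcast] at h1
  rw [schrijver_base_eq hd, numPerfectMatchings_eq hn, ← Real.log_le_log_iff (pow_pos hb n) hm,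
    Real.log_pow, hlog]
  linarith

end RegularBipartite

/-! ### The entropy function of the tree -/

section TreeLimit

variable {d : ℕ}

/-- Lift the complete bipartite graph `K_{d,d}`; bipartiteness and regularity persist, so every
member has a perfect matching. -/
lemma exists_convergingSequence (hd : 1 ≤ d) :
    ∃ (V : ℕ → Type) (G : ∀ i : ℕ, SimpleGraph (V i)),
      BSConvergesTo G (regularTree d) (treeRoot d) ∧ ∀ i : ℕ, 1 ≤ maxDensity (G i) := by
  have : Nonempty (Fin d) := ⟨⟨0, hd⟩⟩
  set K := completeBipartiteGraph (Fin d) (Fin d) with hK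
  have hreg : ∀ x, (K.neighborSet x).ncard = d := by
    rintro (x | x)
    · have : K.neighborSet (Sum.inl x) = Set.range Sum.inr := by
        ext (y | y) <;> simp [hK]
      rw [this, ← Set.image_univ, Set.ncard_image_of_injective _ Sum.inr_injective, Set.ncard_univ,
        Nat.card_fin]
    · have : K.neighborSet (Sum.inr x) = Set.range Sum.inl := by
        ext (y | y) <;> simp [hK]
      rw [this, ← Set.image_univ, Set.ncard_image_of_injective _ Sum.inl_injective, Set.ncard_univ,
        Nat.card_fin]
  have hbip : K.IsBipartite := by
    refine ⟨SimpleGraph.Coloring.mk (Sum.elim (fun _ => 0) fun _ => 1) ?_⟩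
    rintro (x | x) (y | y) h <;> simp [hK] at h ⊢
  obtain ⟨Gs, hseq, hconv⟩ := exists_twoLiftSequence_converging K hreg
  exact ⟨_, Gs, hconv, one_le_maxDensity_twoLiftSequence hd hbip hreg hseq⟩

lemma isLimitEntropy_gurvitsFn (hd : 1 ≤ d) {p : ℝ} (hp0 : 0 ≤ p) (hp : p < 1) :
    IsLimitEntropy (regularTree d) (treeRoot d) 1 p (gurvitsFn d p) :=
  ⟨exists_convergingSequence hd, fun _ _ hconv hmax =>
    tendsto_graphEntropy_of_BS hd hconv hmax hp0 hp⟩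

/-- The value chosen by `Classical.epsilon` is a limit along every admissible sequence. Since one
such sequence exists, uniqueness of limits determines it. -/
lemma treeEntropy_eq_of_lt (hd : 1 ≤ d) {p : ℝ} (hp0 : 0 ≤ p) (hp : p < 1) :
    treeEntropy d p = gurvitsFn d p := by
  have h := isLimitEntropy_gurvitsFn hd hp0 hp
  have h' := Classical.epsilon_spec (p := IsLimitEntropy (regularTree d) (treeRoot d) 1 p) ⟨_, h⟩
  rw [treeEntropy, limitEntropy, if_pos hp]
  obtain ⟨V, G, hconv, hmax⟩ := h.1
  exact tendsto_nhds_unique (h'.2 V G hconv hmax) (h.2 V G hconv hmax)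

lemma tendsto_treeEntropy (hd : 1 ≤ d) :
    Tendsto (treeEntropy d) (𝓝[<] 1) (𝓝 (gurvitsFn d 1)) := by
  refine ((continuousAt_gurvitsFn hd).tendsto.mono_left nhdsWithin_le_nhds).congr' ?_
  filter_upwards [self_mem_nhdsWithin, nhdsWithin_le_nhds (lt_mem_nhds zero_lt_one)] with q hq hq0
  exact (treeEntropy_eq_of_lt hd (le_of_lt hq0) hq).symm

lemma treeEntropy_eq (hd : 1 ≤ d) {p : ℝ} (hp0 : 0 ≤ p) (hp : p ≤ 1) :
    treeEntropy d p = gurvitsFn d p := by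
  rcases hp.lt_or_eq with hp | rfl
  · exact treeEntropy_eq_of_lt hd hp0 hp
  · rw [treeEntropy, limitEntropy, if_neg (lt_irrefl _)]
    refine Tendsto.limUnder_eq ((tendsto_treeEntropy hd).congr' ?_)
    filter_upwards [self_mem_nhdsWithin] with q hq
    rw [treeEntropy, limitEntropy, if_pos (show q < 1 from hq)]

end TreeLimit

end

theorem mainTheorem2 (d : ℕ) (hd : 1 ≤ d) :
    -- the entropy function of the tree is well defined, and equals `𝔾_d`
    (∀ p ∈ Set.Ico (0 : ℝ) 1,
      IsLimitEntropy (regularTree d) (treeRoot d) 1 p (treeEntropy d p)) ∧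
    Tendsto (treeEntropy d) (𝓝[<] 1) (𝓝 (treeEntropy d 1)) ∧
    (∀ p ∈ Set.Icc (0 : ℝ) 1, treeEntropy d p = gurvitsFn d p) ∧
    -- a `2`-lift of a bipartite graph does not have larger entropy
    (∀ (V : Type u) [Finite V] [Nonempty V] (G : SimpleGraph V) (H : SimpleGraph (V × Fin 2)),
      G.IsBipartite → IsTwoLift G H →
        ∀ p ∈ Set.Icc (0 : ℝ) 1, graphEntropy H p ≤ graphEntropy G p) ∧
    -- every `d`-regular graph starts a sequence of `2`-lifts that converges to the tree
    (∀ (V : Type u) [Finite V] [Nonempty V] (G : SimpleGraph V),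
      (∀ x : V, (G.neighborSet x).ncard = d) →
        ∃ Gs : ∀ i : ℕ, SimpleGraph (LiftVertex V i),
          IsTwoLiftSequence G Gs ∧ BSConvergesTo Gs (regularTree d) (treeRoot d)) ∧
    -- the bounds for `d`-regular bipartite graphs
    (∀ (V : Type u) [Finite V] [Nonempty V] (G : SimpleGraph V) (n : ℕ),
      G.IsBipartite → (∀ x : V, (G.neighborSet x).ncard = d) → Nat.card V = 2 * n →
        (∀ p ∈ Set.Icc (0 : ℝ) 1, treeEntropy d p ≤ graphEntropy G p) ∧
        (∀ k : ℕ, k ≤ n →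
          0 < numMatchings G k ∧
          gurvitsFn d ((k : ℝ) / (n : ℝ)) - Real.log (2 * (n : ℝ)) / (2 * (n : ℝ)) ≤
            Real.log (numMatchings G k : ℝ) / (2 * (n : ℝ))) ∧
        (((d : ℝ) - 1) ^ (d - 1) / (d : ℝ) ^ ((d : ℤ) - 2)) ^ n ≤
          (numPerfectMatchings G : ℝ)) := by
  refine ⟨fun p hp => ?_, ?_, fun p hp => treeEntropy_eq hd hp.1 hp.2, ?_, ?_, ?_⟩
  · rw [treeEntropy_eq hd hp.1 hp.2.le]
    exact isLimitEntropy_gurvitsFn hd hp.1 hp.2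
  · rw [treeEntropy_eq hd zero_le_one le_rfl]
    exact tendsto_treeEntropy hd
  · intro V _ _ G H hG hH p hp
    cases nonempty_fintype V
    exact graphEntropy_twoLift_le hH hG hp.1
  · intro V _ _ G hreg
    exact exists_twoLiftSequence_converging G hreg
  · intro V _ _ G n hG hreg hn
    cases nonempty_fintype V
    have hmax : maxMatchingSize G = n := by
      have := two_mul_maxMatchingSize hd hG hreg
      omega
    refine ⟨fun p hp => ?_, fun k hk => ⟨numMatchings_pos_of_le (hmax ▸ hk), ?_⟩,
      schrijver_bound hd hG hreg hn⟩
    · rw [treeEntropy_eq hd hp.1 hp.2]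
      exact gurvitsFn_le_graphEntropy hd hG hreg hp.1 hp.2
    · have hkn : (k : ℝ) / n ≤ 1 :=
        div_le_one_of_le₀ (by exact_mod_cast hk) (Nat.cast_nonneg _)
      have h1 := gurvitsFn_le_graphEntropy hd hG hreg
        (show (0 : ℝ) ≤ (k : ℝ) / n by positivity) hkn
      have h2 := graphEntropy_le_log_numMatchings hn hmax hk
      linarith
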